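/- **Setting.** Let $\mathcal U$ and $\mathcal V$ be finite sets of exogenous and endogenous variables, and let every variable $Z\in\mathcal U\cup\mathcal V$ have a non-empty finite range $\mathcal R(Z)\subset\mathbb R$. A causal model $\mathcal M$ consists of a function $\mathcal F_X:\prod_{Z\in\mathcal U\cup\mathcal V}\mathcal R(Z)\to\mathcal R(X)$ for every $X\in\mathcal V$; cyclic dependencies are allowed. A temporal context is a sequence $u:\mathbb N\to\prod_{U\in\mathcal U}\mathcal R(U)$, and a default assignment is an element $v\in\prod_{X\in\mathcal V}\mathcal R(X)$. An intervention is a finite (possibly empty) tuple $int=(Y_1(n_1)\leftarrow y_1,\dots,Y_k(n_k)\leftarrow y_k)$ with $Y_i\in\mathcal V$, $n_i\in\mathbb N$, $y_i\in\mathcal R(Y_i)$, in which no variable is set twice at the same time. The updated computation $\mathcal C^{int}:\mathbb N\to\prod_{X\in\mathcal V}\mathcal R(X)$ has $\mathcal C^{int}(i)|_X=x$ if $X(i)\leftarrow x$ occurs in $int$; otherwise $\mathcal C^{int}(0)|_X=v|_X$, and $\mathcal C^{int}(i)|_X=\mathcal F_X(u(i-1),\mathcal C^{int}(i-1))$ for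 $i>0$. PLTL formulas are built from atoms $X=x$ ($X\in\mathcal V$, $x\in\mathcal R(X)$) by $\neg$, $\wedge$, next, until, previous and since, with the usual semantics at positions of a sequence $\mathbb N\to\prod_{X\in\mathcal V}\mathcal R(X)$ (until and since are non-strict; previous is false at position $0$). CPLTL formulas are the Boolean combinations (by $\neg$, $\wedge$) of formulas $[int]\psi$ with $\psi$ in PLTL, where $(\mathcal M,u,v),t\models[int]\psi$ iff $\psi$ holds in $\mathcal C^{int}$ at position $t$. **Model-checking problem.** An instance consists of a causal model $\mathcal M$, an ultimately periodic temporal context $u$ given with $n\ge 0$ and $m\ge 1$ such that $u(k)=u(k+m)$ for all $k\ge n$, a default assignment $v$, a time $t\in\mathbb N$ and a CPLTL formula $\varphi$. The question is whether $(\mathcal M,u,v),t\models\varphi$. An instance is written as a word over a fixed finite alphabet, with all numbers in unary: the variables are numbered, a value is given by its rank in its range, the functions $\mathcal F_X$ are given extensionally by the table of all complete assignments of $\mathcal U\cup\mathcal V$ with the resulting values, $u$ is given by $n$, $m$ and $u(0),\dots,u(n+m-1)$, and $\varphi$ is written in prefix notation. The size of an instance is $|\mathcal M|+|u|+|v|+t+|\varphi|$,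 where $|\mathcal M|=|\mathcal U|+|\mathcal V|+\sum_{Z}|\mathcal R(Z)|+|\mathcal V|\cdot\prod_{Z}|\mathcal R(Z)|$, $|u|=n+m+\sum_{0\le j\le n+m}|\mathcal U|$, $|v|=|\mathcal V|$, and $|\varphi|$ is the number of symbols of $\varphi$ with the times in interventions written in unary. **Theorem (CPLTL model-checking is in P).** The set of words that encode an instance with $(\mathcal M,u,v),t\models\varphi$ is decidable by a deterministic Turing machine in polynomial time, i.e. it is in $\mathsf P$. Moreover the length of the word that encodes an instance is at most a polynomial in the size of the instance, so the machine's running time on instances is polynomial in their size. -/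

import Mathlib

noncomputable section

/-! ### Causal models -/

/-- A signature with exogenous variables `U` and endogenous variables `V`: every variable has a
non-empty finite range of real values. -/
structure Signature (U V : Type) where
  range : U ⊕ V → Finset ℝ
  nonempty : ∀ Z, (range Z).Nonempty

namespace Signature

variable {U V : Type} (S : Signature U V)

/-- The values that the variable `Z` can take. -/
abbrev Val (Z : U ⊕ V) : Type := {x : ℝ // x ∈ S.range Z}

/-- Complete assignments of the exogenous variables. -/
abbrev ExoAsg : Type := ∀ X : U, S.Val (Sum.inl X)

/-- Complete assignments of the endogenous variables. -/
abbrev EndoAsg : Type := ∀ X : V, S.Val (Sum.inr X)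

/-- Complete assignments of all variables. -/
abbrev Asg : Type := ∀ Z : U ⊕ V, S.Val Z

variable {S}

/-- The assignment of all variables that combines `u` and `v`. -/
def join (u : S.ExoAsg) (v : S.EndoAsg) : S.Asg
  | Sum.inl X => u X
  | Sum.inr X => v X

end Signature

/-- A causal model: one structural equation per endogenous variable. No acyclicity of the
dependencies is required. -/
structure CausalModel {U V : Type} (S : Signature U V) where
  eqn : ∀ X : V, S.Asg → S.Val (Sum.inr X)

/-! ### Interventions and computations -/

/-- One component `X(time) ← val` of an intervention. -/
structure TimedSetting {U V : Type} (S : Signature U V) where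
  var : V
  time : ℕ
  val : S.Val (Sum.inr var)

/-- A (possibly empty) tuple of components `X(n) ← x`; no variable is set twice at the same
time. -/
structure Intervention {U V : Type} (S : Signature U V) where
  entries : List (TimedSetting S)
  consistent : entries.Pairwise fun a b => a.var = b.var → a.time ≠ b.time

section Semantics

variable {U V : Type} {S : Signature U V}

open Classical in
/-- The value that the intervention gives to `X` at time `i`, and `d` if there is none. -/
def Intervention.override (int : Intervention S) (i : ℕ) (X : V) (d : S.Val (Sum.inr X)) :
    S.Val (Sum.inr X) :=
  if h : ∃ x, (⟨X, i, x⟩ : TimedSetting S) ∈ int.entries then h.choose else d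

/-- The updated computation of the scenario `(M, u, v)` under an intervention. -/
def CausalModel.computation (M : CausalModel S) (u : ℕ → S.ExoAsg) (v : S.EndoAsg)
    (int : Intervention S) : ℕ → S.EndoAsg
  | 0 => fun X => int.override 0 X (v X)
  | i + 1 => fun X =>
      int.override (i + 1) X (M.eqn X (Signature.join (u i) (M.computation u v int i)))

end Semantics

/-! ### The logics PLTL and CPLTL -/

/-- Formulas of linear-time temporal logic with past over the atoms `X = x`. -/
inductive PLTL {U V : Type} (S : Signature U V) : Type
  | atom (X : V) (x : S.Val (Sum.inr X))
  | neg (φ : PLTL S)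
  | conj (φ ψ : PLTL S)
  | nxt (φ : PLTL S)
  | untl (φ ψ : PLTL S)
  | prv (φ : PLTL S)
  | snce (φ ψ : PLTL S)

/-- Boolean combinations of formulas `[int] ψ` with `ψ` in PLTL. -/
inductive CPLTL {U V : Type} (S : Signature U V) : Type
  | box (int : Intervention S) (ψ : PLTL S)
  | neg (φ : CPLTL S)
  | conj (φ ψ : CPLTL S)

section Truth

variable {U V : Type} {S : Signature U V}

/-- Truth of a PLTL formula at a position of a linear model. -/
def PLTL.Holds (σ : ℕ → S.EndoAsg) : PLTL S → ℕ → Prop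
  | .atom X x, i => σ i X = x
  | .neg φ, i => ¬ φ.Holds σ i
  | .conj φ ψ, i => φ.Holds σ i ∧ ψ.Holds σ i
  | .nxt φ, i => φ.Holds σ (i + 1)
  | .untl φ ψ, i => ∃ j, ψ.Holds σ (i + j) ∧ ∀ k < j, φ.Holds σ (i + k)
  | .prv φ, i => 1 ≤ i ∧ φ.Holds σ (i - 1)
  | .snce φ ψ, i => ∃ k ≤ i, ψ.Holds σ k ∧ ∀ j, k < j → j ≤ i → φ.Holds σ j

/-- Truth of a CPLTL formula in the causal scenario `(M, u, v)` at time `t`. -/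
def CPLTL.Holds (M : CausalModel S) (u : ℕ → S.ExoAsg) (v : S.EndoAsg) (t : ℕ) :
    CPLTL S → Prop
  | .box int ψ => ψ.Holds (M.computation u v int) t
  | .neg φ => ¬ φ.Holds M u v t
  | .conj φ ψ => φ.Holds M u v t ∧ ψ.Holds M u v t

end Truth

/-! ### Instances of the model-checking problem -/

/-- An instance: the variables are numbered, and the temporal context comes with numbers `pre`
and `loop` that witness that it is ultimately periodic. -/
structure MCInstance where
  numExo : ℕ
  numEndo : ℕ
  sig : Signature (Fin numExo) (Fin numEndo)
  model : CausalModel sig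
  context : ℕ → sig.ExoAsg
  pre : ℕ
  loop : ℕ
  loop_pos : 0 < loop
  periodic : ∀ k, pre ≤ k → context k = context (k + loop)
  default : sig.EndoAsg
  time : ℕ
  formula : CPLTL sig

/-- The question asked about an instance. -/
def MCInstance.Holds (I : MCInstance) : Prop :=
  I.formula.Holds I.model I.context I.default I.time

/-! ### Encoding of instances as words, with all numbers in unary -/

/-- The finite alphabet of the encoding. -/
inductive CodeSym : Type
  | tick | bar | atom | neg | conj | nxt | untl | prv | snce | lbr | rbr | set
  deriving DecidableEq

/-- The number `n` in unary, with an end marker. -/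
def unary (n : ℕ) : List CodeSym := List.replicate n CodeSym.tick ++ [CodeSym.bar]

/-- A value is written as its rank in the range of its variable, counted from `0`. -/
def Signature.rank {U V : Type} (S : Signature U V) {Z : U ⊕ V} (x : S.Val Z) : ℕ :=
  ((S.range Z).filter (· < x.1)).card

section Encoding

variable {p q : ℕ} {S : Signature (Fin p) (Fin q)}

def PLTL.code : PLTL S → List CodeSym
  | .atom X x => CodeSym.atom :: (unary X ++ unary (S.rank x))
  | .neg φ => CodeSym.neg :: φ.code
  | .conj φ ψ => CodeSym.conj :: (φ.code ++ ψ.code)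
  | .nxt φ => CodeSym.nxt :: φ.code
  | .untl φ ψ => CodeSym.untl :: (φ.code ++ ψ.code)
  | .prv φ => CodeSym.prv :: φ.code
  | .snce φ ψ => CodeSym.snce :: (φ.code ++ ψ.code)

def TimedSetting.code (e : TimedSetting S) : List CodeSym :=
  CodeSym.set :: (unary e.var ++ unary e.time ++ unary (S.rank e.val))

def CPLTL.code : CPLTL S → List CodeSym
  | .box int ψ =>
      [CodeSym.lbr] ++ int.entries.flatMap TimedSetting.code ++ [CodeSym.rbr] ++ ψ.code
  | .neg φ => CodeSym.neg :: φ.code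
  | .conj φ ψ => CodeSym.conj :: (φ.code ++ ψ.code)

variable (S)

/-- All variables in their order: first the exogenous, then the endogenous ones. -/
def varList (p q : ℕ) : List (Fin p ⊕ Fin q) :=
  (List.finRange p).map Sum.inl ++ (List.finRange q).map Sum.inr

/-- All assignments that agree with `z` outside the given variables, in lexicographic order. -/
def Signature.asgsFrom : List (Fin p ⊕ Fin q) → S.Asg → List S.Asg
  | [], z => [z]
  | Z :: Zs, z =>
      ((Finset.univ : Finset (S.Val Z)).sort (· ≤ ·)).flatMap fun x =>
        Signature.asgsFrom Zs (Function.update z Z x)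

/-- All complete assignments, each one once, in lexicographic order. The assignment that the
enumeration starts from is irrelevant, since every variable is overwritten. -/
def Signature.asgs : List S.Asg :=
  S.asgsFrom (varList p q) fun Z => ⟨(S.nonempty Z).choose, (S.nonempty Z).choose_spec⟩

variable {S}

/-- The structural equations, given extensionally: one row for each complete assignment `z`, with
the values of all variables in `z` followed by the values of all structural equations at `z`. -/
def CausalModel.code (M : CausalModel S) : List CodeSym :=
  S.asgs.flatMap fun z =>
    ((varList p q).flatMap fun Z => unary (S.rank (z Z))) ++
      (List.finRange q).flatMap fun X => unary (S.rank (M.eqn X z))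

end Encoding

/-- The word that presents an instance: the numbers of variables, the sizes of their ranges, the
structural equations, the lengths of the prefix and of the loop of the temporal context and its
values on prefix and loop, the default assignment, the time, and the formula. -/
def MCInstance.code (I : MCInstance) : List CodeSym :=
  unary I.numExo ++ unary I.numEndo ++
  ((varList I.numExo I.numEndo).flatMap fun Z => unary (I.sig.range Z).card) ++
  I.model.code ++
  unary I.pre ++ unary I.loop ++
  ((List.range (I.pre + I.loop)).flatMap fun j =>
    (List.finRange I.numExo).flatMap fun X => unary (I.sig.rank (I.context j X))) ++
  ((List.finRange I.numEndo).flatMap fun X => unary (I.sig.rank (I.default X))) ++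
  unary I.time ++
  I.formula.code

/-- The CPLTL model-checking problem: the words that present a true instance. -/
def cpltlModelChecking : Language CodeSym :=
  {w | ∃ I : MCInstance, I.code = w ∧ I.Holds}

/-! ### Size of instances -/

section Size

variable {U V : Type} {S : Signature U V}

/-- The number of symbols, an atom `X = x` counting as three. -/
def PLTL.size : PLTL S → ℕ
  | .atom _ _ => 3
  | .neg φ => φ.size + 1
  | .conj φ ψ => φ.size + ψ.size + 1
  | .nxt φ => φ.size + 1
  | .untl φ ψ => φ.size + ψ.size + 1
  | .prv φ => φ.size + 1
  | .snce φ ψ => φ.size + ψ.size + 1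

/-- The number of symbols, with the time `n` in a component `Y(n) ← y` written in unary, so that
the component counts as `n` plus five symbols. -/
def CPLTL.size : CPLTL S → ℕ
  | .box int ψ => (int.entries.map fun e => e.time + 5).sum + ψ.size + 2
  | .neg φ => φ.size + 1
  | .conj φ ψ => φ.size + ψ.size + 1

/-- `|U| + |V| + |R| + |F|`, where `|R|` is the total size of the ranges and `|F|` the number of
tuples in the extensional definition of the structural equations. -/
def CausalModel.size [Fintype U] [Fintype V] (_ : CausalModel S) : ℕ :=
  Fintype.card U + Fintype.card V + (∑ Z, (S.range Z).card) +
    Fintype.card V * ∏ Z, (S.range Z).card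

end Size

/-- The size of an instance with all numbers in unary: the model, the temporal context (its type
and its values on prefix and loop), the default assignment, the time and the formula. -/
def MCInstance.size (I : MCInstance) : ℕ :=
  I.model.size + (I.pre + I.loop + ∑ _j ∈ Finset.range (I.pre + I.loop + 1), I.numExo) +
    I.numEndo + I.time + I.formula.size

/-! ### The complexity class P -/

/-- `L` is in P: a deterministic multi-stack Turing machine with finite alphabets decides for every
word, in a number of steps bounded by a polynomial in the length of the word, whether it belongs
to `L`. -/
def InP {Γ : Type} (L : Language Γ) : Prop :=
  ∃ (f : List Γ → Bool)
    (M : Turing.TM2ComputableInPolyTime (id : List Γ → List Γ) Computability.encodeBool f),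
    (∀ k, Finite (M.tm.Γ k)) ∧ ∀ w, f w = true ↔ w ∈ L

end

/-! Once the prefix of the context and all settings of an intervention are past, the next values
depend only on the current values and on the time modulo `loop`. By pigeonhole the computation is
ultimately periodic, with period at most `loop` times the number of endogenous assignments
(`exists_period`). The table of the structural equations has at least one entry for each complete
assignment, so this bound is polynomial in the length of the word.

Truth of a PLTL formula along such a computation is ultimately periodic as well, and each connective
delays the onset by at most one period (`holds_add_period_iff`). Hence the least witness of an
until-formula lies inside a long initial segment, unless the position is close to its end
(`untilList_truths`); since and previous only look back. Truth values can therefore be computed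
connective by connective on an initial segment that loses boundedly many positions each time
(`foldr_evalStep`), and a segment of polynomial length decides `[int] ψ` (`evalBox_frontOf`).

A word need not encode anything, so the procedure `accept` also validates it. The numbers before the
formula are compared with the ranges they announce, and the formula is parsed from right to left
with a stack. Whatever passes comes from an instance (`exists_frontOf`, `represents_parse`), and
every true instance passes (`readFront_nums`, `check_frontOf`, `parse_formToks`). A malformed word
can announce exponentially many assignments, so their enumeration is cut off at a bound that no
valid word exceeds.

For the machine, a small language of programs on binary trees, with a cost semantics, is compiled to
multi-stack Turing machines (`runs_ofProg`). The functions computed by such programs at polynomial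
cost are closed under composition, and under folds whose intermediate results stay polynomially
large (`Poly.foldl_of_bound`). This class contains `accept` (`Poly.accept`), and `inP_of_poly` turns
it into a machine. The bound on the length of the encoding is a separate count (`length_code_le`).
-/

noncomputable section

/-! ### Fragments of multi-stack Turing machines -/

namespace TreeProg

open Turing TM2

instance : Fintype CodeSym :=
  ⟨{.tick, .bar, .atom, .neg, .conj, .nxt, .untl, .prv, .snce, .lbr, .rbr, .set},
    fun x => by cases x <;> decide⟩

/-- The stacks: input, output, the main stack, two auxiliary stacks and a unary counter. -/
inductive Stk : Type
  | inp | out | main | auxA | auxB | cnt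
  deriving DecidableEq

instance : Fintype Stk :=
  ⟨{.inp, .out, .main, .auxA, .auxB, .cnt}, fun x => by cases x <;> decide⟩

/-- Symbols on the working stacks: a leaf label, or `none` for an inner node. -/
abbrev Sym : Type := Option CodeSym

/-- The alphabets of the stacks. -/
@[reducible] def Stk.Alph : Stk → Type
  | .inp => CodeSym
  | .out => Bool
  | .main => Sym
  | .auxA => Sym
  | .auxB => Sym
  | .cnt => Sym

/-- The internal memory of the machines: the symbol that was read last. -/
abbrev Reg : Type := Option Sym

abbrev Stacks : Type := ∀ k : Stk, List k.Alph

/-- The stacks with given contents. -/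
def conf (i : List CodeSym) (o : List Bool) (m a b c : List Sym) : Stacks
  | .inp => i
  | .out => o
  | .main => m
  | .auxA => a
  | .auxB => b
  | .cnt => c

section Stacks

variable (i i' : List CodeSym) (o o' : List Bool) (m a b c x : List Sym)

@[simp] theorem conf_inp : conf i o m a b c .inp = i := rfl
@[simp] theorem conf_out : conf i o m a b c .out = o := rfl
@[simp] theorem conf_main : conf i o m a b c .main = m := rfl
@[simp] theorem conf_auxA : conf i o m a b c .auxA = a := rfl
@[simp] theorem conf_auxB : conf i o m a b c .auxB = b := rfl
@[simp] theorem conf_cnt : conf i o m a b c .cnt = c := rfl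

@[simp] theorem update_inp :
    Function.update (conf i o m a b c) Stk.inp i' = conf i' o m a b c := by
  funext k; cases k <;> rfl
@[simp] theorem update_out :
    Function.update (conf i o m a b c) Stk.out o' = conf i o' m a b c := by
  funext k; cases k <;> rfl
@[simp] theorem update_main :
    Function.update (conf i o m a b c) Stk.main x = conf i o x a b c := by
  funext k; cases k <;> rfl
@[simp] theorem update_auxA :
    Function.update (conf i o m a b c) Stk.auxA x = conf i o m x b c := by
  funext k; cases k <;> rfl
@[simp] theorem update_auxB :
    Function.update (conf i o m a b c) Stk.auxB x = conf i o m a x c := by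
  funext k; cases k <;> rfl
@[simp] theorem update_cnt :
    Function.update (conf i o m a b c) Stk.cnt x = conf i o m a b x := by
  funext k; cases k <;> rfl

end Stacks

/-- Statements over the stacks `Stk`. -/
abbrev Code (L : Type) : Type := Stmt Stk.Alph L Reg

/-- Renaming of labels in a statement. -/
def mapLabels {L L' : Type} (g : L → L') : Code L → Code L'
  | .push k f q => .push k f (mapLabels g q)
  | .peek k f q => .peek k f (mapLabels g q)
  | .pop k f q => .pop k f (mapLabels g q)
  | .load f q => .load f (mapLabels g q)
  | .branch f q r => .branch f (mapLabels g q) (mapLabels g r)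
  | .goto l => .goto fun v => g (l v)
  | .halt => .halt

theorem stepAux_mapLabels {L L' : Type} (g : L → L') (q : Code L) (v : Reg) (S : Stacks) :
    stepAux (mapLabels g q) v S =
      ⟨(stepAux q v S).l.map g, (stepAux q v S).var, (stepAux q v S).stk⟩ := by
  induction q generalizing v S with
  | branch f q r hq hr =>
    simp only [mapLabels, stepAux]
    cases f v <;> simp [hq, hr]
  | goto l => rfl
  | halt => rfl
  | _ => simp_all [mapLabels]

/-- A piece of machine code; a jump to `none` leaves it. -/
structure Frag where
  Lab : Type
  fin : Fintype Lab
  start : Lab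
  code : Lab → Code (Option Lab)

namespace Frag

/-- `F.Reach n l S T`: started at label `l` with stacks `S` and arbitrary memory, the fragment is
left after `n` steps with stacks `T`. -/
inductive Reach (F : Frag) : ℕ → Option F.Lab → Stacks → Stacks → Prop
  | exit (S) : Reach F 0 none S S
  -- The memory is universally quantified on entry: no block may rely on what an earlier one left
  -- there, so fragments compose in terms of stack contents alone.
  | step {n l l' S S' T} (h : ∀ v, ∃ v', stepAux (F.code l) v S = ⟨some l', v', S'⟩)
      (hr : Reach F n l' S' T) : Reach F (n + 1) (some l) S T

/-- A copy of `F` inside `G`, with labels renamed by `e`, runs as `F` does until it exits; the run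
then goes on at the label to which `e` sends the exit. The correctness of every combinator below is
an instance of this. -/
theorem Reach.embed {F G : Frag} (e : Option F.Lab → Option G.Lab)
    (he : ∀ l, ∃ l', e (some l) = some l' ∧ G.code l' = mapLabels e (F.code l))
    {n m : ℕ} {l : Option F.Lab} {S S' T : Stacks} (h : F.Reach n l S S')
    (h' : G.Reach m (e none) S' T) : G.Reach (n + m) (e l) S T := by
  induction h with
  | exit S => simpa using h'
  | @step n l l₁ S S₁ T' hs _ ih =>
    obtain ⟨l', hl, hc⟩ := he l
    rw [hl, Nat.add_right_comm]
    refine .step (fun v => ?_) (ih h')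
    obtain ⟨v', hv⟩ := hs v
    exact ⟨v', by rw [hc, stepAux_mapLabels, hv]; rfl⟩

/-- From its start the fragment transforms the stacks `S` into `T` in at most `c` steps. -/
def Runs (F : Frag) (c : ℕ) (S T : Stacks) : Prop :=
  ∃ n ≤ c, F.Reach n (some F.start) S T

theorem Runs.mono {F : Frag} {c d : ℕ} {S T : Stacks} (h : F.Runs c S T) (hcd : c ≤ d) :
    F.Runs d S T :=
  let ⟨n, hn, hr⟩ := h
  ⟨n, hn.trans hcd, hr⟩

/-- One fragment after another. -/
def seq (F G : Frag) : Frag where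
  Lab := F.Lab ⊕ G.Lab
  fin := letI := F.fin; letI := G.fin; inferInstance
  start := .inl F.start
  code
    | .inl l => mapLabels (fun | none => some (.inr G.start) | some l => some (.inl l)) (F.code l)
    | .inr l => mapLabels (Option.map .inr) (G.code l)

theorem Runs.seq {F G : Frag} {c d : ℕ} {S T U : Stacks} (h : F.Runs c S T) (h' : G.Runs d T U) :
    (F.seq G).Runs (c + d) S U := by
  obtain ⟨n, hn, hr⟩ := h
  obtain ⟨m, hm, hr'⟩ := h'
  refine ⟨n + (m + 0), by omega, ?_⟩
  have h2 : (F.seq G).Reach (m + 0) (some (.inr G.start)) T U :=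
    Reach.embed (G := F.seq G) (Option.map .inr) (fun l => ⟨.inr l, rfl, rfl⟩) hr' (.exit U)
  exact Reach.embed (G := F.seq G)
    (fun | none => some (.inr G.start) | some l => some (.inl l))
    (fun l => ⟨.inl l, rfl, rfl⟩) hr h2

/-- A single statement that leaves the fragment, given without its final jump. -/
def single (q : Code (Option Unit)) : Frag where
  Lab := Unit
  fin := inferInstance
  start := ()
  code _ := q

theorem runs_single {q : Code (Option Unit)} {S T : Stacks}
    (h : ∀ v, ∃ v', stepAux q v S = ⟨some none, v', T⟩) : (single q).Runs 1 S T :=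
  ⟨0 + 1, le_rfl, .step h (.exit T)⟩

/-- A two-way branch: the statement `q` jumps to `true` or `false`. -/
def branch (q : Code Bool) (F G : Frag) : Frag where
  Lab := Option (F.Lab ⊕ G.Lab)
  fin := letI := F.fin; letI := G.fin; inferInstance
  start := none
  code
    | none => mapLabels (fun b => some (some (cond b (.inl F.start) (.inr G.start)))) q
    | some (.inl l) => mapLabels (Option.map (some ∘ .inl)) (F.code l)
    | some (.inr l) => mapLabels (Option.map (some ∘ .inr)) (G.code l)

theorem Runs.branch_true {q : Code Bool} {F G : Frag} {c : ℕ} {S T U : Stacks}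
    (hq : ∀ v, ∃ v', stepAux q v S = ⟨some true, v', T⟩) (h : F.Runs c T U) :
    (branch q F G).Runs (c + 1) S U := by
  obtain ⟨n, hn, hr⟩ := h
  refine ⟨n + 0 + 1, by omega, .step (l' := some (some (.inl F.start))) (S' := T) (fun v => ?_) ?_⟩
  · obtain ⟨v', hv⟩ := hq v
    exact ⟨v', by simp only [branch, stepAux_mapLabels, hv]; rfl⟩
  · exact Reach.embed (G := branch q F G) (Option.map (some ∘ .inl))
      (fun l => ⟨some (.inl l), rfl, rfl⟩) hr (.exit U)

theorem Runs.branch_false {q : Code Bool} {F G : Frag} {c : ℕ} {S T U : Stacks}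
    (hq : ∀ v, ∃ v', stepAux q v S = ⟨some false, v', T⟩) (h : G.Runs c T U) :
    (branch q F G).Runs (c + 1) S U := by
  obtain ⟨n, hn, hr⟩ := h
  refine ⟨n + 0 + 1, by omega, .step (l' := some (some (.inr G.start))) (S' := T) (fun v => ?_) ?_⟩
  · obtain ⟨v', hv⟩ := hq v
    exact ⟨v', by simp only [branch, stepAux_mapLabels, hv]; rfl⟩
  · exact Reach.embed (G := branch q F G) (Option.map (some ∘ .inr))
      (fun l => ⟨some (.inr l), rfl, rfl⟩) hr (.exit U)

/-- A loop: the statement `q` jumps to `true` to run the body, and to `false` to leave. -/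
def loop (q : Code Bool) (F : Frag) : Frag where
  Lab := Option F.Lab
  fin := letI := F.fin; inferInstance
  start := none
  code
    | none => mapLabels (fun b => cond b (some (some F.start)) none) q
    | some l => mapLabels some (F.code l)

theorem Runs.loop_done {q : Code Bool} {F : Frag} {S T : Stacks}
    (hq : ∀ v, ∃ v', stepAux q v S = ⟨some false, v', T⟩) : (loop q F).Runs 1 S T := by
  refine ⟨0 + 1, le_rfl, .step (l' := none) (fun v => ?_) (.exit T)⟩
  obtain ⟨v', hv⟩ := hq v
  exact ⟨v', by simp only [loop, stepAux_mapLabels, hv]; rfl⟩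

theorem Runs.loop_step {q : Code Bool} {F : Frag} {c d : ℕ} {S T U V : Stacks}
    (hq : ∀ v, ∃ v', stepAux q v S = ⟨some true, v', T⟩) (h : F.Runs c T U)
    (h' : (loop q F).Runs d U V) : (loop q F).Runs (c + d + 1) S V := by
  obtain ⟨n, hn, hr⟩ := h
  obtain ⟨m, hm, hr'⟩ := h'
  refine ⟨n + m + 1, by omega, .step (l' := some (some F.start)) (S' := T) (fun v => ?_) ?_⟩
  · obtain ⟨v', hv⟩ := hq v
    exact ⟨v', by simp only [loop, stepAux_mapLabels, hv]; rfl⟩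
  · exact Reach.embed (G := loop q F) some (fun l => ⟨some l, rfl, rfl⟩) hr hr'

/-- A fragment without instructions to speak of. -/
def skip : Frag := single (.goto fun _ => none)

theorem runs_skip (S : Stacks) : skip.Runs 1 S S := runs_single fun v => ⟨v, rfl⟩

end Frag

/-! ### Trees on stacks -/

/-- Binary trees with labelled leaves: the data of the programs below. -/
inductive Data : Type
  | leaf (s : CodeSym)
  | node (l r : Data)

namespace Data

/-- The number of vertices. -/
def size : Data → ℕ
  | leaf _ => 1
  | node l r => l.size + r.size + 1

/-- Trees are stored on stacks in prefix order. -/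
def word : Data → List Sym
  | leaf s => [some s]
  | node l r => none :: (l.word ++ r.word)

theorem length_word (x : Data) : x.word.length = x.size := by
  induction x with
  | leaf => rfl
  | node l r hl hr => simp [word, size, hl, hr]

end Data

namespace Frag

/-- Push on one of the two auxiliary stacks. -/
def pushAux {L : Type} (k : Bool) (f : Reg → Sym) (q : Code L) : Code L :=
  bif k then .push .auxA f q else .push .auxB f q

/-- Move the topmost tree of the main stack to an auxiliary stack, reversing its word. -/
def moveTree (k : Bool) : Frag :=
  seq (single (.push .cnt (fun _ => none) (.goto fun _ => none)))
    (loop (.pop .cnt (fun _ x => x) (.goto fun v => v.isSome))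
      (single (.pop .main (fun _ x => x) (pushAux k (fun v => v.getD none)
        (.branch (fun v => v == some none)
          (.push .cnt (fun _ => none) (.push .cnt (fun _ => none) (.goto fun _ => none)))
          (.goto fun _ => none))))))

/-- Pour an auxiliary stack out, doing `q` for every symbol. -/
def pour (k : Bool) (q : Code Bool) : Frag :=
  loop (bif k then .pop .auxA (fun _ x => x) (.branch (fun v => v.isSome) q (.goto fun _ => false))
    else .pop .auxB (fun _ x => x) (.branch (fun v => v.isSome) q (.goto fun _ => false))) skip

section Primitives

variable (i : List CodeSym) (o : List Bool) (m a b c : List Sym)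

/-- The counter holds one mark for each tree still to be moved. A leaf uses up a mark and an inner
node exchanges one for two, so the loop recognizes the end of a tree in prefix order. The rest of
the run is a hypothesis, so that the node case can chain the induction hypotheses of the two
subtrees. -/
theorem moveTree_loop (k : Bool) (x : Data) (d : ℕ) (T : Stacks) (a b : List Sym) (m c : List Sym)
    (h : (loop (.pop .cnt (fun _ x => x) (.goto fun v => v.isSome))
      (single (.pop .main (fun _ x => x) (pushAux k (fun v => v.getD none)
        (.branch (fun v => v == some none)
          (.push .cnt (fun _ => none) (.push .cnt (fun _ => none) (.goto fun _ => none)))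
          (.goto fun _ => none)))))).Runs d
        (conf i o m (bif k then x.word.reverse ++ a else a)
          (bif k then b else x.word.reverse ++ b) c) T) :
    (loop (.pop .cnt (fun _ x => x) (.goto fun v => v.isSome))
      (single (.pop .main (fun _ x => x) (pushAux k (fun v => v.getD none)
        (.branch (fun v => v == some none)
          (.push .cnt (fun _ => none) (.push .cnt (fun _ => none) (.goto fun _ => none)))
          (.goto fun _ => none)))))).Runs (d + 2 * x.size)
        (conf i o (x.word ++ m) a b (none :: c)) T := by
  induction x generalizing d a b m c with
  | leaf s =>
    refine (Runs.loop_step (T := conf i o (some s :: m) a b c) (fun v => ⟨some none, ?_⟩)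
      (runs_single (T := conf i o m (bif k then some s :: a else a)
        (bif k then b else some s :: b) c) (fun v => ⟨some (some s), ?_⟩)) h).mono
      (by simp only [Data.size]; omega)
    · simp [Data.word]
    · cases k <;> simp [pushAux]
  | node l r hl hr =>
    refine (Runs.loop_step (T := conf i o (none :: (l.word ++ (r.word ++ m))) a b c)
      (fun v => ⟨some none, ?_⟩)
      (runs_single (T := conf i o (l.word ++ (r.word ++ m)) (bif k then none :: a else a)
        (bif k then b else none :: b) (none :: none :: c)) (fun v => ⟨some none, ?_⟩))
      (hl (d + 2 * r.size) _ _ _ _ (hr d _ _ _ _ ?_))).mono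
      (by simp only [Data.size]; omega)
    · simp [Data.word]
    · cases k <;> simp [pushAux]
    · cases k <;> simpa [Data.word] using h

theorem runs_moveTree (k : Bool) (x : Data) :
    (moveTree k).Runs (2 * x.size + 2) (conf i o (x.word ++ m) a b [])
      (conf i o m (bif k then x.word.reverse ++ a else a)
        (bif k then b else x.word.reverse ++ b) []) := by
  refine (Runs.seq (T := conf i o (x.word ++ m) a b [none]) (runs_single fun v => ⟨v, by simp⟩)
    (moveTree_loop i o k x 1 _ a b m [] (Runs.loop_done fun v => ⟨none, by simp⟩))).mono
    (by omega)

theorem runs_moveA (x : Data) :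
    (moveTree true).Runs (2 * x.size + 2) (conf i o (x.word ++ m) a b [])
      (conf i o m (x.word.reverse ++ a) b []) :=
  runs_moveTree i o m a b true x

theorem runs_moveB (x : Data) :
    (moveTree false).Runs (2 * x.size + 2) (conf i o (x.word ++ m) a b [])
      (conf i o m a (x.word.reverse ++ b) []) :=
  runs_moveTree i o m a b false x

theorem runs_clearA :
    (pour true (.goto fun _ => true)).Runs (2 * a.length + 1) (conf i o m a b c)
      (conf i o m [] b c) := by
  induction a with
  | nil => exact Runs.loop_done fun v => ⟨none, by simp⟩
  | cons s a ih =>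
    refine (Runs.loop_step (T := conf i o m a b c) (fun v => ⟨some s, by simp⟩)
      (runs_skip _) (d := 2 * a.length + 1) ?_).mono
      (by simp only [List.length_cons]; omega)
    exact ih

theorem runs_clearB :
    (pour false (.goto fun _ => true)).Runs (2 * b.length + 1) (conf i o m a b c)
      (conf i o m a [] c) := by
  induction b with
  | nil => exact Runs.loop_done fun v => ⟨none, by simp⟩
  | cons s b ih =>
    refine (Runs.loop_step (T := conf i o m a b c) (fun v => ⟨some s, by simp⟩)
      (runs_skip _) (d := 2 * b.length + 1) ?_).mono
      (by simp only [List.length_cons]; omega)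
    exact ih

theorem runs_pourA :
    (pour true (.push .main (fun v => v.getD none) (.goto fun _ => true))).Runs (2 * a.length + 1) (conf i o m a b c)
      (conf i o (a.reverse ++ m) [] b c) := by
  induction a generalizing m with
  | nil => exact Runs.loop_done fun v => ⟨none, by simp⟩
  | cons s a ih =>
    refine (Runs.loop_step (T := conf i o (s :: m) a b c) (fun v => ⟨some s, by simp⟩)
      (runs_skip _) (d := 2 * a.length + 1) ?_).mono
      (by simp only [List.length_cons]; omega)
    simp only [List.reverse_cons, List.append_assoc, List.singleton_append]
    exact ih (s :: m)

theorem runs_pourB :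
    (pour false (.push .main (fun v => v.getD none) (.goto fun _ => true))).Runs (2 * b.length + 1) (conf i o m a b c)
      (conf i o (b.reverse ++ m) a [] c) := by
  induction b generalizing m with
  | nil => exact Runs.loop_done fun v => ⟨none, by simp⟩
  | cons s b ih =>
    refine (Runs.loop_step (T := conf i o (s :: m) a b c) (fun v => ⟨some s, by simp⟩)
      (runs_skip _) (d := 2 * b.length + 1) ?_).mono
      (by simp only [List.length_cons]; omega)
    simp only [List.reverse_cons, List.append_assoc, List.singleton_append]
    exact ih (s :: m)

theorem runs_forkA :
    (pour true (.push .main (fun v => v.getD none)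
      (.push .auxB (fun v => v.getD none) (.goto fun _ => true)))).Runs (2 * a.length + 1) (conf i o m a b c)
      (conf i o (a.reverse ++ m) [] (a.reverse ++ b) c) := by
  induction a generalizing m b with
  | nil => exact Runs.loop_done fun v => ⟨none, by simp⟩
  | cons s a ih =>
    refine (Runs.loop_step (T := conf i o (s :: m) a (s :: b) c) (fun v => ⟨some s, by simp⟩)
      (runs_skip _) (d := 2 * a.length + 1) ?_).mono
      (by simp only [List.length_cons]; omega)
    simp only [List.reverse_cons, List.append_assoc, List.singleton_append]
    exact ih (s :: m) (s :: b)

theorem runs_pourBA :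
    (pour false (.push .auxA (fun v => v.getD none) (.goto fun _ => true))).Runs (2 * b.length + 1) (conf i o m a b c)
      (conf i o m (b.reverse ++ a) [] c) := by
  induction b generalizing a with
  | nil => exact Runs.loop_done fun v => ⟨none, by simp⟩
  | cons s b ih =>
    refine (Runs.loop_step (T := conf i o m (s :: a) b c) (fun v => ⟨some s, by simp⟩)
      (runs_skip _) (d := 2 * b.length + 1) ?_).mono
      (by simp only [List.length_cons]; omega)
    simp only [List.reverse_cons, List.append_assoc, List.singleton_append]
    exact ih (s :: a)

end Primitives

end Frag

/-! ### Programs on trees -/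

/-- Programs that transform trees. -/
inductive Prog : Type
  | const (s : CodeSym)
  | skip
  | fst
  | snd
  | pair (f g : Prog)
  | comp (f g : Prog)
  | ite (s : CodeSym) (f g : Prog)
  | while (f : Prog)

/-- Big-step semantics with costs. A branch tests whether the left subtree is a leaf with a certain
label, and removes it; a loop runs until the left subtree is a leaf with label `bar`. -/
inductive Eval : Prog → Data → Data → ℕ → Prop
  | const (s x) : Eval (.const s) x (.leaf s) (4 * x.size + 5)
  | skip (x) : Eval .skip x x 1
  | fst (x y) : Eval .fst (.node x y) x (9 * x.size + 9 * y.size + 9)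
  | snd (x y) : Eval .snd (.node x y) y (4 * x.size + 4)
  | pair {f g x y z c d} (hg : Eval g x z c) (hf : Eval f x y d) :
      Eval (.pair f g) x (.node y z) (c + d + 12 * x.size + 4 * z.size + 20)
  | comp {f g x y z c d} (hg : Eval g x y c) (hf : Eval f y z d) : Eval (.comp f g) x z (c + d)
  | ite_true {s f g x y c} (hf : Eval f x y c) :
      Eval (.ite s f g) (.node (.leaf s) x) y (c + 10)
  | ite_false {s f g x x' y c} (hx : x ≠ .leaf s) (hg : Eval g x' y c) :
      Eval (.ite s f g) (.node x x') y (c + 4 * x.size + 10)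
  | while_done {f} (x) : Eval (.while f) (.node (.leaf .bar) x) (.node (.leaf .bar) x) 1
  | while_step {f x x' y z c d} (hx : x ≠ .leaf .bar) (hf : Eval f (.node x x') y c)
      (hr : Eval (.while f) y z d) : Eval (.while f) (.node x x') z (c + d + 1)

/-! ### Compilation of tree programs into machine fragments. -/

namespace Frag

/-- Remove the topmost tree. -/
def dropTree : Frag := seq (moveTree true) (pour true (.goto fun _ => true))

/-- Duplicate the topmost tree. -/
def dupTree : Frag :=
  seq (moveTree true) (seq (pour true (.push .main (fun v => v.getD none)
      (.push .auxB (fun v => v.getD none) (.goto fun _ => true))))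
    (seq (pour false (.push .auxA (fun v => v.getD none) (.goto fun _ => true)))
      (pour true (.push .main (fun v => v.getD none) (.goto fun _ => true)))))

/-- Exchange the two topmost trees. -/
def swapTrees : Frag :=
  seq (moveTree true) (seq (moveTree false)
    (seq (pour true (.push .main (fun v => v.getD none) (.goto fun _ => true)))
      (pour false (.push .main (fun v => v.getD none) (.goto fun _ => true)))))

def pushMain (s : Sym) : Frag := single (.push .main (fun _ => s) (.goto fun _ => none))

def popMain : Frag := single (.pop .main (fun _ x => x) (.goto fun _ => none))

section Primitives

variable (i : List CodeSym) (o : List Bool) (m : List Sym)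

theorem runs_dropTree (x : Data) :
    dropTree.Runs (4 * x.size + 3) (conf i o (x.word ++ m) [] [] []) (conf i o m [] [] []) := by
  refine (Runs.seq (runs_moveA i o m [] [] x) (runs_clearA ..)).mono ?_
  simp only [List.append_nil, List.length_reverse, Data.length_word]; omega

/-- Pouring a stack out reverses it. The copy that the fork leaves on `auxB` is in reading order,
and must pass through `auxA` before it can be put back on the main stack. -/
theorem runs_dupTree (x : Data) :
    dupTree.Runs (8 * x.size + 5) (conf i o (x.word ++ m) [] [] [])
      (conf i o (x.word ++ (x.word ++ m)) [] [] []) := by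
  have h := Runs.seq (runs_moveA i o m [] [] x) (Runs.seq (runs_forkA i o m _ [] [])
    (Runs.seq (runs_pourBA i o _ [] _ []) (runs_pourA i o _ _ [] [])))
  simp only [List.append_nil, List.reverse_reverse, List.length_reverse, Data.length_word] at h
  exact h.mono (by omega)

theorem runs_swapTrees (x y : Data) :
    swapTrees.Runs (4 * x.size + 4 * y.size + 6) (conf i o (x.word ++ (y.word ++ m)) [] [] [])
      (conf i o (y.word ++ (x.word ++ m)) [] [] []) := by
  have h := Runs.seq (runs_moveA i o (y.word ++ m) [] [] x)
    (Runs.seq (runs_moveB i o m _ [] y)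
    (Runs.seq (runs_pourA i o _ _ _ []) (runs_pourB i o _ [] _ [])))
  simp only [List.append_nil, List.reverse_reverse, List.length_reverse, Data.length_word] at h
  exact h.mono (by omega)

theorem runs_pushMain (s : Sym) :
    (pushMain s).Runs 1 (conf i o m [] [] []) (conf i o (s :: m) [] [] []) :=
  runs_single fun v => ⟨v, by simp⟩

theorem runs_popMain (s : Sym) :
    popMain.Runs 1 (conf i o (s :: m) [] [] []) (conf i o m [] [] []) :=
  runs_single fun v => ⟨some s, by simp⟩

end Primitives

/-- The machine code for a program. -/
def ofProg : Prog → Frag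
  | .const s => seq dropTree (pushMain (some s))
  | .skip => skip
  | .fst => seq popMain (seq (moveTree true) (seq dropB
      (pour true (.push .main (fun v => v.getD none) (.goto fun _ => true)))))
  | .snd => seq popMain dropTree
  | .pair f g => seq dupTree (seq (ofProg g) (seq swapTrees (seq (ofProg f) (pushMain none))))
  | .comp f g => seq (ofProg g) (ofProg f)
  | .ite s f g =>
    branch (.pop .main (fun _ x => x) (.peek .main (fun _ x => x)
      (.goto fun v => v == some (some s)))) (seq popMain (ofProg f)) (seq dropTree (ofProg g))
  -- The test removes the node mark to see the first symbol of the left subtree, and puts the mark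
  -- back, because body and exit both work on the whole pair.
  | .while f =>
    loop (.pop .main (fun _ x => x) (.peek .main (fun _ x => x) (.push .main (fun _ => none)
      (.goto fun v => v != some (some .bar))))) (ofProg f)
where
  dropB : Frag := seq (moveTree false) (pour false (.goto fun _ => true))

/-- Comparing a subtree with a leaf takes one look at the stack, since the prefix word of an inner
node begins with `none`. -/
theorem head_word_eq_iff (x : Data) (m : List Sym) (s : CodeSym) :
    (x.word ++ m).head? = some (some s) ↔ x = .leaf s := by
  cases x <;> simp [Data.word]

/-- The costs in `Eval` are chosen to dominate the steps of the compiled fragments, so each case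
combines runs of primitives and compares numbers. Between instructions the auxiliary stacks and the
counter are empty. The arbitrary rest `m` of the main stack is needed for pairs: a copy of the input
lies below while `g` runs, and the value of `g` lies below while `f` runs. -/
theorem runs_ofProg {p : Prog} {x y : Data} {c : ℕ} (h : Eval p x y c) (i : List CodeSym)
    (o : List Bool) (m : List Sym) :
    (ofProg p).Runs c (conf i o (x.word ++ m) [] [] []) (conf i o (y.word ++ m) [] [] []) := by
  induction h generalizing m with
  | const s x =>
    exact (Runs.seq (runs_dropTree i o m x) (runs_pushMain i o m (some s))).mono (by omega)
  | skip x => exact runs_skip _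
  | fst x y =>
    have h := Runs.seq (runs_popMain i o (x.word ++ (y.word ++ m)) none)
      (Runs.seq (runs_moveA i o (y.word ++ m) [] [] x)
      (Runs.seq (Runs.seq (runs_moveB i o m _ [] y) (runs_clearB ..)) (runs_pourA ..)))
    simp only [List.append_nil, List.reverse_reverse, List.length_reverse, Data.length_word] at h
    simp only [Data.word, List.cons_append, List.append_assoc]
    exact h.mono (by omega)
  | snd x y =>
    simp only [Data.word, List.cons_append, List.append_assoc]
    exact (Runs.seq (runs_popMain ..) (runs_dropTree ..)).mono (by omega)
  | @pair f g x y z c d hg hf ihg ihf =>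
    simp only [Data.word, List.cons_append, List.append_assoc]
    exact (Runs.seq (runs_dupTree i o m x) (Runs.seq (ihg _) (Runs.seq (runs_swapTrees ..)
      (Runs.seq (ihf _) (runs_pushMain ..))))).mono (by omega)
  | comp hg hf ihg ihf => exact Runs.seq (ihg m) (ihf m)
  | @ite_true s f g x y c hf ih =>
    simp only [Data.word, List.cons_append, List.append_assoc]
    exact (Runs.branch_true (fun v => ⟨some (some s), by simp⟩)
      (Runs.seq (runs_popMain i o _ (some s)) (ih m))).mono (by omega)
  | @ite_false s f g x x' y c hx hg ih =>
    simp only [Data.word, List.cons_append, List.append_assoc]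
    refine (Runs.branch_false (T := conf i o (x.word ++ (x'.word ++ m)) [] [] [])
      (fun v => ⟨(x.word ++ (x'.word ++ m)).head?, ?_⟩)
      (Runs.seq (runs_dropTree i o _ x) (ih m))).mono (by omega)
    have := mt (head_word_eq_iff x (x'.word ++ m) s).1 hx
    simp [-List.head?_append, this]
  | @while_done f x => exact Runs.loop_done fun v => ⟨some (some .bar), by simp [Data.word]⟩
  | @while_step f x x' y z c d hx hf hr ihf ihr =>
    refine Runs.loop_step (fun v => ⟨(x.word ++ (x'.word ++ m)).head?, ?_⟩) (ihf m) (ihr m)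
    have := mt (head_word_eq_iff x (x'.word ++ m) .bar).1 hx
    simp [-List.head?_append, Data.word, this]

end Frag

end TreeProg

end

noncomputable section

namespace TreeProg

open Turing TM2

/-! ### The machine of a program -/

/-- Words as trees. -/
def wordData : List CodeSym → Data
  | [] => .leaf .bar
  | s :: w => .node (.leaf s) (wordData w)

/-- Truth values as trees. -/
def boolData (b : Bool) : Data := .leaf (bif b then .tick else .bar)

namespace Frag

/-- Turn the input word into the tree of its reversal. -/
def readInput : Frag :=
  seq (pushMain (some .bar))
    (loop (.pop .inp (fun _ x => x.map some) (.branch (fun v => v.isSome)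
      (.push .main (fun v => v.getD none) (.push .main (fun _ => none) (.goto fun _ => true)))
      (.goto fun _ => false))) skip)

theorem runs_readInput (w : List CodeSym) :
    readInput.Runs (2 * w.length + 2) (conf w [] [] [] [] [])
      (conf [] [] (wordData w.reverse).word [] [] []) := by
  have key : ∀ w u : List CodeSym, (loop (.pop .inp (fun _ x => x.map some)
      (.branch (fun v => v.isSome)
      (.push .main (fun v => v.getD none) (.push .main (fun _ => none) (.goto fun _ => true)))
      (.goto fun _ => false))) skip).Runs (2 * w.length + 1)
      (conf w [] (wordData u).word [] [] [])
      (conf [] [] (wordData (w.reverse ++ u)).word [] [] []) := by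
    intro w
    induction w with
    | nil => exact fun u => Runs.loop_done fun v => ⟨none, by simp⟩
    | cons s w ih =>
      intro u
      refine (Runs.loop_step (T := conf w [] (wordData (s :: u)).word [] [] [])
        (fun v => ⟨some (some s), by simp [wordData, Data.word]⟩)
        (runs_skip _) (d := 2 * w.length + 1) ?_).mono (by simp only [List.length_cons]; omega)
      simp only [List.reverse_cons, List.append_assoc, List.singleton_append]
      exact ih (s :: u)
  have h := Runs.seq (runs_pushMain w [] [] (some .bar)) (key w [])
  rw [List.append_nil] at h
  exact h.mono (by omega)

/-- Move a truth value from the main stack to the output stack. -/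
def writeOutput : Frag :=
  single (.pop .main (fun _ x => x)
    (.push .out (fun v => v == some (some .tick)) (.goto fun _ => none)))

theorem runs_writeOutput (b : Bool) :
    writeOutput.Runs 1 (conf [] [] ((boolData b).word ++ []) [] [] [])
      (conf [] [b] [] [] [] []) :=
  runs_single fun v => ⟨some (some (bif b then .tick else .bar)), by
    cases b <;> simp [boolData, Data.word] <;> rfl⟩

/-- A fragment as a machine. -/
def machine (F : Frag) : FinTM2 where
  K := Stk
  k₀ := .inp
  k₁ := .out
  Γ := Stk.Alph
  Λ := Option F.Lab
  main := some F.start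
  ΛFin := letI := F.fin; inferInstance
  σ := Reg
  initialState := none
  Γk₀Fin := inferInstanceAs (Fintype CodeSym)
  m
    -- A halting configuration is required to carry the initial memory, so the memory is reset
    -- before the halt.
    | none => .load (fun _ => none) .halt
    | some l => F.code l

/-- The additional step is the one that resets the memory and halts at the exit label. -/
theorem Reach.iterate {F : Frag} {n : ℕ} {l : Option F.Lab} {S T : Stacks} (h : F.Reach n l S T)
    (v : Reg) : (flip bind F.machine.step)^[n + 1]
      (some (⟨some l, v, S⟩ : F.machine.Cfg)) = some (⟨none, none, T⟩ : F.machine.Cfg) := by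
  induction h generalizing v with
  | exit S => rfl
  | step hs _ ih =>
    obtain ⟨v', hv⟩ := hs v
    rw [Function.iterate_succ_apply]
    refine Eq.trans (congrArg _ ?_) (ih v')
    exact congrArg some hv

end Frag

theorem finite_alph (k : Stk) : Finite k.Alph := by
  cases k <;> dsimp only [Stk.Alph] <;> infer_instance

open Frag in
/-- A language that is decided by a program on trees at polynomial cost is in P. -/
theorem inP_of_eval {L : Language CodeSym} (f : List CodeSym → Bool) (hf : ∀ w, f w = true ↔ w ∈ L)
    (p : Prog) (P : Polynomial ℕ)
    (h : ∀ w, ∃ c ≤ P.eval w.length, Eval p (wordData w.reverse) (boolData (f w)) c) : InP L := by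
  let F : Frag := seq readInput (seq (ofProg p) writeOutput)
  have hF : ∀ w, ∃ n ≤ (2 * w.length + 2) + (P.eval w.length + 1),
      F.Reach n (some F.start) (conf w [] [] [] [] []) (conf [] [f w] [] [] [] []) := by
    intro w
    obtain ⟨c, hc, he⟩ := h w
    have h1 := runs_ofProg he [] [] []
    rw [List.append_nil] at h1
    exact (Runs.seq (runs_readInput w) (Runs.seq h1 (runs_writeOutput (f w)))).mono (by omega)
  choose n hn hr using hF
  refine ⟨f, {
    tm := F.machine
    inputAlphabet := Equiv.refl CodeSym
    outputAlphabet := Equiv.refl Bool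
    time := 2 * Polynomial.X + P + 4
    outputsFun := fun w => {
      steps := n w + 1
      evals_in_steps := ?_
      steps_le_m := ?_ } }, ?_, hf⟩
  · have h1 := (hr w).iterate none
    have h2 : initList F.machine (List.map (Equiv.refl CodeSym).invFun w) =
        (⟨some (some F.start), none, conf w [] [] [] [] []⟩ : F.machine.Cfg) := by
      unfold initList
      congr 1
      funext k
      cases k <;> simp [machine] <;> rfl
    have h3 : haltList F.machine (List.map (Equiv.refl Bool).invFun
        (Computability.encodeBool (f w))) =
        (⟨none, none, conf [] [f w] [] [] [] []⟩ : F.machine.Cfg) := by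
      unfold haltList
      congr 1
      funext k
      cases k <;> simp [machine, Computability.encodeBool] <;> rfl
    rw [Option.map_some]
    exact (congrArg (fun c => (flip bind F.machine.step)^[n w + 1] (some c)) h2).trans
      (h1.trans (congrArg some h3).symm)
  · have := hn w
    simp only [Polynomial.eval_add, Polynomial.eval_mul, Polynomial.eval_ofNat,
      Polynomial.eval_X, id]
    omega
  · exact fun k => finite_alph k

end TreeProg

end

noncomputable section

namespace TreeProg

/-! ### Functions of polynomial cost -/

/-- Types whose elements are represented by trees. -/
class Enc (α : Type) where
  enc : α → Data

open Enc

variable {α β γ δ σ : Type} [Enc α] [Enc β] [Enc γ] [Enc δ] [Enc σ]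

/-- The size of the tree that represents `x`. -/
def esize (x : α) : ℕ := (enc x).size

instance : Enc CodeSym := ⟨.leaf⟩
instance : Enc Bool := ⟨boolData⟩
instance : Enc Unit := ⟨fun _ => .leaf .bar⟩
instance : Enc (α × β) := ⟨fun x => .node (enc x.1) (enc x.2)⟩

/-- Lists as trees. -/
def listData : List α → Data
  | [] => .leaf .bar
  | a :: l => .node (enc a) (listData l)

instance : Enc (List α) := ⟨listData⟩
-- Numbers are unary, so a number is linear in the size of its tree, and programs on lists serve as
-- arithmetic.
instance : Enc ℕ := ⟨fun n => listData (List.replicate n ())⟩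

theorem enc_nil : enc ([] : List α) = .leaf .bar := rfl
theorem enc_cons (a : α) (l : List α) : enc (a :: l) = .node (enc a) (enc l) := rfl
theorem enc_replicate (n : ℕ) : enc (List.replicate n ()) = enc n := rfl

@[simp] theorem esize_mk (a : α) (b : β) : esize (a, b) = esize a + esize b + 1 := rfl
theorem esize_prod (x : α × β) : esize x = esize x.1 + esize x.2 + 1 := rfl
@[simp] theorem esize_nil : esize ([] : List α) = 1 := rfl
@[simp] theorem esize_cons (a : α) (l : List α) : esize (a :: l) = esize a + esize l + 1 := rfl
@[simp] theorem esize_bool (b : Bool) : esize b = 1 := rfl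
@[simp] theorem esize_sym (s : CodeSym) : esize s = 1 := rfl

@[simp] theorem esize_nat (n : ℕ) : esize n = 2 * n + 1 := by
  induction n with
  | zero => rfl
  | succ n ih =>
    have : esize (n + 1) = 1 + esize n + 1 := rfl
    omega

theorem wordData_eq (w : List CodeSym) : wordData w = enc w := by
  induction w with
  | nil => rfl
  | cons s w ih => rw [wordData, ih]; rfl

theorem esize_append (l l' : List α) : esize (l ++ l') + 1 = esize l + esize l' := by
  induction l with
  | nil => simp; omega
  | cons a l ih => simp only [List.cons_append, esize_cons]; omega

theorem esize_reverse (l : List α) : esize l.reverse = esize l := by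
  induction l with
  | nil => rfl
  | cons a l ih =>
    have := esize_append l.reverse [a]
    simp only [List.reverse_cons, esize_cons, esize_nil] at *
    omega

theorem esize_le_of_mem {l : List α} {a : α} (h : a ∈ l) : esize a ≤ esize l := by
  induction l with
  | nil => simp at h
  | cons b l ih =>
    simp only [esize_cons]
    rcases List.mem_cons.1 h with rfl | h
    · omega
    · have := ih h; omega

theorem length_lt_esize (l : List α) : l.length < esize l := by
  induction l with
  | nil => simp
  | cons a l ih => simp only [List.length_cons, esize_cons]; omega

theorem esize_le_of_sublist {l l' : List α} (h : l.Sublist l') : esize l ≤ esize l' := by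
  induction h with
  | slnil => exact le_rfl
  | cons a _ ih => simp only [esize_cons]; omega
  | cons_cons a _ ih => simp only [esize_cons]; omega

theorem esize_le_mul {l : List α} {b : ℕ} (h : ∀ a ∈ l, esize a ≤ b) :
    esize l ≤ l.length * (b + 1) + 1 := by
  induction l with
  | nil => simp
  | cons a l ih =>
    have h1 := ih fun x hx => h x (List.mem_cons_of_mem _ hx)
    have h2 := h a List.mem_cons_self
    simp only [esize_cons, List.length_cons, Nat.add_mul]
    omega

/-! #### Polynomially bounded quantities -/

theorem eval_mono_nat (P : Polynomial ℕ) {m n : ℕ} (h : m ≤ n) :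
    P.eval m ≤ P.eval n := by
  rw [Polynomial.eval_eq_sum, Polynomial.eval_eq_sum]
  exact Finset.sum_le_sum fun i _ => Nat.mul_le_mul_left _ (Nat.pow_le_pow_left h i)

/-- The quantity `g x` is bounded by a polynomial in the size of `x`. -/
@[fun_prop]
def PolyBdd (g : α → ℕ) : Prop := ∃ P : Polynomial ℕ, ∀ x, g x ≤ P.eval (esize x)

theorem PolyBdd.mono {g h : α → ℕ} (hh : PolyBdd h) (hle : ∀ x, g x ≤ h x) : PolyBdd g :=
  let ⟨P, hP⟩ := hh
  ⟨P, fun x => (hle x).trans (hP x)⟩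

@[fun_prop]
theorem PolyBdd.const (n : ℕ) : PolyBdd fun _ : α => n :=
  ⟨Polynomial.C n, fun x => by simp⟩

@[fun_prop]
theorem PolyBdd.add {g h : α → ℕ} (hg : PolyBdd g) (hh : PolyBdd h) :
    PolyBdd fun x => g x + h x :=
  let ⟨P, hP⟩ := hg
  let ⟨Q, hQ⟩ := hh
  ⟨P + Q, fun x => by rw [Polynomial.eval_add]; exact Nat.add_le_add (hP x) (hQ x)⟩

@[fun_prop]
theorem PolyBdd.mul {g h : α → ℕ} (hg : PolyBdd g) (hh : PolyBdd h) :
    PolyBdd fun x => g x * h x :=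
  let ⟨P, hP⟩ := hg
  let ⟨Q, hQ⟩ := hh
  ⟨P * Q, fun x => by rw [Polynomial.eval_mul]; exact Nat.mul_le_mul (hP x) (hQ x)⟩

theorem PolyBdd.eval {g : α → ℕ} (hg : PolyBdd g) (Q : Polynomial ℕ) :
    PolyBdd fun x => Q.eval (g x) :=
  let ⟨P, hP⟩ := hg
  ⟨Q.comp P, fun x => by
    rw [Polynomial.eval_comp]; exact eval_mono_nat Q (hP x)⟩

theorem PolyBdd.esize : PolyBdd fun x : α => esize x :=
  ⟨Polynomial.X, fun x => by simp⟩

/-! #### Cost of evaluation, up to a bound -/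

/-- The program `p` maps `x` to `y` at cost at most `c`. -/
def EvalLe (p : Prog) (x y : Data) (c : ℕ) : Prop := ∃ d ≤ c, Eval p x y d

theorem EvalLe.mono {p : Prog} {x y : Data} {c d : ℕ} (h : EvalLe p x y c) (hcd : c ≤ d) :
    EvalLe p x y d :=
  let ⟨e, he, h'⟩ := h
  ⟨e, he.trans hcd, h'⟩

theorem EvalLe.fst (x y : Data) : EvalLe .fst (.node x y) x (9 * (x.size + y.size) + 9) :=
  ⟨_, by omega, .fst x y⟩

theorem EvalLe.snd (x y : Data) : EvalLe .snd (.node x y) y (9 * (x.size + y.size) + 9) :=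
  ⟨_, by omega, .snd x y⟩

theorem EvalLe.skip (x : Data) : EvalLe .skip x x 1 := ⟨_, le_rfl, .skip x⟩

theorem EvalLe.comp {f g : Prog} {x y z : Data} {c d : ℕ} (hf : EvalLe f y z d)
    (hg : EvalLe g x y c) : EvalLe (.comp f g) x z (c + d) :=
  let ⟨_, he, h⟩ := hf
  let ⟨_, he', h'⟩ := hg
  ⟨_, by omega, .comp h' h⟩

theorem EvalLe.pair {f g : Prog} {x y z : Data} {c d : ℕ} (hf : EvalLe f x y d)
    (hg : EvalLe g x z c) :
    EvalLe (.pair f g) x (.node y z) (c + d + 12 * x.size + 4 * z.size + 20) :=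
  let ⟨_, he, h⟩ := hf
  let ⟨_, he', h'⟩ := hg
  ⟨_, by omega, .pair h' h⟩

/-- Every vertex of the output comes from the input or is paid for. Polynomial cost therefore forces
polynomial output size, which is what makes polynomial programs composable. -/
theorem Eval.size_le {p : Prog} {x y : Data} {c : ℕ} (h : Eval p x y c) :
    y.size ≤ x.size + c := by
  induction h <;> (try simp only [Data.size] at *) <;> omega

/-! #### Polynomial-time functions -/

/-- The function `f` is computed by a program of polynomial cost. -/
@[fun_prop]
def Poly (f : α → β) : Prop :=
  ∃ (p : Prog) (c : α → ℕ), PolyBdd c ∧ ∀ x, EvalLe p (enc x) (enc (f x)) (c x)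

@[fun_prop]
theorem PolyBdd.comp_poly {g : β → ℕ} {f : α → β} (hg : PolyBdd g) (hf : Poly f) :
    PolyBdd fun x => g (f x) := by
  obtain ⟨P, hP⟩ := hg
  obtain ⟨p, c, hc, h⟩ := hf
  refine ((PolyBdd.esize.add hc).eval P).mono fun x => (hP _).trans ?_
  obtain ⟨d, hd, h⟩ := h x
  exact eval_mono_nat P (h.size_le.trans (Nat.add_le_add_left hd _))

@[fun_prop]
theorem PolyBdd.esize_poly {f : α → β} (hf : Poly f) : PolyBdd fun x => TreeProg.esize (f x) :=
  PolyBdd.comp_poly PolyBdd.esize hf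

@[fun_prop]
theorem Poly.id : Poly fun x : α => x :=
  ⟨.skip, fun _ => 1, .const 1, fun _ => .skip _⟩

@[fun_prop]
theorem Poly.comp {g : β → γ} {f : α → β} (hg : Poly g) (hf : Poly f) :
    Poly fun x => g (f x) := by
  obtain ⟨q, d, hd, h'⟩ := hg
  have hdf := hd.comp_poly hf
  obtain ⟨p, c, hc, h⟩ := hf
  exact ⟨.comp q p, _, hc.add hdf, fun x => (h' (f x)).comp (h x)⟩

@[fun_prop]
theorem Poly.prodMk {f : α → β} {g : α → γ} (hf : Poly f) (hg : Poly g) :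
    Poly fun x => (f x, g x) := by
  have hs : PolyBdd fun x => TreeProg.esize (g x) := .esize_poly hg
  obtain ⟨p, c, hc, h⟩ := hf
  obtain ⟨q, d, hd, h'⟩ := hg
  exact ⟨.pair p q, _, (((hd.add hc).add ((PolyBdd.const 12).mul .esize)).add
    ((PolyBdd.const 4).mul hs)).add (.const 20), fun x => (h x).pair (h' x)⟩

theorem Poly.fst' : Poly fun x : α × β => x.1 :=
  ⟨.fst, fun x => 9 * esize x + 9, by
    exact ((PolyBdd.const 9).mul .esize).add (.const 9), fun x => (EvalLe.fst _ _).mono (by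
      simp only [esize_prod]; simp only [esize]; omega)⟩

theorem Poly.snd' : Poly fun x : α × β => x.2 :=
  ⟨.snd, fun x => 9 * esize x + 9, by
    exact ((PolyBdd.const 9).mul .esize).add (.const 9), fun x => (EvalLe.snd _ _).mono (by
      simp only [esize_prod]; simp only [esize]; omega)⟩

@[fun_prop]
theorem Poly.fst {f : α → β × γ} (hf : Poly f) : Poly fun x => (f x).1 := Poly.fst'.comp hf

@[fun_prop]
theorem Poly.snd {f : α → β × γ} (hf : Poly f) : Poly fun x => (f x).2 := Poly.snd'.comp hf

/-- A program for a constant function. -/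
def constProg : Data → Prog
  | .leaf s => .const s
  | .node l r => .pair (constProg l) (constProg r)

theorem evalLe_constProg (d x : Data) :
    EvalLe (constProg d) x d (d.size * (16 * x.size + 4 * d.size + 25)) := by
  induction d with
  | leaf s => exact ⟨_, by simp only [Data.size]; omega, .const s x⟩
  | node l r hl hr =>
    refine (hl.pair hr).mono ?_
    simp only [Data.size]
    nlinarith [l.size.zero_le, r.size.zero_le, x.size.zero_le]

@[fun_prop]
theorem Poly.const (b : β) : Poly fun _ : α => b :=
  ⟨constProg (enc b), fun x => esize b * (16 * esize x + 4 * esize b + 25),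
    (PolyBdd.const _).mul ((((PolyBdd.const _).mul .esize).add (.const _)).add (.const _)),
    fun _ => evalLe_constProg _ _⟩

/-- Being polynomial depends on a function only through the trees of its values. This lets numbers
be treated as lists of units, structures as tuples, and a function be replaced by any extensionally
equal one. -/
theorem Poly.of_enc_eq {f : α → β} {g : α → γ} (hf : Poly f) (h : ∀ x, enc (g x) = enc (f x)) :
    Poly g :=
  let ⟨p, c, hc, hp⟩ := hf
  ⟨p, c, hc, fun x => by rw [h]; exact hp x⟩

open Classical in
/-- Case distinction on whether `t x` is represented by the leaf `s`. -/
theorem Poly.ite_leaf {t : α → γ} (s : CodeSym) {f g : α → β} (ht : Poly t) (hf : Poly f)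
    (hg : Poly g) : Poly fun x => if enc (t x) = .leaf s then f x else g x := by
  have hts : PolyBdd fun x => TreeProg.esize (t x) := .esize_poly ht
  obtain ⟨p, c, hc, h⟩ := ht
  obtain ⟨q, d, hd, h'⟩ := hf
  obtain ⟨r, e, he, h''⟩ := hg
  refine ⟨.comp (.ite s q r) (.pair p .skip),
    fun x => c x + d x + e x + 4 * TreeProg.esize (t x) + 16 * TreeProg.esize x + 40,
    (((((hc.add hd).add he).add ((PolyBdd.const 4).mul hts)).add
      ((PolyBdd.const 16).mul .esize)).add (.const _)), fun x => ?_⟩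
  have h0 := (h x).pair (EvalLe.skip (enc x))
  dsimp only
  split_ifs with hx
  · rw [hx] at h0
    obtain ⟨k, hk, hq⟩ := h' x
    refine (EvalLe.comp ⟨_, le_rfl, .ite_true hq⟩ h0).mono ?_
    simp only [esize]; omega
  · obtain ⟨k, hk, hq⟩ := h'' x
    refine (EvalLe.comp ⟨_, le_rfl, .ite_false hx hq⟩ h0).mono ?_
    simp only [esize]; omega

@[fun_prop]
theorem Poly.cond {b : α → Bool} {f g : α → β} (hb : Poly b) (hf : Poly f) (hg : Poly g) :
    Poly fun x => cond (b x) (f x) (g x) := by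
  refine (Poly.ite_leaf .tick hb hf hg).of_enc_eq fun x => ?_
  cases b x <;> simp [enc, boolData]

@[fun_prop]
theorem Poly.beq_sym {t : α → CodeSym} (s : CodeSym) (ht : Poly t) : Poly fun x => t x == s := by
  refine (Poly.ite_leaf s ht (.const true) (.const false)).of_enc_eq fun x => ?_
  by_cases h : t x = s
  · simp [enc, h]
  · simp [enc, h, beq_eq_false_iff_ne.2 h]

/-- Case distinction on a list. -/
theorem Poly.list_cases {l : α → List γ} {f : α → β} {g : α × γ × List γ → β} (hl : Poly l)
    (hf : Poly f) (hg : Poly g) :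
    Poly fun x => match l x with | [] => f x | a :: t => g (x, a, t) := by
  have hls : PolyBdd fun x => TreeProg.esize (l x) := .esize_poly hl
  obtain ⟨p, c, hc, h⟩ := hl
  obtain ⟨q, d, hd, h'⟩ := hf
  obtain ⟨r, ⟨e, ⟨E, hE⟩, h''⟩⟩ := hg
  -- The list is computed twice. One copy is consumed by the test; if the list is not empty, the
  -- other one already has the shape of the pair of head and tail that `g` expects.
  refine ⟨.comp (.ite .bar (.comp q .fst) r) (.pair p (.pair .skip p)),
    fun x => c x + c x + d x + E.eval (TreeProg.esize x + TreeProg.esize (l x) + 1) +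
      40 * TreeProg.esize (l x) + 40 * TreeProg.esize x + 100,
    (((((hc.add hc).add hd).add (((PolyBdd.esize.add hls).add (.const 1)).eval E)).add
      ((PolyBdd.const _).mul hls)).add ((PolyBdd.const _).mul .esize)).add (.const _),
    fun x => ?_⟩
  have h0 := (h x).pair ((EvalLe.skip (enc x)).pair (h x))
  dsimp only
  cases hx : l x with
  | nil =>
    rw [hx, enc_nil] at h0
    dsimp only
    obtain ⟨k, hk, hq⟩ := (h' x).comp (EvalLe.fst (enc x) (.leaf .bar))
    refine (EvalLe.comp ⟨_, le_rfl, .ite_true hq⟩ h0).mono ?_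
    simp only [esize, Data.size, enc_nil] at *; omega
  | cons a t =>
    rw [hx, enc_cons] at h0
    dsimp only
    obtain ⟨k, hk, hq⟩ := h'' (x, a, t)
    refine (EvalLe.comp ⟨_, le_rfl, .ite_false (by simp) hq⟩ h0).mono ?_
    have h1 := (hk.trans (hE (x, a, t))).trans (eval_mono_nat E
      (show TreeProg.esize (x, a, t) ≤ TreeProg.esize x + TreeProg.esize (a :: t) + 1 by
        simp only [esize_mk, esize_cons]; omega))
    simp only [esize, Data.size, enc_cons] at *; omega

end TreeProg

end

noncomputable section

namespace TreeProg

open Enc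

variable {α β γ δ σ : Type} [Enc α] [Enc β] [Enc γ] [Enc δ] [Enc σ]

/-! ### Iteration -/

/-- The loop body for a fold, from a program for its step function. -/
def foldBody (p : Prog) : Prog :=
  .pair (.comp .snd .fst) (.pair (.comp .fst .snd)
    (.comp p (.pair (.comp .fst .snd) (.pair (.comp .snd .snd) (.comp .fst .fst)))))

theorem evalLe_foldBody {p : Prog} {a l x s s' : Data} {c : ℕ}
    (h : EvalLe p (.node x (.node s a)) s' c) :
    EvalLe (foldBody p) (.node (.node a l) (.node x s)) (.node l (.node x s'))
      (c + 500 * (a.size + l.size + x.size + s.size + s'.size + 1)) := by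
  have hA := EvalLe.fst (.node a l) (.node x s)
  have hB := EvalLe.snd (.node a l) (.node x s)
  have hx := (EvalLe.fst x s).comp hB
  have hs := (EvalLe.snd x s).comp hB
  have ha := (EvalLe.fst a l).comp hA
  have hl := (EvalLe.snd a l).comp hA
  refine (hl.pair (hx.pair (h.comp (hx.pair (hs.pair ha))))).mono ?_
  simp only [Data.size]
  omega

/-- The states that the loop meets are the folds over initial segments of the list. It is enough to
bound the cost of a step on states of size at most `B` and to bound these folds by `B`. -/
theorem evalLe_fold {step : α → σ → β → σ} {p : Prog} {x : α} {A B C : ℕ}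
    (hp : ∀ s a, esize s ≤ B → esize a ≤ A →
      EvalLe p (enc (x, s, a)) (enc (step x s a)) C)
    (l : List β) (s : σ) (hl : esize l ≤ A)
    (hB : ∀ l', l' <+: l → esize (l'.foldl (step x) s) ≤ B) :
    EvalLe (.while (foldBody p)) (.node (enc l) (.node (enc x) (enc s)))
      (.node (enc ([] : List β)) (.node (enc x) (enc (l.foldl (step x) s))))
      (l.length * (C + 1000 * (A + esize x + B + 1) + 1) + 1) := by
  induction l generalizing s with
  | nil => exact ⟨1, by simp, .while_done _⟩
  | cons a l ih =>
    rw [esize_cons] at hl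
    have hs := hB [] (List.nil_prefix)
    have hs' := hB [a] (by simp)
    simp only [List.foldl_nil, List.foldl_cons] at hs hs'
    obtain ⟨d, hd, hbody⟩ := evalLe_foldBody (l := enc l) (hp s a hs (by omega))
    obtain ⟨e, he, hrest⟩ := ih (step x s a) (by omega) fun l' hl' => by
      simpa using hB (a :: l') (by simpa using hl')
    refine ⟨_, ?_, .while_step Data.noConfusion hbody hrest⟩
    simp only [esize] at *
    simp only [List.length_cons, Nat.add_mul, Nat.one_mul]
    omega

/-- A fold is polynomial if its step is and all intermediate results have polynomial size. -/
theorem Poly.foldl_of_bound {l : α → List β} {init : α → σ} {step : α → σ → β → σ} {B : α → ℕ}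
    (hl : Poly l) (hi : Poly init) (hs : Poly fun y : α × σ × β => step y.1 y.2.1 y.2.2)
    (hB : PolyBdd B)
    (hb : ∀ x l', l' <+: l x → esize (l'.foldl (step x) (init x)) ≤ B x) :
    Poly fun x => (l x).foldl (step x) (init x) := by
  have hls : PolyBdd fun x => esize (l x) := .esize_poly hl
  have his : PolyBdd fun x => esize (init x) := .esize_poly hi
  obtain ⟨p, c, hc, hp⟩ := hl
  obtain ⟨q, d, hd, hq⟩ := hi
  obtain ⟨r, e, ⟨E, hE⟩, hr⟩ := hs
  let C : α → ℕ := fun x => E.eval (esize x + (B x + esize (l x) + 1) + 1)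
  have hC : PolyBdd C :=
    ((PolyBdd.esize.add ((hB.add hls).add (.const 1))).add (.const 1)).eval E
  let W : α → ℕ := fun x =>
    esize (l x) * (C x + 1000 * (esize (l x) + esize x + B x + 1) + 1) + 1
  have hW : PolyBdd W :=
    (hls.mul ((hC.add ((PolyBdd.const 1000).mul
      (((hls.add .esize).add hB).add (.const 1)))).add (.const 1))).add (.const 1)
  refine ⟨.comp .snd (.comp .snd (.comp (.while (foldBody r)) (.pair p (.pair .skip q)))),
    fun x => c x + d x + W x + 100 * (esize (l x) + esize x + esize (init x) + B x + 1),
    ((hc.add hd).add hW).add ((PolyBdd.const _).mul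
      ((((hls.add .esize).add his).add hB).add (.const 1))), fun x => ?_⟩
  have h0 := (hp x).pair ((EvalLe.skip (enc x)).pair (hq x))
  have h1 := evalLe_fold (step := step) (p := r) (x := x) (A := esize (l x)) (B := B x) (C := C x)
    (fun s a hs ha => (hr (x, s, a)).mono ((hE _).trans (eval_mono_nat E (by
      simp only [esize_mk]; omega)))) (l x) (init x) le_rfl (hb x)
  have h2 := (EvalLe.snd _ _).comp ((EvalLe.snd _ _).comp (h1.comp h0))
  refine h2.mono ?_
  have hlen : (l x).length * (C x + 1000 * (esize (l x) + esize x + B x + 1) + 1) + 1 ≤ W x :=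
    Nat.add_le_add_right (Nat.mul_le_mul_right _ (length_lt_esize _).le) 1
  have hfin := hb x (l x) (List.prefix_refl _)
  dsimp only
  simp only [esize, Data.size, enc_nil] at *
  omega

theorem esize_foldl_le {step : σ → β → σ} {c : ℕ} (l : List β) (s : σ)
    (h : ∀ s, ∀ a ∈ l, esize (step s a) ≤ esize s + c) :
    esize (l.foldl step s) ≤ esize s + l.length * c := by
  induction l generalizing s with
  | nil => simp
  | cons a l ih =>
    have h1 := ih (step s a) fun s b hb => h s b (List.mem_cons_of_mem _ hb)
    have h2 := h s a List.mem_cons_self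
    simp only [List.foldl_cons, List.length_cons, Nat.add_mul]
    omega

/-- A fold is polynomial if its step is and increases the size by a polynomially bounded amount
that does not depend on the intermediate result. -/
theorem Poly.foldl {l : α → List β} {init : α → σ} {step : α → σ → β → σ} {b : α × β → ℕ}
    (hl : Poly l) (hi : Poly init) (hs : Poly fun y : α × σ × β => step y.1 y.2.1 y.2.2)
    (hb : PolyBdd b) (h : ∀ x s a, esize (step x s a) ≤ esize s + b (x, a)) :
    Poly fun x => (l x).foldl (step x) (init x) := by
  obtain ⟨P, hP⟩ := hb
  have hls : PolyBdd fun x => esize (l x) := .esize_poly hl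
  have his : PolyBdd fun x => esize (init x) := .esize_poly hi
  refine Poly.foldl_of_bound (B := fun x => esize (init x) + esize (l x) *
    P.eval (esize x + esize (l x) + 1)) hl hi hs
    (his.add (hls.mul (((PolyBdd.esize.add hls).add (.const 1)).eval P))) fun x l' hl' => ?_
  refine (esize_foldl_le (c := P.eval (esize x + esize (l x) + 1)) l' (init x)
    fun s a ha => (h x s a).trans (Nat.add_le_add_left ((hP _).trans (eval_mono_nat P ?_)) _)).trans
    (Nat.add_le_add_left (Nat.mul_le_mul_right _ ?_) _)
  · have := esize_le_of_mem (hl'.subset ha)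
    simp only [esize_mk]; omega
  · exact hl'.length_le.trans (length_lt_esize _).le

theorem foldl_replicate (f : σ → σ) (n : ℕ) (s : σ) :
    (List.replicate n ()).foldl (fun s _ => f s) s = f^[n] s := by
  induction n generalizing s with
  | zero => rfl
  | succ n ih => simp [List.replicate_succ, ih]

theorem Poly.replicate_unit {n : α → ℕ} (hn : Poly n) : Poly fun x => List.replicate (n x) () :=
  hn.of_enc_eq fun x => enc_replicate _

theorem Poly.iterate {n : α → ℕ} {init : α → σ} {step : α → σ → σ} {b : α → ℕ}
    (hn : Poly n) (hi : Poly init) (hs : Poly fun y : α × σ => step y.1 y.2)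
    (hb : PolyBdd b) (h : ∀ x s, esize (step x s) ≤ esize s + b x) :
    Poly fun x => (step x)^[n x] (init x) := by
  have := Poly.foldl (l := fun x => List.replicate (n x) ()) (step := fun x s _ => step x s)
    (b := fun y => b y.1) (Poly.replicate_unit hn) hi
    (hs.comp (f := fun y : α × σ × Unit => (y.1, y.2.1)) (by fun_prop))
    (hb.comp_poly Poly.fst') fun x s _ => h x s
  simpa only [foldl_replicate] using this

/-! ### A library of polynomial functions -/

@[fun_prop]
theorem Poly.not {b : α → Bool} (hb : Poly b) : Poly fun x => !(b x) := by
  have : (fun x => !(b x)) = fun x => bif b x then false else true := by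
    funext x; cases b x <;> rfl
  rw [this]; fun_prop

@[fun_prop]
theorem Poly.and {b c : α → Bool} (hb : Poly b) (hc : Poly c) : Poly fun x => b x && c x := by
  have : (fun x => b x && c x) = fun x => bif b x then c x else false := by
    funext x; cases b x <;> rfl
  rw [this]; fun_prop

@[fun_prop]
theorem Poly.or {b c : α → Bool} (hb : Poly b) (hc : Poly c) : Poly fun x => b x || c x := by
  have : (fun x => b x || c x) = fun x => bif b x then true else c x := by
    funext x; cases b x <;> rfl
  rw [this]; fun_prop

@[fun_prop]
theorem Poly.cons {a : α → β} {l : α → List β} (ha : Poly a) (hl : Poly l) :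
    Poly fun x => a x :: l x :=
  (ha.prodMk hl).of_enc_eq fun _ => rfl

@[fun_prop]
theorem Poly.headD {l : α → List β} {d : α → β} (hl : Poly l) (hd : Poly d) :
    Poly fun x => (l x).headD (d x) := by
  refine (Poly.list_cases (g := fun y : α × β × List β => y.2.1) hl hd
    (by fun_prop)).of_enc_eq fun x => ?_
  cases l x <;> rfl

@[fun_prop]
theorem Poly.tail {l : α → List β} (hl : Poly l) : Poly fun x => (l x).tail := by
  refine (Poly.list_cases (f := fun _ => []) (g := fun y : α × β × List β => y.2.2) hl
    (by fun_prop) (by fun_prop)).of_enc_eq fun x => ?_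
  cases l x <;> rfl

@[fun_prop]
theorem Poly.isEmpty {l : α → List β} (hl : Poly l) : Poly fun x => (l x).isEmpty := by
  refine (Poly.list_cases (f := fun _ => true) (g := fun _ : α × β × List β => false) hl
    (by fun_prop) (by fun_prop)).of_enc_eq fun x => ?_
  cases l x <;> rfl

@[fun_prop]
theorem Poly.reverse {l : α → List β} (hl : Poly l) : Poly fun x => (l x).reverse := by
  have := Poly.foldl (init := fun _ => []) (step := fun _ s a => a :: s)
    (b := fun y : α × β => esize y.2 + 1) hl (by fun_prop) (by fun_prop) (by fun_prop)
    (fun x s a => by simp only [esize_cons]; omega)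
  simpa using this

theorem Poly.foldr {l : α → List β} {init : α → σ} {step : α → β → σ → σ} {b : α × β → ℕ}
    (hl : Poly l) (hi : Poly init) (hs : Poly fun y : α × σ × β => step y.1 y.2.2 y.2.1)
    (hb : PolyBdd b) (h : ∀ x s a, esize (step x a s) ≤ esize s + b (x, a)) :
    Poly fun x => (l x).foldr (step x) (init x) := by
  simpa only [List.foldl_reverse] using
    Poly.foldl (step := fun x s a => step x a s) hl.reverse hi hs hb h

@[fun_prop]
theorem Poly.append {l l' : α → List β} (hl : Poly l) (hl' : Poly l') :
    Poly fun x => l x ++ l' x := by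
  have := Poly.foldr (step := fun _ a s => a :: s)
    (b := fun y : α × β => esize y.2 + 1) hl hl' (by fun_prop) (by fun_prop)
    (fun x s a => by simp only [esize_cons]; omega)
  simpa using this

theorem Poly.map {l : α → List β} {f : α → β → γ} (hl : Poly l)
    (hf : Poly fun y : α × β => f y.1 y.2) : Poly fun x => (l x).map (f x) := by
  have := Poly.foldr (init := fun _ => []) (step := fun x a s => f x a :: s)
    (b := fun y : α × β => esize (f y.1 y.2) + 1) hl (by fun_prop)
    (Poly.cons (hf.comp (f := fun y : α × List γ × β => (y.1, y.2.2)) (by fun_prop)) (by fun_prop))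
    (by fun_prop)
    (fun x s a => by simp only [esize_cons]; omega)
  refine this.of_enc_eq fun x => ?_
  congr 1
  induction l x with
  | nil => rfl
  | cons a t ih => rw [List.map_cons, List.foldr_cons, ih]

theorem Poly.flatMap {l : α → List β} {f : α → β → List γ} (hl : Poly l)
    (hf : Poly fun y : α × β => f y.1 y.2) : Poly fun x => (l x).flatMap (f x) := by
  have := Poly.foldr (init := fun _ => []) (step := fun x a s => f x a ++ s)
    (b := fun y : α × β => esize (f y.1 y.2)) hl (by fun_prop)
    (Poly.append (hf.comp (f := fun y : α × List γ × β => (y.1, y.2.2)) (by fun_prop))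
      (by fun_prop)) (by fun_prop)
    (fun x s a => by have := esize_append (f x a) s; dsimp only; omega)
  refine this.of_enc_eq fun x => ?_
  congr 1
  induction l x with
  | nil => rfl
  | cons a t ih => simp [ih]

theorem Poly.all {l : α → List β} {f : α → β → Bool} (hl : Poly l)
    (hf : Poly fun y : α × β => f y.1 y.2) : Poly fun x => (l x).all (f x) := by
  have := Poly.foldr (init := fun _ => true) (step := fun x a s => f x a && s)
    (b := fun _ : α × β => 0) hl (by fun_prop)
    (Poly.and (hf.comp (f := fun y : α × Bool × β => (y.1, y.2.2)) (by fun_prop))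
      (by fun_prop)) (by fun_prop) (fun x s a => by simp)
  refine this.of_enc_eq fun x => ?_
  congr 1
  induction l x with
  | nil => rfl
  | cons a t ih => simp [ih]

@[fun_prop]
theorem Poly.length {l : α → List β} (hl : Poly l) : Poly fun x => (l x).length := by
  refine (Poly.map (f := fun _ _ => ()) hl (by fun_prop)).of_enc_eq fun x => ?_
  rw [← enc_replicate]; simp

@[fun_prop]
theorem Poly.succ {n : α → ℕ} (hn : Poly n) : Poly fun x => n x + 1 :=
  (Poly.cons (.const ()) hn.replicate_unit).of_enc_eq fun _ => rfl

@[fun_prop]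
theorem Poly.pred {n : α → ℕ} (hn : Poly n) : Poly fun x => n x - 1 :=
  (hn.replicate_unit.tail).of_enc_eq fun x => by simp [← enc_replicate]

@[fun_prop]
theorem Poly.isZero {n : α → ℕ} (hn : Poly n) : Poly fun x => n x == 0 :=
  (hn.replicate_unit.isEmpty).of_enc_eq fun x => by cases n x <;> rfl

@[fun_prop]
theorem Poly.add {m n : α → ℕ} (hm : Poly m) (hn : Poly n) : Poly fun x => m x + n x :=
  (hm.replicate_unit.append hn.replicate_unit).of_enc_eq fun x => by
    simp [← enc_replicate, List.replicate_append_replicate]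

@[fun_prop]
theorem Poly.sub {m n : α → ℕ} (hm : Poly m) (hn : Poly n) : Poly fun x => m x - n x := by
  have := Poly.iterate (step := fun _ s => s - 1) (b := fun _ : α => 0) hn hm
    (by fun_prop) (by fun_prop) (fun x s => by simp only [esize_nat]; omega)
  refine this.of_enc_eq fun x => ?_
  congr 1
  induction n x with
  | zero => rfl
  | succ k ih => rw [Function.iterate_succ_apply', ← ih]; rfl

@[fun_prop]
theorem Poly.mul {m n : α → ℕ} (hm : Poly m) (hn : Poly n) : Poly fun x => m x * n x := by
  have := Poly.iterate (init := fun _ => 0) (step := fun x s => s + m x)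
    (b := fun x : α => 2 * m x) hn
    (by fun_prop) (by fun_prop) ?_ (fun x s => by simp only [esize_nat]; omega)
  · refine this.of_enc_eq fun x => ?_
    congr 1
    induction n x with
    | zero => rfl
    | succ k ih => rw [Function.iterate_succ_apply', ← ih]; rfl
  · exact (PolyBdd.esize_poly hm).mono fun x => by simp

@[fun_prop]
theorem Poly.ble {m n : α → ℕ} (hm : Poly m) (hn : Poly n) : Poly fun x => (m x).ble (n x) := by
  refine (hm.sub hn).isZero.of_enc_eq fun x => ?_
  congr 1
  rw [Bool.eq_iff_iff]; simp; omega

@[fun_prop]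
theorem Poly.beq_nat {m n : α → ℕ} (hm : Poly m) (hn : Poly n) : Poly fun x => m x == n x := by
  refine ((hm.ble hn).and (hn.ble hm)).of_enc_eq fun x => ?_
  congr 1
  rw [Bool.eq_iff_iff]; simp; omega

@[fun_prop]
theorem Poly.drop {n : α → ℕ} {l : α → List β} (hn : Poly n) (hl : Poly l) :
    Poly fun x => (l x).drop (n x) := by
  have := Poly.iterate (step := fun _ s => s.tail) (b := fun _ : α => 0) hn hl
    (by fun_prop) (by fun_prop) (fun x s => esize_le_of_sublist (List.tail_sublist s))
  refine this.of_enc_eq fun x => ?_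
  congr 1
  induction n x with
  | zero => rfl
  | succ k ih => rw [Function.iterate_succ_apply', ← ih, List.tail_drop]

@[fun_prop]
theorem Poly.take {n : α → ℕ} {l : α → List β} (hn : Poly n) (hl : Poly l) :
    Poly fun x => (l x).take (n x) := by
  refine (Poly.reverse (Poly.drop ((hl.length).sub hn) hl.reverse)).of_enc_eq fun x => ?_
  rw [List.drop_reverse, List.reverse_reverse]
  congr 1
  rcases le_total (n x) (l x).length with h | h
  · rw [Nat.sub_sub_self h]
  · rw [List.take_of_length_le h, List.take_of_length_le (by omega)]

@[fun_prop]
theorem Poly.getD {n : α → ℕ} {l : α → List β} {d : α → β} (hn : Poly n) (hl : Poly l)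
    (hd : Poly d) : Poly fun x => (l x).getD (n x) (d x) := by
  refine (Poly.headD (hn.drop hl) hd).of_enc_eq fun x => ?_
  congr 1
  simp [List.getD_eq_getElem?_getD, ← List.head?_drop]


@[fun_prop]
theorem Poly.replicate {n : α → ℕ} {b : α → β} (hn : Poly n) (hb : Poly b) :
    Poly fun x => List.replicate (n x) (b x) :=
  (Poly.map (f := fun x _ => b x) hn.replicate_unit (by fun_prop)).of_enc_eq fun x => by simp

-- The entry appended is the current length, which grows with the state, so the additive criterion
-- `Poly.foldl` does not apply. Every intermediate list is however a range of length at most `n x`,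
-- and this bounds its size directly.
@[fun_prop]
theorem Poly.range {n : α → ℕ} (hn : Poly n) : Poly fun x => List.range (n x) := by
  have key : ∀ l : List Unit, l.foldl (fun s _ => s ++ [s.length]) [] = List.range l.length := by
    intro l
    induction l using List.reverseRecOn with
    | nil => rfl
    | append_singleton l a ih => simp [ih, List.range_succ]
  have hn' : PolyBdd n := (PolyBdd.esize_poly hn).mono fun x => by simp; omega
  have := Poly.foldl_of_bound (init := fun _ => []) (step := fun _ s _ => s ++ [s.length])
    (l := fun x => List.replicate (n x) ()) (B := fun x => n x * (2 * n x + 1 + 1) + 1)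
    hn.replicate_unit (by fun_prop) (by fun_prop) (by fun_prop) fun x l' hl' => ?_
  · simpa only [key, List.length_replicate] using this
  · have h := hl'.length_le
    rw [List.length_replicate] at h
    rw [key]
    refine (esize_le_mul (b := 2 * n x + 1) fun a ha => ?_).trans ?_
    · have := List.mem_range.1 ha
      simp only [esize_nat]; omega
    · rw [List.length_range]
      gcongr

end TreeProg

end

noncomputable section

namespace TreeProg

open Enc

/-! ### The decision procedure: reading the word -/

/-- A token: a symbol other than `tick`, with the number of ticks in front of it. -/
abbrev Tok : Type := CodeSym × ℕ

/-- Read from the right, a tick belongs to the token that follows it. The last tick of a word that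
ends in ticks opens the token `(.tick, 0)`, which stands for one tick by itself. -/
def lexStep (c : CodeSym) (ts : List Tok) : List Tok :=
  bif c == .tick then
    bif ts.isEmpty then [(.tick, 0)]
    else ((ts.headD (.tick, 0)).1, (ts.headD (.tick, 0)).2 + 1) :: ts.tail
  else (c, 0) :: ts

/-- The tokens of a word; ticks at the end form a token of their own. -/
def lex (w : List CodeSym) : List Tok := w.foldr lexStep []

/-- Whether the numbers in `l` lie in the half-open intervals `bs`, one each. -/
def inBounds (l : List ℕ) (bs : List (ℕ × ℕ)) : Bool :=
  (fun s : Bool × List ℕ => s.1 && s.2.isEmpty) (bs.foldl (fun s b =>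
    (s.1 && !s.2.isEmpty && b.1.ble (s.2.headD 0) && (s.2.headD 0 + 1).ble b.2, s.2.tail)) (true, l))

/-- Equality is matching against one-point intervals. One routine thus checks a whole row of the
table, whose first part is prescribed and whose second part is only bounded. -/
def eqList (l l' : List ℕ) : Bool := inBounds l (l'.map fun d => (d, d + 1))

/-- All tuples below the given bounds in lexicographic order. -/
def tuples (cs : List ℕ) : List (List ℕ) :=
  cs.foldr (fun c acc => (List.range c).flatMap fun d => acc.map fun z => d :: z) [[]]

/-- The same, cut off after `B` tuples at every stage. -/
def tuplesUpTo (B : ℕ) (cs : List ℕ) : List (List ℕ) :=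
  cs.foldr (fun c acc => ((List.range c).flatMap fun d => acc.map fun z => d :: z).take B) [[]]

/-- The part of an instance before the formula, as numbers; values are ranks. -/
structure Front where
  numExo : ℕ
  numEndo : ℕ
  cards : List ℕ
  rows : List (List ℕ)
  table : List ℕ
  pre : ℕ
  loop : ℕ
  context : List ℕ
  default : List ℕ
  time : ℕ

namespace Front

def toTuple (E : Front) : ℕ × ℕ × List ℕ × List (List ℕ) × List ℕ × ℕ × ℕ × List ℕ × List ℕ × ℕ :=
  (E.numExo, E.numEndo, E.cards, E.rows, E.table, E.pre, E.loop, E.context, E.default, E.time)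

instance : Enc Front := ⟨fun E => enc E.toTuple⟩

/-- The numbers in the order of the encoding. -/
def nums (E : Front) : List ℕ :=
  E.numExo :: E.numEndo :: (E.cards ++ (E.table ++ (E.pre :: E.loop ::
    (E.context ++ (E.default ++ [E.time])))))

def endoCards (E : Front) : List ℕ := E.cards.drop E.numExo

/-- The intervals in which the values of the endogenous variables lie. -/
def endoBounds (E : Front) : List (ℕ × ℕ) := E.endoCards.map fun c => (0, c)

def exoBounds (E : Front) : List (ℕ × ℕ) := (E.cards.take E.numExo).map fun c => (0, c)

def rowBounds (E : Front) (z : List ℕ) : List (ℕ × ℕ) :=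
  z.map (fun d => (d, d + 1)) ++ E.endoBounds

/-- Whether the data are in range. -/
def check (E : Front) : Bool :=
  E.cards.length == E.numExo + E.numEndo && E.cards.all (fun c => (1).ble c) &&
  inBounds E.table (E.rows.flatMap fun z => E.rowBounds z) && (1).ble E.loop &&
  inBounds E.context ((List.replicate (E.pre + E.loop) ()).flatMap fun _ => E.exoBounds) &&
  inBounds E.default E.endoBounds

/-- The values of the structural equations at the tuple `z`. -/
def lookup (E : Front) (z : List ℕ) : List ℕ :=
  (((fun tb => bif eqList (tb.take (E.numExo + E.numEndo)) z then tb
    else tb.drop (E.numExo + E.numEndo + E.numEndo))^[E.table.length] E.table).drop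
      (E.numExo + E.numEndo)).take E.numEndo

end Front

def readFront₄ (p q : ℕ) (cards : List ℕ) (rows : List (List ℕ)) (table : List ℕ) (pre loop : ℕ)
    (ns : List ℕ) : Front :=
  ⟨p, q, cards, rows, table, pre, loop, ns.take ((pre + loop) * p),
    (ns.drop ((pre + loop) * p)).take q, ((ns.drop ((pre + loop) * p)).drop q).headD 0⟩

def readFront₃ (p q : ℕ) (cards : List ℕ) (rows : List (List ℕ)) (table ns : List ℕ) : Front :=
  readFront₄ p q cards rows table (ns.headD 0) (ns.tail.headD 0) ns.tail.tail

def readFront₂ (p q : ℕ) (cards : List ℕ) (rows : List (List ℕ)) (ns : List ℕ) : Front :=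
  readFront₃ p q cards rows (ns.take (rows.length * (p + q + q)))
    (ns.drop (rows.length * (p + q + q)))

/-- The cut-off is one more than the count of numbers that remain. A genuine table has at least one
entry per row, so nothing is lost; and an enumeration that reaches the cut-off cannot match any
table contained in the word. -/
def readFront₁ (p q : ℕ) (ns : List ℕ) : Front :=
  readFront₂ p q (ns.take (p + q))
    (tuplesUpTo ((ns.drop (p + q)).length + 1) (ns.take (p + q))) (ns.drop (p + q))

/-- Read the part before the formula from the numbers in the word. -/
def readFront (ns : List ℕ) : Front := readFront₁ (ns.headD 0) (ns.tail.headD 0) ns.tail.tail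

/-! ### The decision procedure: computations and formulas -/

/-- A component of an intervention: variable, time and rank of the value. -/
abbrev Setting : Type := ℕ × ℕ × ℕ

/-- Apply the components of an intervention that concern time `i` to a tuple of values. -/
def overrideAt (es : List Setting) (i : ℕ) (s : List ℕ) : List ℕ :=
  es.foldl (fun s e => bif e.2.1 == i then s.take e.1 ++ e.2.2 :: s.drop (e.1 + 1) else s) s

/-- One step of a computation. The state holds the time, the position in the context, the current
values and all earlier values. -/
def traceStep (E : Front) (es : List Setting) (s : ℕ × ℕ × List ℕ × List (List ℕ)) :
    ℕ × ℕ × List ℕ × List (List ℕ) :=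
  (s.1 + 1, bif s.2.1 + 1 == E.pre + E.loop then E.pre else s.2.1 + 1,
    overrideAt es (s.1 + 1)
      (E.lookup ((E.context.drop (s.2.1 * E.numExo)).take E.numExo ++ s.2.2.1)),
    s.2.2.1 :: s.2.2.2)

/-- The first `L` values of the computation under an intervention. -/
def trace (E : Front) (es : List Setting) (L : ℕ) : List (List ℕ) :=
  (((traceStep E es)^[L] (0, 0, overrideAt es 0 E.default, [])).2.2.2).reverse

/-- Until and since satisfy the same one-step recursion, towards the future and the past
respectively. Beyond the ends of the segment the value counts as false. -/
def untilStep (y : Bool × Bool) (acc : List Bool) : List Bool :=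
  (y.2 || (y.1 && acc.headD false)) :: acc

/-- Truth values of an until-formula, except at the last `D` positions. -/
def untilList (D : ℕ) (a b : List Bool) : List Bool :=
  (fun u : List Bool => u.take (u.length - D)) ((a.zip b).foldr untilStep [])

def sinceList (a b : List Bool) : List Bool :=
  ((a.zip b).foldl (fun acc y => untilStep y acc) []).reverse

/-- One step in the evaluation of a PLTL formula from right to left. The state holds the numbers
read and the truth values of the complete subformulas read. -/
def evalStep (tr : List (List ℕ)) (D : ℕ) (t : Tok) (s : List ℕ × List (List Bool)) :
    List ℕ × List (List Bool) :=
  bif t.1 == .bar then (t.2 :: s.1, s.2)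
  -- Numbers that have been used stay on the list; the two that belong to an atom are always the
  -- latest ones.
  else bif t.1 == .atom then
    (s.1, (tr.map fun a => a.getD (s.1.headD 0) 0 == s.1.tail.headD 0) :: s.2)
  else bif t.1 == .neg then (s.1, (s.2.headD []).map (fun b => !b) :: s.2.tail)
  else bif t.1 == .conj then
    (s.1, (((s.2.headD []).zip (s.2.tail.headD [])).map fun y => y.1 && y.2) :: s.2.tail.tail)
  else bif t.1 == .nxt then (s.1, (s.2.headD []).tail :: s.2.tail)
  else bif t.1 == .untl then
    (s.1, untilList D (s.2.headD []) (s.2.tail.headD []) :: s.2.tail.tail)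
  else bif t.1 == .prv then (s.1, (false :: s.2.headD []) :: s.2.tail)
  else (s.1, sinceList (s.2.headD []) (s.2.tail.headD []) :: s.2.tail.tail)

/-- Truth values of a PLTL formula at an initial segment of the positions of a trace. -/
def evalPLTL (tr : List (List ℕ)) (D : ℕ) (ts : List Tok) : List Bool :=
  (ts.foldr (evalStep tr D) ([], [])).2.headD []

/-- A bound on the periods of computations. -/
def Front.period (E : Front) : ℕ := E.loop * E.table.length

/-- A length of traces that suffices to evaluate a formula of length `n` at the given time. -/
def Front.horizon (E : Front) (es : List Setting) (n : ℕ) : ℕ :=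
  E.time + E.pre + es.foldl (fun s e => s + e.2.1) 0 + E.period + n * (2 * E.period + 1) + 2

/-- The truth value of `[int] ψ`. -/
def evalBox (E : Front) (es : List Setting) (ts : List Tok) : Bool :=
  (evalPLTL (trace E es (E.horizon es ts.length)) E.period ts).getD E.time false

/-- What has been recognized in a formula: a tag and a content. -/
abbrev Item : Type := CodeSym × ℕ × List Setting × List Tok

/-- The tags are borrowed from the alphabet. A PLTL formula keeps its tokens, since it can be
evaluated only after the intervention to its left has been read, whereas a CPLTL formula keeps only
its truth value. The tag of `junk` passes no test, so popping from an empty stack makes a step fail.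
-/
def Item.num (n : ℕ) : Item := (.bar, n, [], [])
def Item.settings (es : List Setting) : Item := (.rbr, 0, es, [])
def Item.path (ts : List Tok) : Item := (.atom, 0, [], ts)
def Item.truth (b : Bool) : Item := (.lbr, bif b then 1 else 0, [], [])
def Item.junk : Item := (.tick, 0, [], [])

def atomStep (E : Front) (t : Tok) (s : List Item) : Bool × List Item :=
  bif (s.headD .junk).1 == .bar && (s.tail.headD .junk).1 == .bar &&
    ((s.headD .junk).2.1 + 1).ble E.numEndo &&
    ((s.tail.headD .junk).2.1 + 1).ble (E.endoCards.getD (s.headD .junk).2.1 0)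
  then (true, .path [t, (.bar, (s.headD .junk).2.1), (.bar, (s.tail.headD .junk).2.1)] ::
    s.tail.tail)
  else (false, [])

/-- Negation belongs to both logics; the tag of its argument tells which one is meant. The same
holds for conjunction in `binaryStep`. -/
def unaryStep (t : Tok) (s : List Item) : Bool × List Item :=
  bif (s.headD .junk).1 == .atom then (true, .path (t :: (s.headD .junk).2.2.2) :: s.tail)
  else bif (s.headD .junk).1 == .lbr && t.1 == .neg then
    (true, .truth ((s.headD .junk).2.1 == 0) :: s.tail)
  else (false, [])

def binaryStep (t : Tok) (s : List Item) : Bool × List Item :=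
  bif (s.headD .junk).1 == .atom && (s.tail.headD .junk).1 == .atom then
    (true, .path (t :: ((s.headD .junk).2.2.2 ++ (s.tail.headD .junk).2.2.2)) :: s.tail.tail)
  else bif (s.headD .junk).1 == .lbr && (s.tail.headD .junk).1 == .lbr && t.1 == .conj then
    (true, .truth (!((s.headD .junk).2.1 == 0) && !((s.tail.headD .junk).2.1 == 0)) :: s.tail.tail)
  else (false, [])

/-- The last test compares the new setting with all settings to its right; passing it at each
setting is the pairwise condition in `Intervention`. -/
def setStep (E : Front) (s : List Item) : Bool × List Item :=
  bif (s.headD .junk).1 == .bar && (s.tail.headD .junk).1 == .bar &&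
    (s.tail.tail.headD .junk).1 == .bar && (s.tail.tail.tail.headD .junk).1 == .rbr &&
    ((s.headD .junk).2.1 + 1).ble E.numEndo &&
    ((s.tail.tail.headD .junk).2.1 + 1).ble (E.endoCards.getD (s.headD .junk).2.1 0) &&
    (s.tail.tail.tail.headD .junk).2.2.1.all (fun e =>
      !(e.1 == (s.headD .junk).2.1 && e.2.1 == (s.tail.headD .junk).2.1))
  then (true, .settings (((s.headD .junk).2.1, (s.tail.headD .junk).2.1,
    (s.tail.tail.headD .junk).2.1) :: (s.tail.tail.tail.headD .junk).2.2.1) ::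
      s.tail.tail.tail.tail)
  else (false, [])

def boxStep (E : Front) (s : List Item) : Bool × List Item :=
  bif (s.headD .junk).1 == .rbr && (s.tail.headD .junk).1 == .atom then
    (true, .truth (evalBox E (s.headD .junk).2.2.1 (s.tail.headD .junk).2.2.2) :: s.tail.tail)
  else (false, [])

/-- One step of reading a CPLTL formula from right to left. The Boolean says whether the tokens
can belong to a formula. -/
def parseStep (E : Front) (t : Tok) (s : Bool × List Item) : Bool × List Item :=
  bif !s.1 then (false, [])
  else bif t.1 == .bar then (true, .num t.2 :: s.2)
  else bif !(t.2 == 0) then (false, [])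
  else bif t.1 == .atom then atomStep E t s.2
  else bif t.1 == .neg || t.1 == .nxt || t.1 == .prv then unaryStep t s.2
  else bif t.1 == .conj || t.1 == .untl || t.1 == .snce then binaryStep t s.2
  else bif t.1 == .rbr then (true, .settings [] :: s.2)
  else bif t.1 == .set then setStep E s.2
  else bif t.1 == .lbr then boxStep E s.2
  else (false, [])

def parse (E : Front) (ts : List Tok) : Bool × List Item := ts.foldr (parseStep E) (true, [])

def acceptItems (s : Bool × List Item) : Bool :=
  s.1 && s.2.tail.isEmpty && (s.2.headD .junk).1 == .lbr && (s.2.headD .junk).2.1 == 1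

def acceptToks (E : Front) (ts : List Tok) : Bool :=
  E.check && eqList ((ts.take E.nums.length).map fun t => t.2) E.nums &&
  (ts.take E.nums.length).all (fun t => t.1 == .bar) &&
  acceptItems (parse E (ts.drop E.nums.length))

/-- The decision procedure. -/
def accept (w : List CodeSym) : Bool :=
  (fun ts : List Tok => acceptToks (readFront (ts.map fun t => t.2)) ts) (lex w)

end TreeProg

end

noncomputable section

namespace TreeProg

open Enc

variable {α β γ δ σ : Type} [Enc α] [Enc β] [Enc γ] [Enc δ] [Enc σ]

/-! ### The decision procedure is polynomial -/

theorem esize_headD_add_tail (l : List β) (d : β) :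
    esize (l.headD d) + esize l.tail ≤ esize l + esize d := by
  cases l <;> simp <;> omega

theorem esize_lexStep (c : CodeSym) (ts : List Tok) : esize (lexStep c ts) ≤ esize ts + 10 := by
  have := esize_headD_add_tail ts (.tick, 0)
  unfold lexStep
  cases c == .tick <;> cases ts <;> simp [esize_prod] <;> omega

theorem Poly.lex : Poly lex := by
  refine (Poly.foldr (l := fun w : List CodeSym => w) (init := fun _ => [])
    (step := fun _ => lexStep) (b := fun _ => 10) (by fun_prop) (by fun_prop) ?_ (by fun_prop)
    fun _ s a => esize_lexStep a s)
  unfold lexStep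
  fun_prop

@[fun_prop]
theorem Poly.inBounds {l : α → List ℕ} {bs : α → List (ℕ × ℕ)} (hl : Poly l) (hb : Poly bs) :
    Poly fun x => inBounds (l x) (bs x) := by
  unfold TreeProg.inBounds
  refine Poly.comp (g := fun s : Bool × List ℕ => s.1 && s.2.isEmpty) (by fun_prop)
    (Poly.foldl (b := fun _ => 0) (step := fun _ (s : Bool × List ℕ) (b : ℕ × ℕ) =>
    (s.1 && !s.2.isEmpty && b.1.ble (s.2.headD 0) && (s.2.headD 0 + 1).ble b.2, s.2.tail))
    hb (by fun_prop) ?_ (by fun_prop) fun x s b => ?_)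
  · fun_prop
  · have := esize_le_of_sublist (List.tail_sublist s.2)
    simp only [esize_prod, esize_bool]; omega

@[fun_prop]
theorem Poly.eqList {l l' : α → List ℕ} (hl : Poly l) (hl' : Poly l') :
    Poly fun x => eqList (l x) (l' x) := by
  unfold TreeProg.eqList
  have := Poly.map (f := fun _ d => (d, d + 1)) hl' (by fun_prop)
  fun_prop

theorem esize_le_of_mem_tuplesUpTo {B : ℕ} {cs z : List ℕ} (h : z ∈ tuplesUpTo B cs) :
    esize z ≤ esize cs := by
  induction cs generalizing z with
  | nil => simp [tuplesUpTo] at h; simp [h]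
  | cons c cs ih =>
    have h' := List.mem_of_mem_take h
    simp only [List.mem_flatMap, List.mem_range, List.mem_map] at h'
    obtain ⟨d, hd, z', hz', rfl⟩ := h'
    have := ih hz'
    simp only [esize_cons, esize_nat]
    omega

/-- One more than `B`, because the initial list `[[]]` is not cut off, even for `B = 0`. -/
theorem length_tuplesUpTo_le (B : ℕ) (cs : List ℕ) : (tuplesUpTo B cs).length ≤ B + 1 := by
  cases cs with
  | nil => simp [tuplesUpTo]
  | cons c cs =>
    simp only [tuplesUpTo, List.foldr_cons, List.length_take]
    omega

-- This is the effect of the cut-off: an intermediate list has at most `B x + 1` tuples, each no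
-- larger than the list of bounds, although the full enumeration may be exponential.
@[fun_prop]
theorem Poly.tuplesUpTo {B : α → ℕ} {cs : α → List ℕ} (hB : Poly B) (hc : Poly cs) :
    Poly fun x => tuplesUpTo (B x) (cs x) := by
  have hB' : PolyBdd B := (PolyBdd.esize_poly hB).mono fun x => by simp; omega
  have := Poly.foldl_of_bound (init := fun _ => [[]]) (step := fun x (acc : List (List ℕ)) c =>
      ((List.range c).flatMap fun d => acc.map fun z => d :: z).take (B x))
    (B := fun x => (B x + 1) * (esize (cs x) + 1) + 1) hc.reverse (by fun_prop) ?_ (by fun_prop)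
    fun x l' hl' => ?_
  · refine this.of_enc_eq fun x => ?_
    rw [List.foldl_reverse]; rfl
  · refine Poly.take (by fun_prop) (Poly.flatMap (l := fun y : α × List (List ℕ) × ℕ => List.range y.2.2)
      (f := fun y d => y.2.1.map fun z => d :: z)
      (by fun_prop) (Poly.map (l := fun y : (α × List (List ℕ) × ℕ) × ℕ => y.1.2.1)
        (f := fun y z => y.2 :: z)
        (by fun_prop) (by fun_prop)))
  · have h : l'.foldl (fun acc c =>
        ((List.range c).flatMap fun d => acc.map fun z => d :: z).take (B x)) [[]] =
        TreeProg.tuplesUpTo (B x) l'.reverse := by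
      rw [TreeProg.tuplesUpTo, List.foldr_reverse]
    rw [h]
    refine (esize_le_mul (b := esize (cs x)) fun z hz =>
      (esize_le_of_mem_tuplesUpTo hz).trans ?_).trans ?_
    · rw [esize_reverse, ← esize_reverse (cs x)]
      exact esize_le_of_sublist hl'.sublist
    · gcongr
      exact length_tuplesUpTo_le _ _

theorem Poly.toTuple : Poly Front.toTuple := (Poly.id (α := Front)).of_enc_eq fun _ => rfl

section Front

variable {E : α → Front}

@[fun_prop] theorem Poly.front_numExo (h : Poly E) : Poly fun x => (E x).numExo :=
  (Poly.toTuple.comp h).fst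
@[fun_prop] theorem Poly.front_numEndo (h : Poly E) : Poly fun x => (E x).numEndo :=
  (Poly.toTuple.comp h).snd.fst
@[fun_prop] theorem Poly.front_cards (h : Poly E) : Poly fun x => (E x).cards :=
  (Poly.toTuple.comp h).snd.snd.fst
@[fun_prop] theorem Poly.front_rows (h : Poly E) : Poly fun x => (E x).rows :=
  (Poly.toTuple.comp h).snd.snd.snd.fst
@[fun_prop] theorem Poly.front_table (h : Poly E) : Poly fun x => (E x).table :=
  (Poly.toTuple.comp h).snd.snd.snd.snd.fst
@[fun_prop] theorem Poly.front_pre (h : Poly E) : Poly fun x => (E x).pre :=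
  (Poly.toTuple.comp h).snd.snd.snd.snd.snd.fst
@[fun_prop] theorem Poly.front_loop (h : Poly E) : Poly fun x => (E x).loop :=
  (Poly.toTuple.comp h).snd.snd.snd.snd.snd.snd.fst
@[fun_prop] theorem Poly.front_context (h : Poly E) : Poly fun x => (E x).context :=
  (Poly.toTuple.comp h).snd.snd.snd.snd.snd.snd.snd.fst
@[fun_prop] theorem Poly.front_default (h : Poly E) : Poly fun x => (E x).default :=
  (Poly.toTuple.comp h).snd.snd.snd.snd.snd.snd.snd.snd.fst
@[fun_prop] theorem Poly.front_time (h : Poly E) : Poly fun x => (E x).time :=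
  (Poly.toTuple.comp h).snd.snd.snd.snd.snd.snd.snd.snd.snd

end Front

theorem Poly.readFront : Poly readFront := by
  have h4 {a b e f : List ℕ → ℕ} {c t n : List ℕ → List ℕ} {r : List ℕ → List (List ℕ)} (ha : Poly a) (hb : Poly b)
      (he : Poly e) (hf : Poly f) (hc : Poly c) (ht : Poly t) (hn : Poly n) (hr : Poly r) :
      Poly fun x => readFront₄ (a x) (b x) (c x) (r x) (t x) (e x) (f x) (n x) := by
    refine Poly.of_enc_eq (f := fun x => (readFront₄ (a x) (b x) (c x) (r x) (t x) (e x) (f x)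
      (n x)).toTuple) ?_ fun _ => rfl
    simp only [readFront₄, Front.toTuple]
    fun_prop
  have h3 {a b : List ℕ → ℕ} {c t n : List ℕ → List ℕ} {r : List ℕ → List (List ℕ)} (ha : Poly a) (hb : Poly b)
      (hc : Poly c) (ht : Poly t) (hn : Poly n) (hr : Poly r) :
      Poly fun x => readFront₃ (a x) (b x) (c x) (r x) (t x) (n x) :=
    h4 ha hb (by fun_prop) (by fun_prop) hc ht (by fun_prop) hr
  have h2 {a b : List ℕ → ℕ} {c n : List ℕ → List ℕ} {r : List ℕ → List (List ℕ)} (ha : Poly a) (hb : Poly b)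
      (hc : Poly c) (hn : Poly n) (hr : Poly r) :
      Poly fun x => readFront₂ (a x) (b x) (c x) (r x) (n x) :=
    h3 ha hb hc (by fun_prop) (by fun_prop) hr
  have h1 {a b : List ℕ → ℕ} {n : List ℕ → List ℕ} (ha : Poly a) (hb : Poly b) (hn : Poly n) :
      Poly fun x => readFront₁ (a x) (b x) (n x) :=
    h2 ha hb (by fun_prop) (by fun_prop) (by fun_prop)
  exact h1 (by fun_prop) (by fun_prop) (by fun_prop)

@[fun_prop]
theorem Poly.nums {E : α → Front} (h : Poly E) : Poly fun x => (E x).nums := by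
  unfold Front.nums; fun_prop

@[fun_prop]
theorem Poly.endoCards {E : α → Front} (h : Poly E) : Poly fun x => (E x).endoCards := by
  unfold Front.endoCards; fun_prop

@[fun_prop]
theorem Poly.endoBounds {E : α → Front} (h : Poly E) : Poly fun x => (E x).endoBounds :=
  Poly.map (f := fun _ c => (0, c)) (by fun_prop) (by fun_prop)

@[fun_prop]
theorem Poly.exoBounds {E : α → Front} (h : Poly E) : Poly fun x => (E x).exoBounds :=
  Poly.map (f := fun _ c => (0, c)) (by fun_prop) (by fun_prop)

@[fun_prop]
theorem Poly.rowBounds {E : α → Front} {z : α → List ℕ} (h : Poly E) (hz : Poly z) :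
    Poly fun x => (E x).rowBounds (z x) := by
  unfold Front.rowBounds
  have := Poly.map (f := fun _ d => (d, d + 1)) hz (by fun_prop)
  fun_prop

@[fun_prop]
theorem Poly.check {E : α → Front} (h : Poly E) : Poly fun x => (E x).check := by
  unfold Front.check
  have h1 := Poly.all (l := fun x => (E x).cards) (f := fun _ c => (1).ble c) (by fun_prop)
    (by fun_prop)
  have h2 := Poly.flatMap (l := fun x => (E x).rows) (f := fun x z => (E x).rowBounds z)
    (by fun_prop) (by fun_prop)
  have h3 := Poly.flatMap (l := fun x => List.replicate ((E x).pre + (E x).loop) ())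
    (f := fun x _ => (E x).exoBounds) (by fun_prop) (by fun_prop)
  fun_prop

/-- The result is obtained from the table by dropping and taking, so its size is bounded
independently of the argument `z`. This keeps the tuples in a trace from growing. -/
theorem Front.lookup_sublist (E : Front) (z : List ℕ) : (E.lookup z).Sublist E.table := by
  refine (List.take_sublist _ _).trans ((List.drop_sublist _ _).trans ?_)
  induction E.table.length with
  | zero => exact .refl _
  | succ k ih =>
    rw [Function.iterate_succ_apply']
    refine List.Sublist.trans ?_ ih
    cases eqList _ z
    · exact List.drop_sublist _ _
    · exact .refl _

@[fun_prop]
theorem Poly.lookup {E : α → Front} {z : α → List ℕ} (h : Poly E) (hz : Poly z) :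
    Poly fun x => (E x).lookup (z x) := by
  unfold Front.lookup
  have := Poly.iterate (n := fun x => (E x).table.length) (init := fun x => (E x).table)
    (b := fun _ => 0)
    (step := fun x tb => bif TreeProg.eqList (tb.take ((E x).numExo + (E x).numEndo)) (z x) then tb
      else tb.drop ((E x).numExo + (E x).numEndo + (E x).numEndo)) (by fun_prop) (by fun_prop)
    (by fun_prop) (by fun_prop) fun x s => by
      cases TreeProg.eqList _ (z x)
      · exact esize_le_of_sublist (List.drop_sublist _ _)
      · exact le_rfl
  fun_prop

theorem esize_override_step (e : Setting) (i : ℕ) (s : List ℕ) :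
    esize (bif e.2.1 == i then s.take e.1 ++ e.2.2 :: s.drop (e.1 + 1) else s) ≤
      esize s + esize e := by
  cases e.2.1 == i
  · simp
  · have h1 := esize_append (s.take e.1) (e.2.2 :: s.drop (e.1 + 1))
    have h2 := esize_append (s.take e.1) (s.drop e.1)
    have h3 : esize (s.drop (e.1 + 1)) ≤ esize (s.drop e.1) := by
      rw [← List.drop_drop]
      exact esize_le_of_sublist (List.drop_sublist _ _)
    rw [List.take_append_drop] at h2
    simp only [esize_cons, esize_prod, cond_true] at *
    omega

theorem esize_overrideAt_le (es : List Setting) (i : ℕ) (s : List ℕ) :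
    esize (overrideAt es i s) ≤ esize s + esize es * esize es :=
  (esize_foldl_le (c := esize es) es s fun s e he => (esize_override_step e i s).trans
    (Nat.add_le_add_left (esize_le_of_mem he) _)).trans
    (Nat.add_le_add_left (Nat.mul_le_mul_right _ (length_lt_esize es).le) _)

@[fun_prop]
theorem Poly.overrideAt {es : α → List Setting} {i : α → ℕ} {s : α → List ℕ} (he : Poly es)
    (hi : Poly i) (hs : Poly s) : Poly fun x => overrideAt (es x) (i x) (s x) :=
  Poly.foldl (step := fun x (s : List ℕ) (e : Setting) =>
    bif e.2.1 == i x then s.take e.1 ++ e.2.2 :: s.drop (e.1 + 1) else s)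
    (b := fun y => esize y.2) he hs (by fun_prop) (by fun_prop)
    fun x s e => esize_override_step e (i x) s

@[fun_prop]
theorem Poly.traceStep : Poly fun y : (Front × List Setting) × ℕ × ℕ × List ℕ × List (List ℕ) =>
    traceStep y.1.1 y.1.2 y.2 := by
  unfold TreeProg.traceStep
  fun_prop

/-- The old values only move to the history and are already counted. The new ones come from the
table and the settings, and the position in the context grows by one or becomes `pre`; so the
increase does not depend on the state. -/
theorem esize_traceStep_le (E : Front) (es : List Setting)
    (s : ℕ × ℕ × List ℕ × List (List ℕ)) : esize (traceStep E es s) ≤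
      esize s + (esize E.table + esize es * esize es + 2 * E.pre + 20) := by
  have h1 := esize_overrideAt_le es (s.1 + 1)
    (E.lookup ((E.context.drop (s.2.1 * E.numExo)).take E.numExo ++ s.2.2.1))
  have h2 := esize_le_of_sublist (E.lookup_sublist
    ((E.context.drop (s.2.1 * E.numExo)).take E.numExo ++ s.2.2.1))
  unfold traceStep
  simp only [esize_prod, esize_cons, esize_nat] at *
  cases s.2.1 + 1 == E.pre + E.loop <;> simp only [cond_true, cond_false] <;> omega

@[fun_prop]
theorem PolyBdd.poly {n : α → ℕ} (h : Poly n) : PolyBdd n :=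
  (PolyBdd.esize_poly h).mono fun x => by simp; omega

@[fun_prop]
theorem Poly.trace {E : α → Front} {es : α → List Setting} {L : α → ℕ} (hE : Poly E) (he : Poly es)
    (hL : Poly L) : Poly fun x => trace (E x) (es x) (L x) := by
  unfold TreeProg.trace
  have := Poly.iterate (n := L) (init := fun x => (0, 0, TreeProg.overrideAt (es x) 0 (E x).default, []))
    (step := fun x => TreeProg.traceStep (E x) (es x))
    (b := fun x => esize (E x).table + esize (es x) * esize (es x) + 2 * (E x).pre + 20)
    hL (by fun_prop)
    (Poly.traceStep.comp (f := fun y : α × ℕ × ℕ × List ℕ × List (List ℕ) =>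
      ((E y.1, es y.1), y.2)) (by fun_prop)) (by fun_prop)
    fun x s => esize_traceStep_le (E x) (es x) s
  fun_prop

/-- A fold over the first list carries along the rest of the second. The default `d` only makes the
head total and never enters the result. -/
theorem Poly.zip {l : α → List β} {l' : α → List γ} (d : γ) (hl : Poly l) (hl' : Poly l') :
    Poly fun x => (l x).zip (l' x) := by
  have key : ∀ (l : List β) (l' : List γ) (u : List (β × γ)),
      (l.foldl (fun (s : List γ × List (β × γ)) a =>
        (s.1.tail, bif s.1.isEmpty then s.2 else (a, s.1.headD d) :: s.2)) (l', u)).2 =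
        (l.zip l').reverse ++ u := by
    intro l
    induction l with
    | nil => intro l' u; simp
    | cons a l ih =>
      intro l' u
      cases l' with
      | nil => simpa using ih [] u
      | cons b l' =>
        simpa only [List.foldl_cons, List.tail_cons, List.isEmpty_cons, cond_false,
          List.headD_cons, List.zip_cons_cons, List.reverse_cons, List.append_assoc,
          List.singleton_append] using ih l' ((a, b) :: u)
  have := Poly.foldl (l := l) (init := fun x => (l' x, []))
    (step := fun _ (s : List γ × List (β × γ)) a =>
      (s.1.tail, bif s.1.isEmpty then s.2 else (a, s.1.headD d) :: s.2))
    (b := fun y => esize y.2 + esize d + 2) hl (by fun_prop) (by fun_prop) (by fun_prop)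
    fun x s a => by
      have := esize_headD_add_tail s.1 d
      cases hs : s.1.isEmpty <;> simp only [esize_prod, cond_true, cond_false, esize_cons] <;> omega
  refine this.snd.reverse.of_enc_eq fun x => ?_
  rw [key]; simp

theorem esize_boolList (l : List Bool) : esize l = 2 * l.length + 1 := by
  induction l with
  | nil => rfl
  | cons a l ih => simp only [esize_cons, esize_bool, List.length_cons]; omega

@[fun_prop]
theorem Poly.untilStep : Poly fun y : (Bool × Bool) × List Bool => untilStep y.1 y.2 := by
  unfold TreeProg.untilStep; fun_prop

theorem length_foldr_untilStep (l : List (Bool × Bool)) :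
    (l.foldr untilStep []).length = l.length := by
  induction l with
  | nil => rfl
  | cons a l ih => simp [untilStep, ih]

@[fun_prop]
theorem Poly.untilList {D : α → ℕ} {a b : α → List Bool} (hD : Poly D) (ha : Poly a) (hb : Poly b) :
    Poly fun x => untilList (D x) (a x) (b x) := by
  unfold TreeProg.untilList
  have := Poly.foldr (l := fun x => (a x).zip (b x)) (init := fun _ => [])
    (step := fun _ => TreeProg.untilStep) (b := fun _ => 2) (Poly.zip false ha hb) (by fun_prop)
    (Poly.untilStep.comp (f := fun y : α × List Bool × Bool × Bool => (y.2.2, y.2.1))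
      (by fun_prop)) (by fun_prop)
    fun x s a => by simp only [TreeProg.untilStep, esize_cons, esize_bool]; omega
  fun_prop

@[fun_prop]
theorem Poly.sinceList {a b : α → List Bool} (ha : Poly a) (hb : Poly b) :
    Poly fun x => sinceList (a x) (b x) := by
  unfold TreeProg.sinceList
  have := Poly.foldl (l := fun x => (a x).zip (b x)) (init := fun _ => [])
    (step := fun _ acc y => TreeProg.untilStep y acc) (b := fun _ => 2) (Poly.zip false ha hb)
    (by fun_prop)
    (Poly.untilStep.comp (f := fun y : α × List Bool × Bool × Bool => (y.2.2, y.2.1))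
      (by fun_prop)) (by fun_prop)
    fun x s a => by simp only [TreeProg.untilStep, esize_cons, esize_bool]; omega
  fun_prop

theorem length_untilList (D : ℕ) (a b : List Bool) :
    (untilList D a b).length = min a.length b.length - D := by
  unfold untilList
  simp only [List.length_take, length_foldr_untilStep, List.length_zip]
  omega

theorem length_sinceList (a b : List Bool) :
    (sinceList a b).length = min a.length b.length := by
  unfold sinceList
  rw [List.length_reverse, ← List.foldr_reverse, length_foldr_untilStep, List.length_reverse,
    List.length_zip]

theorem Poly.evalStep : Poly fun y : (List (List ℕ) × ℕ) × Tok × List ℕ × List (List Bool) =>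
    evalStep y.1.1 y.1.2 y.2.1 y.2.2 := by
  unfold TreeProg.evalStep
  have h1 := Poly.map (l := fun y : (List (List ℕ) × ℕ) × Tok × List ℕ × List (List Bool) => y.1.1)
    (f := fun y a => a.getD (y.2.2.1.headD 0) 0 == y.2.2.1.tail.headD 0) (by fun_prop) (by fun_prop)
  have h2 := Poly.map
    (l := fun y : (List (List ℕ) × ℕ) × Tok × List ℕ × List (List Bool) => y.2.2.2.headD [])
    (f := fun _ b => !b) (by fun_prop) (by fun_prop)
  have h3 := Poly.map
    (l := fun y : (List (List ℕ) × ℕ) × Tok × List ℕ × List (List Bool) =>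
      (y.2.2.2.headD []).zip (y.2.2.2.tail.headD []))
    (f := fun _ b => b.1 && b.2) (Poly.zip false (by fun_prop) (by fun_prop)) (by fun_prop)
  fun_prop

end TreeProg

end

/-! ### Growth of the evaluator and of the parser, and polynomiality of the whole procedure. -/

noncomputable section

namespace TreeProg

open Enc

variable {α β γ δ σ : Type} [Enc α] [Enc β] [Enc γ] [Enc δ] [Enc σ]

/-- A connective consumes the lists it reads and returns one that is at most one entry longer than
its first argument. Only an atom adds a whole list, of the length of the trace. -/
theorem esize_evalStep_le (tr : List (List ℕ)) (D : ℕ) (t : Tok) (s : List ℕ × List (List Bool)) :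
    esize (evalStep tr D t s) ≤ esize s + (esize t + 2 * esize tr + 10) := by
  have h1 := esize_headD_add_tail s.2 []
  have h2 := esize_headD_add_tail s.2.tail []
  have h3 := length_lt_esize tr
  have h4 := esize_prod t
  unfold evalStep
  simp only [esize_boolList, esize_nil] at h1 h2
  cases t.1 == .bar
  swap
  · simp only [cond_true, esize_prod, esize_cons]; omega
  cases t.1 == .atom
  swap
  · simp only [cond_true, cond_false, esize_prod, esize_cons, esize_boolList, List.length_map]
    omega
  cases t.1 == .neg
  swap
  · simp only [cond_true, cond_false, esize_prod, esize_cons, esize_boolList, List.length_map]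
    omega
  cases t.1 == .conj
  swap
  · simp only [cond_true, cond_false, esize_prod, esize_cons, esize_boolList, List.length_map,
      List.length_zip]
    omega
  cases t.1 == .nxt
  swap
  · simp only [cond_true, cond_false, esize_prod, esize_cons, esize_boolList, List.length_tail]
    omega
  cases t.1 == .untl
  swap
  · simp only [cond_true, cond_false, esize_prod, esize_cons, esize_boolList, length_untilList]
    omega
  cases t.1 == .prv
  swap
  · simp only [cond_true, cond_false, esize_prod, esize_cons, esize_bool, esize_boolList]
    omega
  simp only [cond_false, esize_prod, esize_cons, esize_boolList, length_sinceList]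
  omega

@[fun_prop]
theorem Poly.evalPLTL {tr : α → List (List ℕ)} {D : α → ℕ} {ts : α → List Tok} (htr : Poly tr)
    (hD : Poly D) (hts : Poly ts) : Poly fun x => evalPLTL (tr x) (D x) (ts x) := by
  unfold TreeProg.evalPLTL
  have := Poly.foldr (l := ts) (init := fun _ => ([], []))
    (step := fun x => TreeProg.evalStep (tr x) (D x))
    (b := fun y => esize y.2 + 2 * esize (tr y.1) + 10) hts (by fun_prop)
    (Poly.evalStep.comp (f := fun y : α × (List ℕ × List (List Bool)) × Tok =>
      ((tr y.1, D y.1), y.2.2, y.2.1)) (by fun_prop)) (by fun_prop)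
    fun x s a => esize_evalStep_le (tr x) (D x) a s
  fun_prop

@[fun_prop]
theorem Poly.period {E : α → Front} (hE : Poly E) : Poly fun x => (E x).period := by
  unfold Front.period; fun_prop

@[fun_prop]
theorem Poly.horizon {E : α → Front} {es : α → List Setting} {n : α → ℕ} (hE : Poly E)
    (he : Poly es) (hn : Poly n) : Poly fun x => (E x).horizon (es x) (n x) := by
  unfold Front.horizon
  have := Poly.foldl (l := es) (init := fun _ => 0) (step := fun _ s e => s + e.2.1)
    (b := fun y => 2 * y.2.2.1) he (by fun_prop) (by fun_prop) (by fun_prop)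
    fun x s a => by simp only [esize_nat]; omega
  fun_prop

@[fun_prop]
theorem Poly.evalBox {E : α → Front} {es : α → List Setting} {ts : α → List Tok} (hE : Poly E)
    (he : Poly es) (hts : Poly ts) : Poly fun x => evalBox (E x) (es x) (ts x) := by
  unfold TreeProg.evalBox
  fun_prop

@[fun_prop]
theorem Poly.num {n : α → ℕ} (hn : Poly n) : Poly fun x => Item.num (n x) := by
  unfold Item.num; fun_prop

@[fun_prop]
theorem Poly.settings {es : α → List Setting} (he : Poly es) :
    Poly fun x => Item.settings (es x) := by
  unfold Item.settings; fun_prop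

@[fun_prop]
theorem Poly.path {ts : α → List Tok} (ht : Poly ts) : Poly fun x => Item.path (ts x) := by
  unfold Item.path; fun_prop

@[fun_prop]
theorem Poly.truth {b : α → Bool} (hb : Poly b) : Poly fun x => Item.truth (b x) := by
  unfold Item.truth; fun_prop

section Steps

variable {E : α → Front} {t : α → Tok} {s : α → List Item}

@[fun_prop]
theorem Poly.atomStep (hE : Poly E) (ht : Poly t) (hs : Poly s) :
    Poly fun x => atomStep (E x) (t x) (s x) := by
  unfold TreeProg.atomStep; fun_prop

@[fun_prop]
theorem Poly.unaryStep (ht : Poly t) (hs : Poly s) :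
    Poly fun x => unaryStep (t x) (s x) := by
  unfold TreeProg.unaryStep; fun_prop

@[fun_prop]
theorem Poly.binaryStep (ht : Poly t) (hs : Poly s) :
    Poly fun x => binaryStep (t x) (s x) := by
  unfold TreeProg.binaryStep; fun_prop

@[fun_prop]
theorem Poly.setStep (hE : Poly E) (hs : Poly s) :
    Poly fun x => setStep (E x) (s x) := by
  unfold TreeProg.setStep
  have := Poly.all (l := fun x => ((s x).tail.tail.tail.headD .junk).2.2.1)
    (f := fun x e => !(e.1 == ((s x).headD .junk).2.1 && e.2.1 == ((s x).tail.headD .junk).2.1))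
    (by fun_prop) (by fun_prop)
  fun_prop

@[fun_prop]
theorem Poly.boxStep (hE : Poly E) (hs : Poly s) :
    Poly fun x => boxStep (E x) (s x) := by
  unfold TreeProg.boxStep; fun_prop

end Steps

theorem Poly.parseStep : Poly fun y : Front × (Bool × List Item) × Tok =>
    parseStep y.1 y.2.2 y.2.1 := by
  unfold TreeProg.parseStep
  fun_prop

theorem esize_cond_le {b : Bool} {x y : σ} {n : ℕ} (hx : esize x ≤ n) (hy : esize y ≤ n) :
    esize (bif b then x else y) ≤ n := by
  cases b
  exacts [hy, hx]

theorem esize_item_le (s : List Item) :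
    esize (s.headD .junk) + esize s.tail ≤ esize s + 8 :=
  (esize_headD_add_tail s .junk).trans (by simp [Item.junk])

theorem esize_atomStep_le (E : Front) (t : Tok) (s : List Item) :
    esize (atomStep E t s) ≤ esize s + 2 * esize t + 100 := by
  have h1 := esize_item_le s
  have h2 := esize_item_le s.tail
  refine esize_cond_le ?_ (by simp)
  simp only [Item.path, esize_prod, esize_cons, esize_nil, esize_bool, esize_sym, esize_nat] at *
  omega

theorem esize_unaryStep_le (t : Tok) (s : List Item) :
    esize (unaryStep t s) ≤ esize s + 2 * esize t + 100 := by
  have h1 := esize_item_le s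
  refine esize_cond_le ?_ (esize_cond_le ?_ (by simp))
  · simp only [Item.path, esize_prod, esize_cons, esize_nil, esize_bool, esize_sym, esize_nat] at *
    omega
  · cases h : (s.headD Item.junk).2.1 == 0 <;>
    simp only [Item.truth, esize_prod, esize_cons, esize_nil, esize_bool, esize_sym, esize_nat,
      cond_true, cond_false] at * <;> omega

theorem esize_binaryStep_le (t : Tok) (s : List Item) :
    esize (binaryStep t s) ≤ esize s + 2 * esize t + 100 := by
  have h1 := esize_item_le s
  have h2 := esize_item_le s.tail
  refine esize_cond_le ?_ (esize_cond_le ?_ (by simp))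
  · have h3 := esize_append (s.headD Item.junk).2.2.2 (s.tail.headD Item.junk).2.2.2
    simp only [Item.path, esize_prod, esize_cons, esize_nil, esize_bool, esize_sym, esize_nat] at *
    omega
  · generalize (_ && _ : Bool) = b
    cases b <;>
    simp only [Item.truth, esize_prod, esize_cons, esize_nil, esize_bool, esize_sym, esize_nat,
      cond_true, cond_false] at * <;> omega

theorem esize_setStep_le (E : Front) (s : List Item) (n : ℕ) :
    esize (setStep E s) ≤ esize s + n + 100 := by
  have h1 := esize_item_le s
  have h2 := esize_item_le s.tail
  have h3 := esize_item_le s.tail.tail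
  have h4 := esize_item_le s.tail.tail.tail
  refine esize_cond_le ?_ (by simp)
  simp only [Item.settings, esize_prod, esize_cons, esize_nil, esize_bool, esize_sym, esize_nat]
    at *
  omega

theorem esize_boxStep_le (E : Front) (s : List Item) (n : ℕ) :
    esize (boxStep E s) ≤ esize s + n + 100 := by
  have h1 := esize_item_le s
  have h2 := esize_item_le s.tail
  refine esize_cond_le ?_ (by simp)
  generalize evalBox _ _ _ = b
  cases b <;>
  simp only [Item.truth, esize_prod, esize_cons, esize_nil, esize_bool, esize_sym, esize_nat,
    cond_true, cond_false] at * <;> omega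

/-- The contents of the items popped move into the item pushed, so a token adds no more than a
multiple of its own size and a constant. -/
theorem esize_parseStep_le (E : Front) (t : Tok) (s : Bool × List Item) :
    esize (parseStep E t s) ≤ esize s + (2 * esize t + 100) := by
  have hs : esize s.2 ≤ esize s := by rw [esize_prod]; omega
  have hf : esize ((false, []) : Bool × List Item) ≤ esize s + (2 * esize t + 100) := by
    simp only [esize_mk, esize_bool, esize_nil]; omega
  have h4 := esize_prod t
  refine esize_cond_le hf (esize_cond_le ?_ (esize_cond_le hf (esize_cond_le ?_ (esize_cond_le ?_
    (esize_cond_le ?_ (esize_cond_le ?_ (esize_cond_le ?_ (esize_cond_le ?_ hf))))))))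
  · simp only [Item.num, esize_prod, esize_cons, esize_nil, esize_bool, esize_sym, esize_nat] at *
    omega
  · exact (esize_atomStep_le E t s.2).trans (by omega)
  · exact (esize_unaryStep_le t s.2).trans (by omega)
  · exact (esize_binaryStep_le t s.2).trans (by omega)
  · simp only [Item.settings, esize_prod, esize_cons, esize_nil, esize_bool, esize_sym,
      esize_nat] at *
    omega
  · exact (esize_setStep_le E s.2 (2 * esize t)).trans (by omega)
  · exact (esize_boxStep_le E s.2 (2 * esize t)).trans (by omega)

@[fun_prop]
theorem Poly.parse {E : α → Front} {ts : α → List Tok} (hE : Poly E) (hts : Poly ts) :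
    Poly fun x => parse (E x) (ts x) :=
  Poly.foldr (step := fun x => TreeProg.parseStep (E x)) (b := fun y => 2 * esize y.2 + 100) hts
    (by fun_prop)
    (Poly.parseStep.comp (f := fun y : α × (Bool × List Item) × Tok => (E y.1, y.2))
      (by fun_prop)) (by fun_prop) fun x s a => esize_parseStep_le (E x) a s

@[fun_prop]
theorem Poly.acceptItems {s : α → Bool × List Item} (hs : Poly s) :
    Poly fun x => acceptItems (s x) := by
  have : ∀ n : ℕ, (n == 1) = (!(n == 0) && n - 1 == 0) := by
    intro n; rw [Bool.eq_iff_iff]; simp; omega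
  simp only [TreeProg.acceptItems, this]
  fun_prop

@[fun_prop]
theorem Poly.acceptToks {E : α → Front} {ts : α → List Tok} (hE : Poly E) (hts : Poly ts) :
    Poly fun x => acceptToks (E x) (ts x) := by
  unfold TreeProg.acceptToks
  have h1 := Poly.map (l := fun x => (ts x).take (E x).nums.length) (f := fun _ t => t.2)
    (by fun_prop) (by fun_prop)
  have h2 := Poly.all (l := fun x => (ts x).take (E x).nums.length) (f := fun _ t => t.1 == .bar)
    (by fun_prop) (by fun_prop)
  fun_prop

theorem Poly.accept : Poly accept := by
  have h1 := Poly.map (l := TreeProg.lex) (f := fun _ t => t.2) Poly.lex (by fun_prop)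
  exact Poly.acceptToks (Poly.readFront.comp h1) Poly.lex

/-- A language that is decided by a polynomial function is in P. -/
theorem inP_of_poly {L : Language CodeSym} (f : List CodeSym → Bool) (hf : Poly f)
    (h : ∀ w, f w = true ↔ w ∈ L) : InP L := by
  -- The machine presents its input as the tree of the reversed word; a reversal in the program
  -- compensates for it.
  obtain ⟨p, c, ⟨P, hP⟩, hp⟩ := hf.comp (f := fun w : List CodeSym => w.reverse) (by fun_prop)
  refine inP_of_eval f h p (P.comp (2 * Polynomial.X + 1)) fun w => ?_
  obtain ⟨d, hd, he⟩ := hp w.reverse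
  refine ⟨d, (hd.trans (hP _)).trans ?_, by simpa [wordData_eq, Enc.enc] using he⟩
  have : ∀ w : List CodeSym, esize w = 2 * w.length + 1 := by
    intro w
    induction w with
    | nil => rfl
    | cons s w ih => simp only [esize_cons, esize_sym, List.length_cons, ih]; omega
  simp [this]

end TreeProg

end

noncomputable section

namespace TreeProg

/-! ### Ranks -/

section Rank

variable {U V : Type} (S : Signature U V) {Z : U ⊕ V}

theorem rank_strictMono : StrictMono fun x : S.Val Z => S.rank x := by
  intro x y h
  refine Finset.card_lt_card (Finset.ssubset_iff_of_subset ?_ |>.2 ⟨x.1, ?_, ?_⟩)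
  · intro a ha
    simp only [Finset.mem_filter] at ha ⊢
    exact ⟨ha.1, ha.2.trans h⟩
  · simp only [Finset.mem_filter]
    exact ⟨x.2, h⟩
  · simp

theorem rank_inj {x y : S.Val Z} : S.rank x = S.rank y ↔ x = y :=
  (rank_strictMono S).injective.eq_iff

theorem rank_lt (x : S.Val Z) : S.rank x < (S.range Z).card :=
  Finset.card_lt_card (Finset.ssubset_iff_of_subset (Finset.filter_subset _ _) |>.2
    ⟨x.1, x.2, by simp⟩)

theorem exists_rank_eq {k : ℕ} (h : k < (S.range Z).card) : ∃ x : S.Val Z, S.rank x = k := by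
  have hb : Function.Bijective fun x : S.Val Z => (⟨S.rank x, rank_lt S x⟩ : Fin _) := by
    refine (Fintype.bijective_iff_injective_and_card _).2 ⟨fun x y hxy => ?_, by simp⟩
    simpa [rank_inj] using hxy
  obtain ⟨x, hx⟩ := hb.2 ⟨k, h⟩
  exact ⟨x, by simpa using hx⟩

/-- The value with a given rank. -/
def ofRank (Z : U ⊕ V) (k : ℕ) : S.Val Z :=
  if h : k < (S.range Z).card then (exists_rank_eq S h).choose
  else ⟨(S.nonempty Z).choose, (S.nonempty Z).choose_spec⟩

theorem rank_ofRank {k : ℕ} (h : k < (S.range Z).card) : S.rank (ofRank S Z k) = k := by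
  rw [ofRank, dif_pos h]
  exact (exists_rank_eq S h).choose_spec

end Rank

/-! ### Tokens -/

/-- The word of a token. -/
def Tok.word (t : Tok) : List CodeSym := List.replicate t.2 .tick ++ [t.1]

/-- The token of a number. -/
def numTok (n : ℕ) : Tok := (.bar, n)

section Formulas

variable {p q : ℕ} {S : Signature (Fin p) (Fin q)}

def pathToks : PLTL S → List Tok
  | .atom X x => [(.atom, 0), numTok X, numTok (S.rank x)]
  | .neg φ => (.neg, 0) :: pathToks φ
  | .conj φ ψ => (.conj, 0) :: (pathToks φ ++ pathToks ψ)
  | .nxt φ => (.nxt, 0) :: pathToks φ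
  | .untl φ ψ => (.untl, 0) :: (pathToks φ ++ pathToks ψ)
  | .prv φ => (.prv, 0) :: pathToks φ
  | .snce φ ψ => (.snce, 0) :: (pathToks φ ++ pathToks ψ)

theorem flatMap_pathToks (ψ : PLTL S) : (pathToks ψ).flatMap Tok.word = ψ.code := by
  induction ψ <;> simp_all [pathToks, PLTL.code, Tok.word, numTok, unary]

theorem length_pathToks (ψ : PLTL S) : (pathToks ψ).length = ψ.size := by
  induction ψ <;> simp_all [pathToks, PLTL.size]

/-! ### Periodicity of PLTL -/

/-- Future operators commute with the shift by a period. For since, the threshold leaves one period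
of room above the thresholds of both arguments: a late witness can be shifted with the position, and
an early witness can stay where it is. -/
theorem holds_add_period_iff {σ : ℕ → S.EndoAsg} {N P : ℕ} (hP : 0 < P)
    (hσ : ∀ i, N ≤ i → σ i = σ (i + P)) (ψ : PLTL S) (i : ℕ) (hi : N + ψ.size * P ≤ i) :
    ψ.Holds σ i ↔ ψ.Holds σ (i + P) := by
  induction ψ generalizing i with
  | atom X x =>
    simp only [PLTL.Holds]
    rw [hσ i (by omega)]
  | neg φ ih =>
    simp only [PLTL.size, Nat.add_mul] at hi
    simp only [PLTL.Holds, ih i (by omega)]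
  | conj φ ψ ihφ ihψ =>
    simp only [PLTL.size, Nat.add_mul] at hi
    simp only [PLTL.Holds, ihφ i (by omega), ihψ i (by omega)]
  | nxt φ ih =>
    simp only [PLTL.size, Nat.add_mul] at hi
    simp only [PLTL.Holds, ih (i + 1) (by omega), Nat.add_right_comm]
  | untl φ ψ ihφ ihψ =>
    simp only [PLTL.size, Nat.add_mul] at hi
    simp only [PLTL.Holds]
    refine exists_congr fun j => and_congr ?_ (forall₂_congr fun k _ => ?_)
    · rw [ihψ (i + j) (by omega), Nat.add_right_comm]
    · rw [ihφ (i + k) (by omega), Nat.add_right_comm]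
  | prv φ ih =>
    simp only [PLTL.size, Nat.add_mul] at hi
    simp only [PLTL.Holds]
    rw [ih (i - 1) (by omega), show i - 1 + P = i + P - 1 by omega]
    constructor <;> rintro ⟨-, h⟩ <;> exact ⟨by omega, h⟩
  | snce φ ψ ihφ ihψ =>
    simp only [PLTL.size, Nat.add_mul] at hi
    simp only [PLTL.Holds]
    constructor
    · rintro ⟨k, hk, h1, h2⟩
      by_cases hkA : N + φ.size * P + ψ.size * P ≤ k
      · refine ⟨k + P, by omega, (ihψ k (by omega)).1 h1, fun j hj hj' => ?_⟩
        have := (ihφ (j - P) (by omega)).1 (h2 (j - P) (by omega) (by omega))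
        rwa [show j - P + P = j by omega] at this
      -- An early witness lies more than a period before `i`. The left argument is thus known on the
      -- last period up to `i`, and periodicity copies it to the following one.
      · refine ⟨k, by omega, h1, fun j hj hj' => ?_⟩
        by_cases hji : j ≤ i
        · exact h2 j hj hji
        · have := (ihφ (j - P) (by omega)).1 (h2 (j - P) (by omega) (by omega))
          rwa [show j - P + P = j by omega] at this
    · rintro ⟨k, hk, h1, h2⟩
      by_cases hki : k ≤ i
      · exact ⟨k, hki, h1, fun j hj hj' => h2 j hj (by omega)⟩
      · refine ⟨k - P, by omega, (ihψ (k - P) (by omega)).2 ?_, fun j hj hj' => ?_⟩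
        · rwa [show k - P + P = k by omega]
        · exact (ihφ j (by omega)).2 (h2 (j + P) (by omega) (by omega))

end Formulas

/-! ### Evaluation on initial segments -/

open Classical in
/-- The truth values of `f` below `m`. -/
def truths (f : ℕ → Prop) (m : ℕ) : List Bool := (List.range m).map fun i => decide (f i)

@[simp] theorem length_truths (f : ℕ → Prop) (m : ℕ) : (truths f m).length = m := by
  simp [truths]

theorem truths_congr {f g : ℕ → Prop} {m : ℕ} (h : ∀ i < m, (f i ↔ g i)) :
    truths f m = truths g m :=
  List.map_congr_left fun i hi => by simp [h i (List.mem_range.1 hi)]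

theorem truths_succ (f : ℕ → Prop) (m : ℕ) :
    truths f (m + 1) = truths (fun _ => f 0) 1 ++ truths (fun i => f (i + 1)) m := by
  simp [truths, List.range_succ_eq_map, Function.comp_def]

theorem truths_succ' (f : ℕ → Prop) (m : ℕ) :
    truths f (m + 1) = truths f m ++ truths (fun _ => f m) 1 := by
  simp [truths, List.range_succ]

theorem take_truths (f : ℕ → Prop) (m n : ℕ) : (truths f m).take n = truths f (min n m) := by
  simp [truths, ← List.map_take, List.take_range]

theorem map_not_truths (f : ℕ → Prop) (m : ℕ) :
    (truths f m).map (fun b => !b) = truths (fun i => ¬ f i) m := by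
  simp [truths]

theorem zip_truths (f g : ℕ → Prop) (m n : ℕ) :
    (truths f m).zip (truths g n) = (truths f (min m n)).zip (truths g (min m n)) := by
  apply List.ext_getElem <;> simp [truths]

theorem map_and_zip_truths (f g : ℕ → Prop) (m : ℕ) :
    ((truths f m).zip (truths g m)).map (fun y => y.1 && y.2) =
      truths (fun i => f i ∧ g i) m := by
  refine List.ext_getElem (by simp) fun i h1 h2 => ?_
  rw [Bool.eq_iff_iff]
  simp [truths]

theorem tail_truths (f : ℕ → Prop) (m : ℕ) :
    (truths f m).tail = truths (fun i => f (i + 1)) (m - 1) := by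
  cases m with
  | zero => rfl
  | succ m => rw [truths_succ]; simp [truths]

/-- Starting from an empty accumulator, the backward recursion computes until with its witness
required to lie inside the segment. -/
theorem foldr_untilStep_truths (f g : ℕ → Prop) (m : ℕ) :
    ((truths f m).zip (truths g m)).foldr untilStep [] =
      truths (fun i => ∃ j, i + j < m ∧ g (i + j) ∧ ∀ k < j, f (i + k)) m := by
  induction m generalizing f g with
  | zero => rfl
  | succ m ih =>
    have hz : (truths f (m + 1)).zip (truths g (m + 1)) = (truths (fun _ => f 0) 1).zip
        (truths (fun _ => g 0) 1) ++ (truths (fun i => f (i + 1)) m).zip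
          (truths (fun i => g (i + 1)) m) := by
      rw [truths_succ f, truths_succ g, List.zip_append (by simp)]
    rw [hz, List.foldr_append, ih, truths_succ (fun i => ∃ j, i + j < m + 1 ∧ _)]
    have h1 : truths (fun i => ∃ j, i + j < m ∧ g (i + j + 1) ∧ ∀ k < j, f (i + k + 1)) m =
        truths (fun i => ∃ j, i + 1 + j < m + 1 ∧ g (i + 1 + j) ∧ ∀ k < j, f (i + 1 + k)) m :=
      truths_congr fun i _ => by simp only [Nat.add_right_comm i 1, Nat.add_lt_add_iff_right]
    rw [h1]
    -- The conjunct `0 < m` corresponds to the empty accumulator, whose head defaults to false.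
    have h2 : (∃ j, 0 + j < m + 1 ∧ g (0 + j) ∧ ∀ k < j, f (0 + k)) ↔
        g 0 ∨ f 0 ∧ 0 < m ∧ ∃ j, 0 + 1 + j < m + 1 ∧ g (0 + 1 + j) ∧ ∀ k < j, f (0 + 1 + k) := by
      constructor
      · rintro ⟨j, hj, hg, hf⟩
        cases j with
        | zero => exact .inl hg
        | succ j =>
          refine .inr ⟨by simpa using hf 0 (by omega), by omega, j, by omega, ?_, fun k hk => ?_⟩
          · rwa [show 0 + 1 + j = 0 + (j + 1) by omega]
          · rw [show 0 + 1 + k = 0 + (k + 1) by omega]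
            exact hf _ (by omega)
      · rintro (h | ⟨h0, hm, j, hj, hg, hf⟩)
        · exact ⟨0, by omega, h, fun k hk => by omega⟩
        · refine ⟨j + 1, by omega, by rwa [show 0 + (j + 1) = 0 + 1 + j by omega], fun k hk => ?_⟩
          cases k with
          | zero => simpa using h0
          | succ k =>
            rw [show 0 + (k + 1) = 0 + 1 + k by omega]
            exact hf k (by omega)
    simp only [h2]
    cases m with
    | zero => simp [truths, untilStep, List.range_succ_eq_map]
    | succ m =>
      simp [truths, untilStep, List.range_succ_eq_map]
      rw [Bool.eq_iff_iff]
      simp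

/-- In contrast to until, the result is exact on the whole segment, since the witness and all
positions concerned lie in the past. -/
theorem foldl_untilStep_truths (f g : ℕ → Prop) (m : ℕ) :
    sinceList (truths f m) (truths g m) =
      truths (fun i => ∃ k ≤ i, g k ∧ ∀ j, k < j → j ≤ i → f j) m := by
  unfold sinceList
  rw [← List.reverse_inj, List.reverse_reverse]
  induction m with
  | zero => rfl
  | succ m ih =>
    have hz : (truths f (m + 1)).zip (truths g (m + 1)) = (truths f m).zip (truths g m) ++
        (truths (fun _ => f m) 1).zip (truths (fun _ => g m) 1) := by
      rw [truths_succ' f, truths_succ' g, List.zip_append (by simp)]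
    rw [hz, List.foldl_append, ih, truths_succ' (fun i => ∃ k ≤ i, _), List.reverse_append]
    have h2 : (∃ k ≤ m, g k ∧ ∀ j, k < j → j ≤ m → f j) ↔
        g m ∨ f m ∧ 0 < m ∧ ∃ k ≤ m - 1, g k ∧ ∀ j, k < j → j ≤ m - 1 → f j := by
      constructor
      · rintro ⟨k, hk, hg, hf⟩
        rcases hk.eq_or_lt with rfl | hk
        · exact .inl hg
        · exact .inr ⟨hf m hk le_rfl, by omega, k, by omega, hg, fun j hj hj' => hf j hj (by omega)⟩
      · rintro (h | ⟨h0, hm, k, hk, hg, hf⟩)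
        · exact ⟨m, le_rfl, h, fun j hj hj' => by omega⟩
        · refine ⟨k, by omega, hg, fun j hj hj' => ?_⟩
          rcases hj'.eq_or_lt with rfl | hj'
          · exact h0
          · exact hf j hj (by omega)
    simp only [h2]
    cases m with
    | zero => simp [truths, untilStep, List.range_succ]
    | succ m =>
      simp [truths, untilStep, List.range_succ]
      rw [Bool.eq_iff_iff]
      simp

end TreeProg

end

/-! ### Correctness of the evaluation of PLTL formulas on initial segments. -/

noncomputable section

namespace TreeProg

section

variable {p q : ℕ} {S : Signature (Fin p) (Fin q)}

/-- The ranks of the values in an endogenous assignment. -/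
def endoRanks (s : S.EndoAsg) : List ℕ := (List.finRange q).map fun X => S.rank (s X)

def exoRanks (s : S.ExoAsg) : List ℕ := (List.finRange p).map fun X => S.rank (s X)

theorem getD_endoRanks (s : S.EndoAsg) (X : Fin q) : (endoRanks s).getD X 0 = S.rank (s X) := by
  simp only [endoRanks, List.getD_eq_getElem?_getD, List.getElem?_map]
  rw [List.getElem?_eq_getElem (by simp)]
  simp only [Option.map_some, Option.getD_some]
  congr! <;> simp

/-- Suppose that the least witness for a position below `m - D` lay at `m` or later. It would be
more than `D`, hence more than a period, ahead of the position, and one period earlier would still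
be in the periodic part of `g`. That gives a smaller witness. The condition on `f` passes to smaller
witnesses by itself, so `f` need not be periodic. -/
theorem untilList_truths {f g : ℕ → Prop} {A P D m : ℕ} (hP : 0 < P) (hPD : P ≤ D)
    (hg : ∀ i, A ≤ i → (g i ↔ g (i + P))) (hA : A + D ≤ m) :
    untilList D (truths f m) (truths g m) =
      truths (fun i => ∃ j, g (i + j) ∧ ∀ k < j, f (i + k)) (m - D) := by
  unfold untilList
  simp only [foldr_untilStep_truths, take_truths, length_truths]
  rw [Nat.min_eq_left (by omega)]
  refine truths_congr fun i hi => ⟨fun ⟨j, _, h⟩ => ⟨j, h⟩, fun h => ?_⟩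
  classical
  have h1 := Nat.find_spec h
  refine ⟨Nat.find h, ?_, h1⟩
  by_contra hlt
  refine Nat.find_min h (m := Nat.find h - P) (by omega) ⟨?_, fun k hk => h1.2 k (by omega)⟩
  rw [hg _ (by omega), show i + (Nat.find h - P) + P = i + Nat.find h by omega]
  exact h1.1

theorem zip_truths_eq {f g : ℕ → Prop} {m n : ℕ} :
    untilList D (truths f m) (truths g n) =
      untilList D (truths f (min m n)) (truths g (min m n)) := by
  unfold untilList; rw [zip_truths]

section EvalStep

variable (tr : List (List ℕ)) (D n : ℕ) (ns : List ℕ) (a b : List Bool) (st : List (List Bool))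

theorem evalStep_num (s : List ℕ × List (List Bool)) :
    evalStep tr D (numTok n) s = (n :: s.1, s.2) := rfl
theorem evalStep_atom (X x : ℕ) :
    evalStep tr D (.atom, n) (X :: x :: ns, st) =
      (X :: x :: ns, (tr.map fun a => a.getD X 0 == x) :: st) := rfl
theorem evalStep_neg :
    evalStep tr D (.neg, n) (ns, a :: st) = (ns, a.map (fun b => !b) :: st) := rfl
theorem evalStep_conj : evalStep tr D (.conj, n) (ns, a :: b :: st) =
    (ns, ((a.zip b).map fun y => y.1 && y.2) :: st) := rfl
theorem evalStep_nxt : evalStep tr D (.nxt, n) (ns, a :: st) = (ns, a.tail :: st) := rfl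
theorem evalStep_untl :
    evalStep tr D (.untl, n) (ns, a :: b :: st) = (ns, untilList D a b :: st) := rfl
theorem evalStep_prv : evalStep tr D (.prv, n) (ns, a :: st) = (ns, (false :: a) :: st) := rfl
theorem evalStep_snce :
    evalStep tr D (.snce, n) (ns, a :: b :: st) = (ns, sinceList a b :: st) := rfl

end EvalStep

/-- Per symbol, `D + 1` positions pay for what until and next cut off at the end, and another `D`
pays for the later onset of periodicity, which until needs inside the segment. The tokens `r` to the
right are arbitrary, so that the second argument of a connective can be processed before the first.
The list `ns` is left open because used numbers are not removed. -/
theorem foldr_evalStep {σ : ℕ → S.EndoAsg} {N P D L : ℕ} (hP : 0 < P) (hPD : P ≤ D)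
    (hσ : ∀ i, N ≤ i → σ i = σ (i + P)) {tr : List (List ℕ)}
    (htr : tr = (List.range L).map fun i => endoRanks (σ i)) (ψ : PLTL S)
    (hL : N + ψ.size * (2 * D + 1) ≤ L) (r : List Tok) (s₀ : List ℕ × List (List Bool)) :
    ∃ ns m, L ≤ m + ψ.size * (D + 1) ∧ (pathToks ψ ++ r).foldr (evalStep tr D) s₀ =
      (ns, truths (ψ.Holds σ) m :: (r.foldr (evalStep tr D) s₀).2) := by
  have hmono : ∀ a : ℕ, a * P ≤ a * D := fun a => Nat.mul_le_mul_left a hPD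
  have hmul : ∀ a : ℕ, a * (2 * D + 1) = a * D + a * D + a := fun a => by ring
  have hmul' : ∀ a : ℕ, a * (D + 1) = a * D + a := fun a => by ring
  simp only [hmul, hmul'] at hL ⊢
  induction ψ generalizing r with
  | atom X x =>
    refine ⟨X :: S.rank x :: (r.foldr (evalStep tr D) s₀).1, L, by omega, ?_⟩
    simp only [pathToks, List.cons_append, List.nil_append, List.foldr_cons, evalStep_num,
      evalStep_atom, htr, truths, List.map_map]
    congr 2
    refine List.map_congr_left fun i _ => ?_
    refine Bool.eq_iff_iff.2 (Iff.trans ?_ (@decide_eq_true_iff _ (Classical.propDecidable _)).symm)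
    simp only [Function.comp_apply, getD_endoRanks, PLTL.Holds, beq_iff_eq, rank_inj]
  | neg φ ih =>
    simp only [PLTL.size, Nat.add_mul] at hL ⊢
    obtain ⟨ns, m, hm, h⟩ := ih r (by omega)
    refine ⟨ns, m, by omega, ?_⟩
    rw [pathToks, List.cons_append, List.foldr_cons, h, evalStep_neg, map_not_truths]
    rfl
  | conj φ ψ ihφ ihψ =>
    simp only [PLTL.size, Nat.add_mul] at hL ⊢
    obtain ⟨ns', n, hn, h'⟩ := ihψ r (by omega)
    obtain ⟨ns, m, hm, h⟩ := ihφ (pathToks ψ ++ r) (by omega)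
    refine ⟨ns, min m n, by omega, ?_⟩
    rw [pathToks, List.cons_append, List.foldr_cons, List.append_assoc, h, h', evalStep_conj,
      zip_truths, map_and_zip_truths]
    rfl
  | nxt φ ih =>
    simp only [PLTL.size, Nat.add_mul] at hL ⊢
    obtain ⟨ns, m, hm, h⟩ := ih r (by omega)
    refine ⟨ns, m - 1, by omega, ?_⟩
    rw [pathToks, List.cons_append, List.foldr_cons, h, evalStep_nxt, tail_truths]
    rfl
  | untl φ ψ ihφ ihψ =>
    simp only [PLTL.size, Nat.add_mul] at hL ⊢
    obtain ⟨ns', n, hn, h'⟩ := ihψ r (by omega)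
    obtain ⟨ns, m, hm, h⟩ := ihφ (pathToks ψ ++ r) (by omega)
    have hφ := hmono φ.size
    have hψ := hmono ψ.size
    refine ⟨ns, min m n - D, by omega, ?_⟩
    rw [pathToks, List.cons_append, List.foldr_cons, List.append_assoc, h, h', evalStep_untl,
      zip_truths_eq, untilList_truths (A := N + ψ.size * P) hP hPD
      (holds_add_period_iff hP hσ ψ) (by omega)]
    rfl
  | prv φ ih =>
    simp only [PLTL.size, Nat.add_mul] at hL ⊢
    obtain ⟨ns, m, hm, h⟩ := ih r (by omega)
    refine ⟨ns, m + 1, by omega, ?_⟩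
    have h1 : truths (fun i => (PLTL.prv φ).Holds σ (i + 1)) m = truths (φ.Holds σ) m :=
      truths_congr fun i _ => by simp [PLTL.Holds]
    rw [pathToks, List.cons_append, List.foldr_cons, h, evalStep_prv, truths_succ, h1]
    simp [truths, PLTL.Holds]
  | snce φ ψ ihφ ihψ =>
    simp only [PLTL.size, Nat.add_mul] at hL ⊢
    obtain ⟨ns', n, hn, h'⟩ := ihψ r (by omega)
    obtain ⟨ns, m, hm, h⟩ := ihφ (pathToks ψ ++ r) (by omega)
    refine ⟨ns, min m n, by omega, ?_⟩
    rw [pathToks, List.cons_append, List.foldr_cons, List.append_assoc, h, h', evalStep_snce,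
      sinceList, zip_truths, ← sinceList, foldl_untilStep_truths]
    rfl

open Classical in
theorem getD_evalPLTL {σ : ℕ → S.EndoAsg} {N P D L t : ℕ} (hP : 0 < P) (hPD : P ≤ D)
    (hσ : ∀ i, N ≤ i → σ i = σ (i + P)) (ψ : PLTL S)
    (hL : N + ψ.size * (2 * D + 1) ≤ L) (ht : t + ψ.size * (D + 1) < L) :
    (evalPLTL ((List.range L).map fun i => endoRanks (σ i)) D (pathToks ψ)).getD t false =
      decide (ψ.Holds σ t) := by
  obtain ⟨ns, m, hm, h⟩ := foldr_evalStep hP hPD hσ rfl ψ hL [] ([], [])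
  rw [List.append_nil] at h
  rw [evalPLTL, h]
  have : t < m := by omega
  simp [truths, List.getD_eq_getElem?_getD, this]

end

end TreeProg

end

noncomputable section

namespace TreeProg

/-! ### Interval matching -/

theorem inBounds_iff (l : List ℕ) (bs : List (ℕ × ℕ)) :
    inBounds l bs = true ↔ List.Forall₂ (fun x b => b.1 ≤ x ∧ x < b.2) l bs := by
  have key : ∀ (bs : List (ℕ × ℕ)) (b : Bool) (l : List ℕ),
      (fun s : Bool × List ℕ => s.1 && s.2.isEmpty) (bs.foldl (fun s b =>
        (s.1 && !s.2.isEmpty && b.1.ble (s.2.headD 0) && (s.2.headD 0 + 1).ble b.2, s.2.tail))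
        (b, l)) = true ↔ b = true ∧ List.Forall₂ (fun x b => b.1 ≤ x ∧ x < b.2) l bs := by
    intro bs
    induction bs with
    | nil => intro b l; cases l <;> simp
    | cons c bs ih =>
      intro b l
      rw [List.foldl_cons, ih]
      cases l with
      | nil => simp
      | cons x l =>
        simp [and_assoc]
  rw [inBounds, key]
  simp

theorem eqList_iff (l l' : List ℕ) : eqList l l' = true ↔ l = l' := by
  rw [eqList, inBounds_iff, List.forall₂_map_right_iff]
  have : (fun a c : ℕ => c ≤ a ∧ a < c + 1) = Eq := by
    funext a c; simp; omega
  rw [this, List.forall₂_eq_eq_eq]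

/-! ### Enumeration of assignments -/

section Asgs

variable {p q : ℕ} (S : Signature (Fin p) (Fin q))

theorem mem_asgsFrom (Zs : List (Fin p ⊕ Fin q)) (z z' : S.Asg) :
    z' ∈ S.asgsFrom Zs z ↔ ∀ Z, Z ∉ Zs → z' Z = z Z := by
  induction Zs generalizing z with
  | nil =>
    simp only [Signature.asgsFrom, List.mem_singleton, List.not_mem_nil, not_false_eq_true,
      forall_const]
    exact funext_iff
  | cons Y Zs ih =>
    simp only [Signature.asgsFrom, List.mem_flatMap, Finset.mem_sort, Finset.mem_univ, true_and,
      ih, List.mem_cons, not_or]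
    constructor
    · rintro ⟨x, hx⟩ Z ⟨h1, h2⟩
      rw [hx Z h2, Function.update_of_ne h1]
    · intro h
      refine ⟨z' Y, fun Z hZ => ?_⟩
      by_cases hY : Z = Y
      · subst hY; simp
      · rw [h Z ⟨hY, hZ⟩, Function.update_of_ne hY]

theorem mem_varList (Z : Fin p ⊕ Fin q) : Z ∈ varList p q := by
  cases Z <;> simp [varList]

theorem nodup_varList : (varList p q).Nodup := by
  refine List.Nodup.append ((List.nodup_finRange p).map Sum.inl_injective)
    ((List.nodup_finRange q).map Sum.inr_injective) ?_
  intro Z h1 h2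
  simp only [List.mem_map] at h1 h2
  obtain ⟨a, -, rfl⟩ := h1
  obtain ⟨b, -, h⟩ := h2
  cases h

theorem mem_asgs (z : S.Asg) : z ∈ S.asgs :=
  (mem_asgsFrom S _ _ _).2 fun Z h => (h (mem_varList Z)).elim

/-- Both lists are strictly increasing with the same members, and such lists are equal. -/
theorem map_rank_sort (Z : Fin p ⊕ Fin q) :
    ((Finset.univ : Finset (S.Val Z)).sort (· ≤ ·)).map (fun x => S.rank x) =
      List.range (S.range Z).card := by
  have h1 : (((Finset.univ : Finset (S.Val Z)).sort (· ≤ ·)).map (fun x => S.rank x)).Pairwise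
      (· < ·) := by
    refine List.Pairwise.map _ (fun a b h => rank_strictMono S h) ?_
    exact (Finset.sortedLT_sort _).pairwise
  refine List.Perm.eq_of_pairwise (fun a b _ _ h h' => (lt_asymm h h').elim) h1
    List.pairwise_lt_range ((List.perm_ext_iff_of_nodup (h1.imp fun h => h.ne)
      List.nodup_range).2 fun k => ?_)
  simp only [List.mem_map, Finset.mem_sort, Finset.mem_univ, true_and, List.mem_range]
  exact ⟨fun ⟨x, hx⟩ => hx ▸ rank_lt S x, fun h => exists_rank_eq S h⟩

/-- The ranks of all values in a complete assignment. -/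
def asgRanks (z : S.Asg) : List ℕ := (varList p q).map fun Z => S.rank (z Z)

variable {S} in
theorem asgRanks_join (u : S.ExoAsg) (s : S.EndoAsg) :
    asgRanks S (Signature.join u s) = exoRanks u ++ endoRanks s := by
  simp [asgRanks, varList, exoRanks, endoRanks, Function.comp_def, Signature.join]

theorem asgRanks_injective : Function.Injective (asgRanks S) := by
  intro z z' h
  funext Z
  exact (rank_inj S).1 (List.map_inj_left.1 h Z (mem_varList Z))

theorem length_asgRanks (z : S.Asg) : (asgRanks S z).length = p + q := by
  simp [asgRanks, varList]

/-- The sizes of the ranges of all variables. -/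
def rangeCards : List ℕ := (varList p q).map fun Z => (S.range Z).card

/-- The procedure knows only the sizes of the ranges. This identifies its numerical enumeration with
the order of the rows in the encoding. -/
theorem map_ranks_asgs : S.asgs.map (asgRanks S) = tuples (rangeCards S) := by
  have key : ∀ (Zs : List (Fin p ⊕ Fin q)) (z : S.Asg), Zs.Nodup →
      (S.asgsFrom Zs z).map (fun z' => Zs.map fun Z => S.rank (z' Z)) =
        tuples (Zs.map fun Z => (S.range Z).card) := by
    intro Zs
    induction Zs with
    | nil => intro z _; rfl
    | cons Z Zs ih =>
      intro z hn
      rw [List.nodup_cons] at hn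
      simp only [Signature.asgsFrom, List.map_flatMap, List.map_cons, tuples, List.foldr_cons]
      rw [← map_rank_sort, List.flatMap_map]
      refine List.flatMap_congr fun x _ => ?_
      have h := ih (Function.update z Z x) hn.2
      rw [tuples] at h
      rw [← h, List.map_map]
      refine List.map_congr_left fun z' hz' => ?_
      have := (mem_asgsFrom S Zs _ z').1 hz' Z hn.1
      simp [this]
  exact key _ _ nodup_varList

/-- Completing by a fixed exogenous assignment embeds the endogenous assignments into the complete
ones, each of which has a row in the table. -/
theorem card_endoAsg_le (u : S.ExoAsg) : Fintype.card S.EndoAsg ≤ S.asgs.length := by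
  classical
  have h1 : Fintype.card S.EndoAsg ≤ Fintype.card S.Asg :=
    Fintype.card_le_of_injective (Signature.join u) fun s s' h => by
      funext X
      exact congrFun h (Sum.inr X)
  refine h1.trans ?_
  have h2 : (Finset.univ : Finset S.Asg) ⊆ S.asgs.toFinset := fun z _ =>
    List.mem_toFinset.2 (mem_asgs S z)
  exact (Finset.card_le_card h2).trans (List.toFinset_card_le _)

end Asgs

/-! ### The table of the structural equations -/

section Lookup

variable {p q : ℕ} {S : Signature (Fin p) (Fin q)} (M : CausalModel S)

/-- The ranks of the values of all structural equations. -/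
def eqnRanks (z : S.Asg) : List ℕ := (List.finRange q).map fun X => S.rank (M.eqn X z)

def modelTable : List ℕ := S.asgs.flatMap fun z => asgRanks S z ++ eqnRanks M z

/-- A table whose first row matches is a fixed point of the step, and each row that does not match
costs one iteration; hence any number of iterations not below the number of rows will do. By `hre`
it does not matter which matching row comes first. -/
theorem iterate_lookup {ι : Type} {r e : ι → List ℕ} {k l n : ℕ} (A : List ι) (a : ι)
    (ha : a ∈ A) (hr : ∀ b, (r b).length = k) (he : ∀ b, (e b).length = l)
    (hre : ∀ b c, r b = r c → e b = e c) (hn : A.length ≤ n) :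
    (((fun tb => bif eqList (tb.take k) (r a) then tb else tb.drop (k + l))^[n]
      (A.flatMap fun b => r b ++ e b)).drop k).take l = e a := by
  induction A generalizing n with
  | nil => simp at ha
  | cons b A ih =>
    have h1 : ((b :: A).flatMap fun b => r b ++ e b) =
        r b ++ (e b ++ A.flatMap fun b => r b ++ e b) := by simp
    by_cases hb : r b = r a
    · have hfix : ∀ n, (fun tb : List ℕ => bif eqList (tb.take k) (r a) then tb
          else tb.drop (k + l))^[n] ((b :: A).flatMap fun b => r b ++ e b) =
          (b :: A).flatMap fun b => r b ++ e b := by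
        intro n
        refine Function.iterate_fixed ?_ n
        have : eqList (((b :: A).flatMap fun b => r b ++ e b).take k) (r a) = true := by
          rw [eqList_iff, h1, List.take_left' (hr b), hb]
        simp only [this, cond_true]
      rw [hfix, h1, List.drop_left' (hr b), List.take_left' (he b)]
      exact hre _ _ hb
    · have haA : a ∈ A := (List.mem_cons.1 ha).resolve_left fun h => hb (by rw [h])
      obtain ⟨n, rfl⟩ : ∃ m, n = m + 1 := ⟨n - 1, by simp only [List.length_cons] at hn; omega⟩
      have : eqList (((b :: A).flatMap fun b => r b ++ e b).take k) (r a) = false := by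
        rw [← Bool.not_eq_true, eqList_iff, h1, List.take_left' (hr b)]
        exact hb
      rw [Function.iterate_succ_apply]
      simp only [this, cond_false]
      rw [h1, ← List.append_assoc, List.drop_left' (by simp [hr, he])]
      exact ih haA (by simpa using hn)

theorem length_asgs_le_modelTable (hq : 0 < q) : S.asgs.length ≤ (modelTable M).length := by
  unfold modelTable
  induction S.asgs with
  | nil => simp
  | cons z l ih =>
    simp only [List.flatMap_cons, List.length_append, List.length_cons, length_asgRanks]
    omega

end Lookup

end TreeProg

end

noncomputable section

namespace TreeProg

section

variable {p q : ℕ} {S : Signature (Fin p) (Fin q)}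

/-! ### Interventions -/

def settingsOf (es : List (TimedSetting S)) : List Setting :=
  es.map fun e => ((e.var : ℕ), e.time, S.rank e.val)

def applySettings (es : List (TimedSetting S)) (i : ℕ) (s : S.EndoAsg) : S.EndoAsg :=
  es.foldl (fun s e => if e.time = i then Function.update s e.var e.val else s) s

theorem length_endoRanks (s : S.EndoAsg) : (endoRanks s).length = q := by simp [endoRanks]

theorem length_exoRanks (s : S.ExoAsg) : (exoRanks s).length = p := by simp [exoRanks]

theorem getElem_endoRanks (s : S.EndoAsg) (X : Fin q) (h : (X : ℕ) < (endoRanks s).length) :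
    (endoRanks s)[(X : ℕ)] = S.rank (s X) := by
  rw [← getD_endoRanks, List.getD_eq_getElem?_getD, List.getElem?_eq_getElem h]
  rfl

theorem endoRanks_update (s : S.EndoAsg) (X : Fin q) (x : S.Val (Sum.inr X)) :
    endoRanks (Function.update s X x) =
      (endoRanks s).take X ++ S.rank x :: (endoRanks s).drop (X + 1) := by
  have h : (X : ℕ) < (endoRanks s).length := by rw [length_endoRanks]; exact X.2
  have h1 := List.set_eq_take_append_cons_drop (l := endoRanks s) (i := X) (a := S.rank x)
  rw [if_pos h] at h1
  rw [← h1]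
  refine List.ext_getElem (by simp [length_endoRanks]) fun i h2 h3 => ?_
  obtain ⟨Y, rfl⟩ : ∃ Y : Fin q, (Y : ℕ) = i := ⟨⟨i, by rwa [length_endoRanks] at h2⟩, rfl⟩
  rw [List.getElem_set, getElem_endoRanks]
  split_ifs with hi
  · obtain rfl := Fin.ext hi
    rw [Function.update_self]
  · rw [Function.update_of_ne fun he => hi (by rw [he]), getElem_endoRanks]

theorem overrideAt_settingsOf (es : List (TimedSetting S)) (i : ℕ) (s : S.EndoAsg) :
    overrideAt (settingsOf es) i (endoRanks s) = endoRanks (applySettings es i s) := by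
  induction es generalizing s with
  | nil => rfl
  | cons e es ih =>
    simp only [overrideAt, settingsOf, applySettings, List.map_cons, List.foldl_cons] at ih ⊢
    by_cases h : e.time = i
    · simp only [h, beq_self_eq_true, cond_true, if_true]
      rw [← endoRanks_update, ih]
    · have : (e.time == i) = false := by simpa using h
      simp only [this, cond_false, if_neg h, ih]

theorem applySettings_of_forall_notMem {es : List (TimedSetting S)} {i : ℕ} {X : Fin q}
    (h : ∀ x, (⟨X, i, x⟩ : TimedSetting S) ∉ es) (s : S.EndoAsg) :
    applySettings es i s X = s X := by
  induction es generalizing s with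
  | nil => rfl
  | cons e es ih =>
    simp only [applySettings, List.foldl_cons] at ih ⊢
    rw [ih fun x hx => h x (List.mem_cons_of_mem _ hx)]
    split_ifs with ht
    · rw [Function.update_of_ne]
      rintro rfl
      subst ht
      exact h e.val List.mem_cons_self
    · rfl

theorem applySettings_of_mem {es : List (TimedSetting S)}
    (hes : es.Pairwise fun a b => a.var = b.var → a.time ≠ b.time) {i : ℕ} {X : Fin q}
    {x : S.Val (Sum.inr X)} (h : (⟨X, i, x⟩ : TimedSetting S) ∈ es) (s : S.EndoAsg) :
    applySettings es i s X = x := by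
  induction es generalizing s with
  | nil => simp at h
  | cons e es ih =>
    rw [List.pairwise_cons] at hes
    rcases List.mem_cons.1 h with rfl | h
    · have := applySettings_of_forall_notMem (es := es) (i := i) (X := X)
        (fun y hy => hes.1 _ hy rfl rfl) (Function.update s X x)
      simp only [applySettings, List.foldl_cons, if_true] at this ⊢
      rw [this, Function.update_self]
    · exact ih hes.2 h _

/-- Overwriting one setting after the other agrees with the choice made in `override`, because
consistency allows at most one setting for each variable and time. -/
theorem applySettings_entries (int : Intervention S) (i : ℕ) (s : S.EndoAsg) :
    applySettings int.entries i s = fun X => int.override i X (s X) := by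
  funext X
  unfold Intervention.override
  split_ifs with h
  · exact applySettings_of_mem int.consistent h.choose_spec s
  · exact applySettings_of_forall_notMem (not_exists.1 h) s

theorem override_of_lt {int : Intervention S} {i : ℕ} (h : ∀ e ∈ int.entries, e.time < i)
    (X : Fin q) (d : S.Val (Sum.inr X)) : int.override i X d = d := by
  rw [Intervention.override, dif_neg]
  rintro ⟨x, hx⟩
  exact (h _ hx).false

/-! ### Computations -/

/-- The part of an instance before the formula. -/
def frontOf (M : CausalModel S) (u : ℕ → S.ExoAsg) (v : S.EndoAsg) (pre loop time : ℕ) : Front :=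
  ⟨p, q, rangeCards S, S.asgs.map (asgRanks S), modelTable M, pre, loop,
    (List.range (pre + loop)).flatMap fun j => exoRanks (u j), endoRanks v, time⟩

variable {M : CausalModel S} {u : ℕ → S.ExoAsg} {v : S.EndoAsg} {pre loop time : ℕ}

theorem lookup_frontOf (hq : 0 < q) (z : S.Asg) :
    (frontOf M u v pre loop time).lookup (asgRanks S z) = eqnRanks M z := by
  exact iterate_lookup (r := asgRanks S) (e := eqnRanks M) S.asgs z (mem_asgs S z)
    (length_asgRanks S) (fun b => by simp [eqnRanks, frontOf])
    (fun b c h => by rw [asgRanks_injective S h]) (length_asgs_le_modelTable M hq)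

theorem drop_context {j n : ℕ} (h : j < n) :
    ((((List.range n).flatMap fun j => exoRanks (u j)).drop (j * p)).take p) =
      exoRanks (u j) := by
  obtain ⟨k, rfl⟩ : ∃ k, n = j + (1 + k) := ⟨n - j - 1, by omega⟩
  have hl : ((List.range j).flatMap fun j => exoRanks (u j)).length = j * p := by
    simp [List.length_flatMap, length_exoRanks]
  rw [List.range_add, List.flatMap_append, List.drop_left' hl, List.range_add]
  simp only [List.range_one, List.map_append, List.map_cons, List.flatMap_append,
    List.flatMap_cons, List.map_nil, List.flatMap_nil, List.append_nil, add_zero]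
  rw [List.take_left' (length_exoRanks _)]

theorem trace_frontOf (hq : 0 < q) (hloop : 0 < loop)
    (hu : ∀ k, pre ≤ k → u k = u (k + loop)) (int : Intervention S) (L : ℕ) :
    trace (frontOf M u v pre loop time) (settingsOf int.entries) L =
      (List.range L).map fun i => endoRanks (M.computation u v int i) := by
  set σ := M.computation u v int with hσ
  -- The invariant equates the whole futures of the context at `j` and at `i`; equality of the
  -- current values alone would not survive the jump back to `pre`.
  have key : ∀ i, ∃ j, j < pre + loop ∧ (∀ k, u (j + k) = u (i + k)) ∧
      (traceStep (frontOf M u v pre loop time) (settingsOf int.entries))^[i]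
        (0, 0, overrideAt (settingsOf int.entries) 0 (endoRanks v), []) =
        (i, j, endoRanks (σ i), ((List.range i).map fun i => endoRanks (σ i)).reverse) := by
    intro i
    induction i with
    | zero =>
      refine ⟨0, by omega, fun _ => rfl, ?_⟩
      simp only [Function.iterate_zero, id_eq, overrideAt_settingsOf, applySettings_entries]
      rfl
    | succ i ih =>
      obtain ⟨j, hj, huj, h⟩ := ih
      refine ⟨bif j + 1 == pre + loop then pre else j + 1, ?_, ?_, ?_⟩
      · by_cases hjl : j + 1 = pre + loop
        · simp [hjl, hloop]
        · have : (j + 1 == pre + loop) = false := by simpa using hjl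
          simp only [this, cond_false]
          omega
      · intro k
        have h1 : u (j + 1 + k) = u (i + 1 + k) := by
          rw [add_assoc, huj, add_assoc]
        by_cases hjl : j + 1 = pre + loop
        · simp only [hjl, beq_self_eq_true, cond_true]
          rw [← h1, hjl, hu (pre + k) (by omega), Nat.add_right_comm]
        · have : (j + 1 == pre + loop) = false := by simpa using hjl
          simpa only [this, cond_false] using h1
      · rw [Function.iterate_succ_apply', h, traceStep]
        have hctx : ((frontOf M u v pre loop time).context.drop
            (j * (frontOf M u v pre loop time).numExo)).take
              (frontOf M u v pre loop time).numExo = exoRanks (u i) := by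
          rw [← show u j = u i from huj 0]
          exact drop_context hj
        simp only [hctx, ← asgRanks_join, lookup_frontOf hq]
        have : eqnRanks M (Signature.join (u i) (σ i)) =
            endoRanks fun X => M.eqn X (Signature.join (u i) (σ i)) := rfl
        rw [this, overrideAt_settingsOf, applySettings_entries, List.range_succ]
        simp only [List.map_append, List.reverse_append, List.map_cons, List.map_nil,
          List.reverse_cons, List.reverse_nil, List.nil_append, List.singleton_append]
        rfl
  obtain ⟨j, -, -, h⟩ := key L
  rw [trace]
  have h' : (frontOf M u v pre loop time).default = endoRanks v := rfl
  rw [h', h, List.reverse_reverse]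

/-- From time `pre + T` on, no setting affects later steps, and a step is determined by the current
values and the phase of the context. Two times with the same values and phase therefore have the
same future. -/
theorem exists_period (hloop : 0 < loop) (hu : ∀ k, pre ≤ k → u k = u (k + loop))
    (int : Intervention S) {T : ℕ} (hT : ∀ e ∈ int.entries, e.time ≤ T) :
    ∃ N P, 0 < P ∧ P ≤ loop * Fintype.card S.EndoAsg ∧
      N ≤ pre + T + loop * Fintype.card S.EndoAsg ∧
      ∀ i, N ≤ i → M.computation u v int i = M.computation u v int (i + P) := by
  set σ := M.computation u v int with hσ
  set N₀ := pre + T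
  have hmul : ∀ k m, pre ≤ k → u k = u (k + loop * m) := by
    intro k m hk
    induction m with
    | zero => rfl
    | succ m ih => rw [ih, hu _ (by omega), Nat.mul_succ, add_assoc]
  have hlt : ∀ k₁ k₂ : ℕ, k₁ < k₂ → k₂ ≤ loop * Fintype.card S.EndoAsg →
      k₁ % loop = k₂ % loop → σ (N₀ + k₁) = σ (N₀ + k₂) →
      ∃ N P, 0 < P ∧ P ≤ loop * Fintype.card S.EndoAsg ∧
        N ≤ pre + T + loop * Fintype.card S.EndoAsg ∧ ∀ i, N ≤ i → σ i = σ (i + P) := by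
    intro k₁ k₂ h h2 hmod he
    refine ⟨N₀ + k₁, k₂ - k₁, by omega, by omega, by omega, fun i hi => ?_⟩
    obtain ⟨m, hm⟩ : loop ∣ k₂ - k₁ := (Nat.modEq_iff_dvd' h.le).1 hmod
    induction i, hi using Nat.le_induction with
    | base => rw [he]; congr 1; omega
    | succ i hi ih =>
      rw [Nat.add_right_comm, hσ, CausalModel.computation, CausalModel.computation, ← hσ, ← ih,
        hm, ← hmul i m (by omega)]
      funext X
      rw [override_of_lt fun e he => by have := hT e he; omega,
        override_of_lt fun e he => by have := hT e he; omega]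
  -- Pigeonhole: there is one more time than there are pairs of a phase modulo `loop` and an
  -- endogenous assignment.
  obtain ⟨a, ha, b, hb, hne, hab⟩ := Finset.exists_ne_map_eq_of_card_lt_of_maps_to
    (s := Finset.range (loop * Fintype.card S.EndoAsg + 1))
    (t := (Finset.univ : Finset (Fin loop × S.EndoAsg)))
    (f := fun k => (⟨k % loop, Nat.mod_lt _ hloop⟩, σ (N₀ + k)))
    (by simp [Finset.card_univ]) (fun _ _ => Finset.mem_coe.2 (Finset.mem_univ _))
  simp only [Prod.mk.injEq, Fin.mk.injEq] at hab
  rw [Finset.mem_range] at ha hb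
  rcases lt_or_gt_of_ne hne with h | h
  · exact hlt a b h (by omega) hab.1 hab.2
  · exact hlt b a h (by omega) hab.1.symm hab.2.symm

theorem foldl_times (es : List (TimedSetting S)) :
    (settingsOf es).foldl (fun s e => s + e.2.1) 0 = (es.map fun e => e.time).sum := by
  rw [List.sum_eq_foldl, settingsOf, List.foldl_map, List.foldl_map]

open Classical in
theorem evalBox_frontOf (hq : 0 < q) (hloop : 0 < loop)
    (hu : ∀ k, pre ≤ k → u k = u (k + loop)) (int : Intervention S) (ψ : PLTL S) :
    evalBox (frontOf M u v pre loop time) (settingsOf int.entries) (pathToks ψ) =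
      decide (ψ.Holds (M.computation u v int) time) := by
  -- The sum of the times serves as an upper bound for each of them; with unary times it is still
  -- linear in the word.
  obtain ⟨N, P, hP, hPK, hN, hσ⟩ := exists_period (M := M) (v := v) hloop hu int
    (T := (int.entries.map fun e => e.time).sum)
    fun e he => List.le_sum_of_mem (List.mem_map_of_mem he)
  have hK : loop * Fintype.card S.EndoAsg ≤ (frontOf M u v pre loop time).period :=
    Nat.mul_le_mul_left _ ((card_endoAsg_le S (u 0)).trans (length_asgs_le_modelTable M hq))
  rw [evalBox, trace_frontOf hq hloop hu]
  have hpre : (frontOf M u v pre loop time).pre = pre := rfl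
  have htime : (frontOf M u v pre loop time).time = time := rfl
  have hmul : ψ.size * ((frontOf M u v pre loop time).period + 1) ≤
      ψ.size * (2 * (frontOf M u v pre loop time).period + 1) :=
    Nat.mul_le_mul_left _ (by omega)
  refine getD_evalPLTL hP (hPK.trans hK) hσ ψ ?_ ?_
  · rw [Front.horizon, foldl_times, length_pathToks, hpre]
    omega
  · rw [Front.horizon, foldl_times, length_pathToks, hpre, htime]
    omega

end

end TreeProg

end

noncomputable section

namespace TreeProg

section

variable {p q : ℕ} {S : Signature (Fin p) (Fin q)}

/-! ### Parsing formulas -/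

def setToks (e : TimedSetting S) : List Tok :=
  [(.set, 0), numTok e.var, numTok e.time, numTok (S.rank e.val)]

def formToks : CPLTL S → List Tok
  | .box int ψ => (.lbr, 0) :: (int.entries.flatMap setToks ++ (.rbr, 0) :: pathToks ψ)
  | .neg φ => (.neg, 0) :: formToks φ
  | .conj φ ψ => (.conj, 0) :: (formToks φ ++ formToks ψ)

theorem flatMap_setToks (e : TimedSetting S) : (setToks e).flatMap Tok.word = e.code := by
  simp [setToks, TimedSetting.code, Tok.word, numTok, unary]

theorem flatMap_formToks (φ : CPLTL S) : (formToks φ).flatMap Tok.word = φ.code := by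
  induction φ with
  | box int ψ =>
    have : (int.entries.flatMap setToks).flatMap Tok.word =
        int.entries.flatMap TimedSetting.code := by
      rw [List.flatMap_assoc]
      exact List.flatMap_congr fun e _ => flatMap_setToks e
    simp only [formToks, CPLTL.code, List.flatMap_cons, List.flatMap_append, this,
      flatMap_pathToks]
    simp [Tok.word]
  | neg φ ih => simp [formToks, CPLTL.code, ih, Tok.word]
  | conj φ ψ ihφ ihψ => simp [formToks, CPLTL.code, ihφ, ihψ, Tok.word]

variable (M : CausalModel S) (u : ℕ → S.ExoAsg) (v : S.EndoAsg) (pre loop time : ℕ)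

/-- What an item of the parser stands for. -/
inductive Phrase (S : Signature (Fin p) (Fin q)) : Type
  | num (n : ℕ)
  | settings (int : Intervention S)
  | path (ψ : PLTL S)
  | truth (φ : CPLTL S)

open Classical in
def Phrase.item : Phrase S → Item
  | .num n => .num n
  | .settings int => .settings (settingsOf int.entries)
  | .path ψ => .path (pathToks ψ)
  | .truth φ => .truth (decide (φ.Holds M u v time))

def Phrase.toks : Phrase S → List Tok
  | .num n => [numTok n]
  | .settings int => int.entries.flatMap setToks ++ [(.rbr, 0)]
  | .path ψ => pathToks ψ
  | .truth φ => formToks φ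

theorem getD_endoCards (X : Fin q) :
    (frontOf M u v pre loop time).endoCards.getD X 0 = (S.range (Sum.inr X)).card := by
  have : (frontOf M u v pre loop time).endoCards =
      (List.finRange q).map fun X => (S.range (Sum.inr X)).card := by
    rw [Front.endoCards]
    simp only [frontOf, rangeCards, varList, List.map_append, List.map_map]
    rw [List.drop_left' (by simp)]
    rfl
  rw [this, List.getD_eq_getElem?_getD, List.getElem?_map]
  rw [List.getElem?_eq_getElem (by simp)]
  simp

variable {M u v time}

/-- The tags of the four kinds of items and of `junk` are distinct, so the tag of the head
determines the kind of phrase and rules out an empty stack. The next three lemmas are analogous. -/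
theorem eq_num_cons {ss : List (Phrase S)}
    (h : ((ss.map (Phrase.item M u v time)).headD .junk).1 = .bar) :
    ∃ n ss', ss = .num n :: ss' := by
  rcases ss with _ | ⟨_ | _ | _ | _, ss⟩ <;>
    simp [Item.junk, Phrase.item, Item.num, Item.settings, Item.path, Item.truth] at h ⊢

theorem eq_settings_cons {ss : List (Phrase S)}
    (h : ((ss.map (Phrase.item M u v time)).headD .junk).1 = .rbr) :
    ∃ int ss', ss = .settings int :: ss' := by
  rcases ss with _ | ⟨_ | _ | _ | _, ss⟩ <;>
    simp [Item.junk, Phrase.item, Item.num, Item.settings, Item.path, Item.truth] at h ⊢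

theorem eq_path_cons {ss : List (Phrase S)}
    (h : ((ss.map (Phrase.item M u v time)).headD .junk).1 = .atom) :
    ∃ ψ ss', ss = .path ψ :: ss' := by
  rcases ss with _ | ⟨_ | _ | _ | _, ss⟩ <;>
    simp [Item.junk, Phrase.item, Item.num, Item.settings, Item.path, Item.truth] at h ⊢

theorem eq_truth_cons {ss : List (Phrase S)}
    (h : ((ss.map (Phrase.item M u v time)).headD .junk).1 = .lbr) :
    ∃ φ ss', ss = .truth φ :: ss' := by
  rcases ss with _ | ⟨_ | _ | _ | _, ss⟩ <;>
    simp [Item.junk, Phrase.item, Item.num, Item.settings, Item.path, Item.truth] at h ⊢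

theorem of_cond_eq {b : Bool} {x : Bool × List Item} {st : List Item}
    (h : (bif b then x else (false, [])) = (true, st)) : b = true ∧ x = (true, st) := by
  cases b <;> simp_all

variable (M u v time)

/-- The state `st` of the parser represents the tokens `ts`. -/
def Represents (ts : List Tok) (st : List Item) : Prop :=
  ∃ ss : List (Phrase S), ss.map (Phrase.item M u v time) = st ∧ ss.flatMap Phrase.toks = ts

variable {M u v time}

theorem atomStep_frontOf (X : Fin q) (x : S.Val (Sum.inr X)) (st : List Item) :
    atomStep (frontOf M u v pre loop time) (.atom, 0) (.num X :: .num (S.rank x) :: st) =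
      (true, .path (pathToks (.atom X x)) :: st) := by
  have h1 : ((X : ℕ) + 1).ble (frontOf M u v pre loop time).numEndo = true :=
    Nat.ble_eq_true_of_le X.2
  have h2 : (S.rank x + 1).ble ((frontOf M u v pre loop time).endoCards.getD X 0) = true := by
    rw [getD_endoCards]
    exact Nat.ble_eq_true_of_le (rank_lt S x)
  simp only [atomStep, Item.num, List.headD_cons, List.tail_cons, h1, h2]
  rfl

theorem represents_atomStep {ss : List (Phrase S)} {st : List Item}
    (h : atomStep (frontOf M u v pre loop time) (.atom, 0)
      (ss.map (Phrase.item M u v time)) = (true, st)) :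
    Represents M u v time ((.atom, 0) :: ss.flatMap Phrase.toks) st := by
  obtain ⟨hc, -⟩ := of_cond_eq h
  simp only [Bool.and_eq_true, beq_iff_eq, Nat.ble_eq] at hc
  obtain ⟨⟨⟨h1, h2⟩, h3⟩, h4⟩ := hc
  obtain ⟨X, ss, rfl⟩ := eq_num_cons h1
  rw [List.map_cons, List.tail_cons] at h2
  obtain ⟨k, ss, rfl⟩ := eq_num_cons h2
  simp only [List.map_cons, List.headD_cons, List.tail_cons, Phrase.item, Item.num] at h3 h4
  lift X to Fin q using h3
  rw [getD_endoCards] at h4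
  obtain ⟨x, rfl⟩ := exists_rank_eq S h4
  simp only [List.map_cons, Phrase.item, atomStep_frontOf, Prod.mk.injEq, true_and] at h
  exact ⟨.path (.atom X x) :: ss, h, rfl⟩

theorem represents_unaryStep {c : CodeSym} (hc : c = .neg ∨ c = .nxt ∨ c = .prv)
    {ss : List (Phrase S)} {st : List Item}
    (h : unaryStep (c, 0) (ss.map (Phrase.item M u v time)) = (true, st)) :
    Represents M u v time ((c, 0) :: ss.flatMap Phrase.toks) st := by
  unfold unaryStep at h
  by_cases h1 : ((ss.map (Phrase.item M u v time)).headD .junk).1 = .atom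
  · obtain ⟨ψ, ss, rfl⟩ := eq_path_cons h1
    rw [beq_iff_eq.2 h1, cond_true, Prod.mk.injEq] at h
    rcases hc with rfl | rfl | rfl
    · exact ⟨.path (.neg ψ) :: ss, h.2, rfl⟩
    · exact ⟨.path (.nxt ψ) :: ss, h.2, rfl⟩
    · exact ⟨.path (.prv ψ) :: ss, h.2, rfl⟩
  · rw [beq_eq_false_iff_ne.2 h1, cond_false] at h
    obtain ⟨hb, h'⟩ := of_cond_eq h
    simp only [Bool.and_eq_true, beq_iff_eq] at hb
    obtain ⟨φ, ss, rfl⟩ := eq_truth_cons hb.1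
    obtain rfl := hb.2
    refine ⟨.truth (.neg φ) :: ss, ?_, rfl⟩
    rw [← (Prod.mk.inj h').2]
    simp only [Phrase.item, List.map_cons, List.headD_cons, List.tail_cons, Item.truth,
      CPLTL.Holds]
    by_cases hφ : φ.Holds M u v time <;> simp [hφ]

theorem represents_binaryStep {c : CodeSym} (hc : c = .conj ∨ c = .untl ∨ c = .snce)
    {ss : List (Phrase S)} {st : List Item}
    (h : binaryStep (c, 0) (ss.map (Phrase.item M u v time)) = (true, st)) :
    Represents M u v time ((c, 0) :: ss.flatMap Phrase.toks) st := by
  unfold binaryStep at h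
  by_cases h1 : ((ss.map (Phrase.item M u v time)).headD .junk).1 = .atom ∧
      ((ss.map (Phrase.item M u v time)).tail.headD .junk).1 = .atom
  · obtain ⟨h1, h2⟩ := h1
    rw [beq_iff_eq.2 h1, beq_iff_eq.2 h2, Bool.and_self, cond_true, Prod.mk.injEq] at h
    obtain ⟨ψ, ss, rfl⟩ := eq_path_cons h1
    rw [List.map_cons, List.tail_cons] at h2
    obtain ⟨χ, ss, rfl⟩ := eq_path_cons h2
    rcases hc with rfl | rfl | rfl
    · exact ⟨.path (.conj ψ χ) :: ss, h.2, by simp [Phrase.toks, pathToks]⟩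
    · exact ⟨.path (.untl ψ χ) :: ss, h.2, by simp [Phrase.toks, pathToks]⟩
    · exact ⟨.path (.snce ψ χ) :: ss, h.2, by simp [Phrase.toks, pathToks]⟩
  · rw [show (_ && _) = false from by
      rw [← Bool.not_eq_true, Bool.and_eq_true, beq_iff_eq, beq_iff_eq]; exact h1, cond_false] at h
    obtain ⟨hb, h'⟩ := of_cond_eq h
    simp only [Bool.and_eq_true, beq_iff_eq] at hb
    obtain ⟨⟨hb, hb'⟩, rfl⟩ := hb
    obtain ⟨φ, ss, rfl⟩ := eq_truth_cons hb
    rw [List.map_cons, List.tail_cons] at hb'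
    obtain ⟨χ, ss, rfl⟩ := eq_truth_cons hb'
    refine ⟨.truth (.conj φ χ) :: ss, ?_, by simp [Phrase.toks, formToks]⟩
    rw [← (Prod.mk.inj h').2]
    simp only [Phrase.item, List.map_cons, List.headD_cons, List.tail_cons, Item.truth,
      CPLTL.Holds]
    by_cases hφ : φ.Holds M u v time <;> by_cases hχ : χ.Holds M u v time <;> simp [hφ, hχ]

theorem setStep_frontOf (e : TimedSetting S) (es : List (TimedSetting S))
    (he : ∀ e' ∈ es, e.var = e'.var → e.time ≠ e'.time) (st : List Item) :
    setStep (frontOf M u v pre loop time)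
      (.num e.var :: .num e.time :: .num (S.rank e.val) :: .settings (settingsOf es) :: st) =
      (true, .settings (settingsOf (e :: es)) :: st) := by
  have h1 : ((e.var : ℕ) + 1).ble (frontOf M u v pre loop time).numEndo = true :=
    Nat.ble_eq_true_of_le e.var.2
  have h2 : (S.rank e.val + 1).ble ((frontOf M u v pre loop time).endoCards.getD e.var 0) =
      true := by
    rw [getD_endoCards]
    exact Nat.ble_eq_true_of_le (rank_lt S e.val)
  have h3 : (settingsOf es).all (fun e' => !(e'.1 == (e.var : ℕ) && e'.2.1 == e.time)) =
      true := by
    simp only [settingsOf, List.all_map, List.all_eq_true]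
    intro e' h
    have := he e' h
    rw [Function.comp_apply, Bool.not_eq_true', ← Bool.not_eq_true, Bool.and_eq_true, beq_iff_eq,
      beq_iff_eq]
    rintro ⟨h4, h5⟩
    exact this (Fin.ext h4.symm) h5.symm
  simp only [setStep, Item.num, Item.settings, List.headD_cons, List.tail_cons, h1, h2, h3]
  rfl

theorem represents_setStep {ss : List (Phrase S)} {st : List Item}
    (h : setStep (frontOf M u v pre loop time) (ss.map (Phrase.item M u v time)) = (true, st)) :
    Represents M u v time ((.set, 0) :: ss.flatMap Phrase.toks) st := by
  obtain ⟨hc, h'⟩ := of_cond_eq h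
  simp only [Bool.and_eq_true, beq_iff_eq, Nat.ble_eq] at hc
  obtain ⟨⟨⟨⟨⟨⟨h1, h2⟩, h3⟩, h4⟩, h5⟩, h6⟩, h7⟩ := hc
  obtain ⟨X, ss, rfl⟩ := eq_num_cons h1
  simp only [List.map_cons, List.tail_cons] at h2 h3 h4
  obtain ⟨n, ss, rfl⟩ := eq_num_cons h2
  simp only [List.map_cons, List.tail_cons] at h3 h4
  obtain ⟨k, ss, rfl⟩ := eq_num_cons h3
  simp only [List.map_cons, List.tail_cons] at h4
  obtain ⟨int, ss, rfl⟩ := eq_settings_cons h4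
  simp only [List.map_cons, List.headD_cons, List.tail_cons, Phrase.item, Item.num,
    Item.settings] at h5 h6 h7 h'
  lift X to Fin q using h5
  rw [getD_endoCards] at h6
  obtain ⟨x, rfl⟩ := exists_rank_eq S h6
  have hcons : ∀ e' ∈ int.entries, X = e'.var → n ≠ e'.time := by
    intro e he hX hn
    have := List.all_eq_true.1 h7 _ (List.mem_map_of_mem he)
    simp [hX, hn] at this
  refine ⟨.settings ⟨⟨X, n, x⟩ :: int.entries, List.pairwise_cons.2 ⟨hcons, int.consistent⟩⟩ :: ss,
    (Prod.mk.inj h').2, ?_⟩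
  simp [Phrase.toks, setToks]

/-- Every formula contains an atom and thus an endogenous variable. Consequently the rows of the
table are not empty, and the table is at least as long as the number of assignments. -/
theorem pos_of_pltl (ψ : PLTL S) : 0 < q := by
  induction ψ with
  | atom X x => exact X.pos
  | _ => assumption

theorem boxStep_frontOf (hq : 0 < q) (hloop : 0 < loop)
    (hu : ∀ k, pre ≤ k → u k = u (k + loop)) (int : Intervention S) (ψ : PLTL S)
    (ss : List (Phrase S)) :
    boxStep (frontOf M u v pre loop time)
      ((Phrase.settings int :: Phrase.path ψ :: ss).map (Phrase.item M u v time)) =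
      (true, (Phrase.truth (.box int ψ) :: ss).map (Phrase.item M u v time)) := by
  exact congrArg (fun b => (true, Item.truth b :: ss.map (Phrase.item M u v time)))
    (evalBox_frontOf hq hloop hu int ψ)

theorem represents_boxStep (hloop : 0 < loop)
    (hu : ∀ k, pre ≤ k → u k = u (k + loop)) {ss : List (Phrase S)} {st : List Item}
    (h : boxStep (frontOf M u v pre loop time) (ss.map (Phrase.item M u v time)) = (true, st)) :
    Represents M u v time ((.lbr, 0) :: ss.flatMap Phrase.toks) st := by
  obtain ⟨hc, -⟩ := of_cond_eq h
  simp only [Bool.and_eq_true, beq_iff_eq] at hc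
  obtain ⟨h1, h2⟩ := hc
  obtain ⟨int, ss, rfl⟩ := eq_settings_cons h1
  rw [List.map_cons, List.tail_cons] at h2
  obtain ⟨ψ, ss, rfl⟩ := eq_path_cons h2
  rw [boxStep_frontOf pre loop (pos_of_pltl ψ) hloop hu, Prod.mk.injEq] at h
  exact ⟨_, h.2, by simp [Phrase.toks, formToks]⟩

/-- Soundness of the parser: as long as it does not fail, its stack is the image of phrases that
spell exactly the tokens read. A single item with a truth value at the end then exhibits a formula
with these tokens. -/
theorem represents_parse (hloop : 0 < loop) (hu : ∀ k, pre ≤ k → u k = u (k + loop))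
    {ts : List Tok} {st : List Item} (h : parse (frontOf M u v pre loop time) ts = (true, st)) :
    Represents M u v time ts st := by
  induction ts generalizing st with
  | nil => exact ⟨[], (Prod.mk.inj h).2, rfl⟩
  | cons t ts ih =>
    obtain ⟨b, st', h'⟩ : ∃ b st', parse (frontOf M u v pre loop time) ts = (b, st') := ⟨_, _, rfl⟩
    have h2 : parseStep (frontOf M u v pre loop time) t (b, st') = (true, st) := by
      rw [← h', ← h]; rfl
    cases b with
    | false => simp [parseStep] at h2
    | true =>
      obtain ⟨ss, rfl, rfl⟩ := ih h'
      obtain ⟨c, n⟩ := t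
      by_cases hc : c = .bar
      · subst hc
        exact ⟨.num n :: ss, (Prod.mk.inj h2).2, rfl⟩
      · cases n with
        | succ n =>
          have : (c == CodeSym.bar) = false := beq_eq_false_iff_ne.2 hc
          simp [parseStep, this] at h2
        | zero =>
          cases c with
          | tick => exact absurd (congrArg Prod.fst h2) Bool.false_ne_true
          | bar => exact absurd rfl hc
          | atom => exact represents_atomStep pre loop h2
          | neg => exact represents_unaryStep (by simp) h2
          | conj => exact represents_binaryStep (by simp) h2
          | nxt => exact represents_unaryStep (by simp) h2
          | untl => exact represents_binaryStep (by simp) h2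
          | prv => exact represents_unaryStep (by simp) h2
          | snce => exact represents_binaryStep (by simp) h2
          | lbr => exact represents_boxStep pre loop hloop hu h2
          | rbr => exact ⟨.settings ⟨[], .nil⟩ :: ss, (Prod.mk.inj h2).2, rfl⟩
          | set => exact represents_setStep pre loop h2

/-! ### Completeness of the parser -/

theorem parse_cons (E : Front) (t : Tok) (ts : List Tok) :
    parse E (t :: ts) = parseStep E t (parse E ts) := rfl

theorem parse_numTok {E : Front} {ts : List Tok} {st : List Item} (n : ℕ)
    (h : parse E ts = (true, st)) : parse E (numTok n :: ts) = (true, .num n :: st) := by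
  rw [parse_cons, h]; rfl

theorem parse_pathToks (ψ : PLTL S) {ts : List Tok} {st : List Item}
    (h : parse (frontOf M u v pre loop time) ts = (true, st)) :
    parse (frontOf M u v pre loop time) (pathToks ψ ++ ts) =
      (true, .path (pathToks ψ) :: st) := by
  induction ψ generalizing ts st with
  | atom X x =>
    simp only [pathToks, List.cons_append, List.nil_append]
    rw [parse_cons, parse_numTok X (parse_numTok (S.rank x) h)]
    exact atomStep_frontOf pre loop X x st
  | neg φ ih | nxt φ ih | prv φ ih =>
    rw [pathToks, List.cons_append, parse_cons, ih h]
    rfl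
  | conj φ ψ ihφ ihψ | untl φ ψ ihφ ihψ | snce φ ψ ihφ ihψ =>
    rw [pathToks, List.cons_append, List.append_assoc, parse_cons, ihφ (ihψ h)]
    rfl

theorem parse_setToks {es : List (TimedSetting S)}
    (hes : es.Pairwise fun a b => a.var = b.var → a.time ≠ b.time) {ts : List Tok}
    {st : List Item} (h : parse (frontOf M u v pre loop time) ts = (true, st)) :
    parse (frontOf M u v pre loop time) (es.flatMap setToks ++ (.rbr, 0) :: ts) =
      (true, .settings (settingsOf es) :: st) := by
  induction es with
  | nil => rw [List.flatMap_nil, List.nil_append, parse_cons, h]; rfl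
  | cons e es ih =>
    rw [List.pairwise_cons] at hes
    simp only [List.flatMap_cons, setToks, List.cons_append, List.nil_append]
    rw [parse_cons, parse_numTok _ (parse_numTok _ (parse_numTok _ (ih hes.2)))]
    exact setStep_frontOf pre loop e es hes.1 st

theorem parse_formToks (hloop : 0 < loop) (hu : ∀ k, pre ≤ k → u k = u (k + loop)) (hq : 0 < q)
    (φ : CPLTL S) {ts : List Tok} {ss : List (Phrase S)}
    (h : parse (frontOf M u v pre loop time) ts = (true, ss.map (Phrase.item M u v time))) :
    parse (frontOf M u v pre loop time) (formToks φ ++ ts) =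
      (true, (Phrase.truth φ :: ss).map (Phrase.item M u v time)) := by
  induction φ generalizing ts ss with
  | box int ψ =>
    rw [formToks, List.cons_append, List.append_assoc, parse_cons, List.cons_append,
      parse_setToks pre loop int.consistent (parse_pathToks pre loop ψ h)]
    exact boxStep_frontOf pre loop hq hloop hu int ψ ss
  | neg φ ih =>
    rw [formToks, List.cons_append, parse_cons, ih h]
    simp only [Phrase.item, List.map_cons, CPLTL.Holds]
    by_cases hφ : φ.Holds M u v time <;> simp only [hφ] <;> simp <;> rfl
  | conj φ ψ ihφ ihψ =>
    rw [formToks, List.cons_append, List.append_assoc, parse_cons, ihφ (ihψ h)]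
    simp only [Phrase.item, List.map_cons, CPLTL.Holds]
    by_cases hφ : φ.Holds M u v time <;> by_cases hψ : ψ.Holds M u v time <;>
      simp only [hφ, hψ] <;> simp <;> rfl

end

end TreeProg

end

noncomputable section

namespace TreeProg

/-! ### Tokens and words -/

theorem lexStep_tick (t : Tok) (ts : List Tok) :
    lexStep .tick (t :: ts) = (t.1, t.2 + 1) :: ts := rfl

theorem lexStep_of_ne {c : CodeSym} (h : c ≠ .tick) (ts : List Tok) :
    lexStep c ts = (c, 0) :: ts := by
  rw [lexStep, beq_eq_false_iff_ne.2 h, cond_false]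

theorem flatMap_word_lex (w : List CodeSym) : (lex w).flatMap Tok.word = w := by
  induction w with
  | nil => rfl
  | cons c w ih =>
    have h : lex (c :: w) = lexStep c (lex w) := rfl
    rw [h]
    by_cases hc : c = .tick
    · subst hc
      cases hw : lex w with
      | nil =>
        rw [hw, List.flatMap_nil] at ih
        rw [← ih]; rfl
      | cons t ts =>
        rw [hw, List.flatMap_cons] at ih
        rw [lexStep_tick, List.flatMap_cons, ← ih]
        simp [Tok.word, List.replicate_succ]
    · rw [lexStep_of_ne hc, List.flatMap_cons, ih]
      simp [Tok.word]

/-- Without the hypothesis, the ticks of a token `(.tick, n)` would be absorbed by the token that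
follows it. -/
theorem lex_flatMap_word {ts : List Tok} (h : ∀ t ∈ ts, t.1 ≠ .tick) :
    lex (ts.flatMap Tok.word) = ts := by
  induction ts with
  | nil => rfl
  | cons t ts ih =>
    obtain ⟨c, n⟩ := t
    have hc : c ≠ .tick := h _ List.mem_cons_self
    have key : ∀ w, lex (List.replicate n .tick ++ ([c] ++ w)) = (c, n) :: lex w := by
      intro w
      induction n with
      | zero => exact lexStep_of_ne hc _
      | succ n ihn =>
        have h1 : lex (List.replicate (n + 1) .tick ++ ([c] ++ w)) =
            lexStep .tick (lex (List.replicate n .tick ++ ([c] ++ w))) := rfl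
        rw [h1, ihn fun t ht => ?_, lexStep_tick]
        rcases List.mem_cons.1 ht with rfl | ht
        · exact hc
        · exact h _ (List.mem_cons_of_mem _ ht)
    rw [List.flatMap_cons, Tok.word, List.append_assoc, key,
      ih fun t ht => h t (List.mem_cons_of_mem _ ht)]

/-! ### Enumerations that are cut off -/

theorem tuples_cons (c : ℕ) (cs : List ℕ) :
    tuples (c :: cs) = (List.range c).flatMap fun d => (tuples cs).map fun z => d :: z := rfl

theorem tuplesUpTo_cons (B c : ℕ) (cs : List ℕ) :
    tuplesUpTo B (c :: cs) =
      ((List.range c).flatMap fun d => (tuplesUpTo B cs).map fun z => d :: z).take B := rfl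

theorem length_flatMap_range (c : ℕ) (zs : List (List ℕ)) :
    ((List.range c).flatMap fun d => zs.map fun z => d :: z).length = c * zs.length := by
  simp [List.length_flatMap]

/-- As all bounds are positive, the enumerations for shorter lists of bounds are no longer than the
final one, so no stage is cut off. -/
theorem tuplesUpTo_of_le {B : ℕ} {cs : List ℕ} (hcs : ∀ c ∈ cs, 1 ≤ c)
    (h : (tuples cs).length ≤ B) : tuplesUpTo B cs = tuples cs := by
  induction cs with
  | nil => rfl
  | cons c cs ih =>
    rw [tuples_cons, length_flatMap_range] at h
    rw [List.forall_mem_cons] at hcs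
    have : (tuples cs).length ≤ B :=
      (Nat.le_mul_of_pos_left _ (by omega)).trans h
    rw [tuplesUpTo_cons, tuples_cons, ih hcs.2 this, List.take_of_length_le]
    rwa [length_flatMap_range]

/-- With positive bounds, a stage that has reached length `B` forces length `B` at all later stages;
a final length below `B` shows that nothing was cut off. -/
theorem tuplesUpTo_of_length_lt {B : ℕ} {cs : List ℕ} (hcs : ∀ c ∈ cs, 1 ≤ c)
    (h : (tuplesUpTo B cs).length < B) : tuplesUpTo B cs = tuples cs := by
  induction cs with
  | nil => rfl
  | cons c cs ih =>
    rw [List.forall_mem_cons] at hcs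
    rw [tuplesUpTo_cons, List.length_take, length_flatMap_range] at h
    have h1 := Nat.le_mul_of_pos_left (tuplesUpTo B cs).length (show 0 < c by omega)
    rw [tuplesUpTo_cons, tuples_cons, ← ih hcs.2 (by omega), List.take_of_length_le]
    rw [length_flatMap_range]
    omega

theorem length_of_mem_tuplesUpTo {B : ℕ} {cs z : List ℕ} (h : z ∈ tuplesUpTo B cs) :
    z.length = cs.length := by
  induction cs generalizing z with
  | nil => simp_all [tuplesUpTo]
  | cons c cs ih =>
    obtain ⟨d, -, h⟩ := List.mem_flatMap.1 (List.mem_of_mem_take h)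
    obtain ⟨z, hz, rfl⟩ := List.mem_map.1 h
    simp [ih hz]

theorem nodup_tuples (cs : List ℕ) : (tuples cs).Nodup := by
  induction cs with
  | nil => simp [tuples]
  | cons c cs ih =>
    rw [tuples_cons, List.nodup_flatMap]
    refine ⟨fun d _ => ih.map (List.cons_injective), ?_⟩
    refine List.pairwise_lt_range.imp fun {a b} hab z h1 h2 => ?_
    obtain ⟨x, -, rfl⟩ := List.mem_map.1 h1
    obtain ⟨y, -, h⟩ := List.mem_map.1 h2
    have := (List.cons.inj h).1
    omega

theorem forall₂_flatMap {α β γ : Type*} {R : β → γ → Prop} {l : List α} {f : α → List β}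
    {g : α → List γ} (h : ∀ a, List.Forall₂ R (f a) (g a)) :
    List.Forall₂ R (l.flatMap f) (l.flatMap g) := by
  induction l with
  | nil => exact .nil
  | cons a l ih => exact List.rel_append (h a) ih

/-- A flat list is cut into the blocks that the lengths of the `g a` prescribe. Without repetitions
in `l`, the block is a function of the element; this recovers equations and contexts from lists of
numbers. -/
theorem exists_eq_flatMap {α β γ : Type*} {R : β → γ → Prop} {l : List α} (hl : l.Nodup)
    {g : α → List γ} {m : List β} (h : List.Forall₂ R m (l.flatMap g)) :
    ∃ f : α → List β, m = l.flatMap f ∧ ∀ a ∈ l, List.Forall₂ R (f a) (g a) := by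
  classical
  induction l generalizing m with
  | nil => exact ⟨fun _ => [], by simpa using h, by simp⟩
  | cons a l ih =>
    rw [List.nodup_cons] at hl
    rw [List.flatMap_cons] at h
    obtain ⟨f, hf, hf'⟩ := ih hl.2 (List.forall₂_drop_append _ _ _ h)
    have hne : ∀ b ∈ l, b ≠ a := fun b hb hba => hl.1 (hba ▸ hb)
    refine ⟨Function.update f a (m.take (g a).length), ?_, ?_⟩
    · rw [List.flatMap_cons, Function.update_self,
        List.flatMap_congr fun b hb => Function.update_of_ne (hne b hb) _ _, ← hf,
        List.take_append_drop]
    · rw [List.forall_mem_cons, Function.update_self]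
      refine ⟨List.forall₂_take_append _ _ _ h, fun b hb => ?_⟩
      rw [Function.update_of_ne (hne b hb)]
      exact hf' b hb

/-! ### The part before the formula -/

section

variable {p q : ℕ} {S : Signature (Fin p) (Fin q)} {M : CausalModel S} {u : ℕ → S.ExoAsg}
  {v : S.EndoAsg} {pre loop time : ℕ}

theorem rangeCards_eq : rangeCards S = ((List.finRange p).map fun X => (S.range (.inl X)).card) ++
    (List.finRange q).map fun X => (S.range (.inr X)).card := by
  simp [rangeCards, varList, Function.comp_def]

theorem length_rangeCards : (rangeCards S).length = p + q := by
  simp [rangeCards_eq]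

theorem endoBounds_frontOf : (frontOf M u v pre loop time).endoBounds =
    (List.finRange q).map fun X => (0, (S.range (.inr X)).card) := by
  rw [Front.endoBounds, Front.endoCards]
  simp only [frontOf]
  rw [rangeCards_eq, List.drop_left' (by simp), List.map_map]
  rfl

theorem exoBounds_frontOf : (frontOf M u v pre loop time).exoBounds =
    (List.finRange p).map fun X => (0, (S.range (.inl X)).card) := by
  rw [Front.exoBounds]
  simp only [frontOf]
  rw [rangeCards_eq, List.take_left' (by simp), List.map_map]
  rfl

theorem forall₂_ranks {n : ℕ} {Z : Fin n → Fin p ⊕ Fin q} (s : ∀ i, S.Val (Z i)) :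
    List.Forall₂ (fun x (b : ℕ × ℕ) => b.1 ≤ x ∧ x < b.2)
      ((List.finRange n).map fun i => S.rank (s i))
      ((List.finRange n).map fun i => (0, (S.range (Z i)).card)) := by
  rw [List.forall₂_map_left_iff, List.forall₂_map_right_iff, List.forall₂_same]
  exact fun i _ => ⟨Nat.zero_le _, rank_lt S _⟩

theorem eq_map_getD {n : ℕ} {l : List ℕ} (h : l.length = n) :
    l = (List.finRange n).map fun i : Fin n => l.getD i 0 :=
  List.ext_getElem (by simp [h]) fun i h1 h2 => by simp [h1]

theorem exists_ranks {n : ℕ} {Z : Fin n → Fin p ⊕ Fin q} {l : List ℕ}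
    (h : List.Forall₂ (fun x (b : ℕ × ℕ) => b.1 ≤ x ∧ x < b.2) l
      ((List.finRange n).map fun i => (0, (S.range (Z i)).card))) :
    ∃ s : ∀ i, S.Val (Z i), (List.finRange n).map (fun i => S.rank (s i)) = l := by
  have hl := eq_map_getD (h.length_eq.trans (by simp) : l.length = n)
  rw [hl, List.forall₂_map_left_iff, List.forall₂_map_right_iff, List.forall₂_same] at h
  refine ⟨fun i => ofRank S (Z i) (l.getD i 0), ?_⟩
  conv_rhs => rw [hl]
  exact List.map_congr_left fun i hi => rank_ofRank S (h i hi).2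

theorem check_frontOf (hloop : 0 < loop) : (frontOf M u v pre loop time).check = true := by
  simp only [Front.check, Bool.and_eq_true, beq_iff_eq, List.all_eq_true, Nat.ble_eq, inBounds_iff]
  refine ⟨⟨⟨⟨⟨length_rangeCards, ?_⟩, ?_⟩, hloop⟩, ?_⟩, ?_⟩
  · intro c hc
    obtain ⟨Z, -, rfl⟩ := List.mem_map.1 hc
    exact Finset.card_pos.2 (S.nonempty Z)
  · have h1 : (frontOf M u v pre loop time).rows = S.asgs.map (asgRanks S) := rfl
    rw [h1, List.flatMap_map]
    refine forall₂_flatMap fun z => List.rel_append ?_ ?_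
    · rw [List.forall₂_map_right_iff, List.forall₂_same]
      exact fun x _ => ⟨le_rfl, Nat.lt_succ_self x⟩
    · rw [endoBounds_frontOf]
      exact forall₂_ranks fun X => M.eqn X z
  · have h1 : List.replicate (pre + loop) () = (List.range (pre + loop)).map fun _ => () := by
      simp
    have h2 : (frontOf M u v pre loop time).pre + (frontOf M u v pre loop time).loop =
      pre + loop := rfl
    rw [h2, h1, List.flatMap_map]
    refine forall₂_flatMap fun j => ?_
    rw [exoBounds_frontOf]
    exact forall₂_ranks (u j)
  · rw [endoBounds_frontOf]
    exact forall₂_ranks v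

theorem length_context : ((List.range (pre + loop)).flatMap fun j => exoRanks (u j)).length =
    (pre + loop) * p := by
  simp [List.length_flatMap, length_exoRanks]

theorem length_modelTable : (modelTable M).length = S.asgs.length * (p + q + q) := by
  simp [List.length_flatMap, modelTable, length_asgRanks, eqnRanks]

theorem readFront_nums (hq : 0 < q) (l : List ℕ) :
    readFront ((frontOf M u v pre loop time).nums ++ l) = frontOf M u v pre loop time := by
  have hrows : tuplesUpTo ((modelTable M ++ (pre :: loop ::
      (((List.range (pre + loop)).flatMap fun j => exoRanks (u j)) ++
        (endoRanks v ++ time :: l)))).length + 1) (rangeCards S) = S.asgs.map (asgRanks S) := by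
    rw [map_ranks_asgs, tuplesUpTo_of_le]
    · intro c hc
      obtain ⟨Z, -, rfl⟩ := List.mem_map.1 hc
      exact Finset.card_pos.2 (S.nonempty Z)
    · rw [← map_ranks_asgs, List.length_map, List.length_append]
      have := length_asgs_le_modelTable M hq
      omega
  have h1 : (frontOf M u v pre loop time).nums ++ l = p :: q :: (rangeCards S ++ (modelTable M ++
      (pre :: loop :: (((List.range (pre + loop)).flatMap fun j => exoRanks (u j)) ++
        (endoRanks v ++ time :: l))))) := by
    simp [Front.nums, frontOf]
  rw [h1, readFront]
  simp only [List.headD_cons, List.tail_cons, readFront₁]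
  rw [List.take_left' length_rangeCards, List.drop_left' length_rangeCards, hrows, readFront₂,
    List.length_map, List.take_left' length_modelTable, List.drop_left' length_modelTable]
  simp only [readFront₃, readFront₄, List.headD_cons, List.tail_cons]
  rw [List.take_left' length_context, List.drop_left' length_context,
    List.take_left' (length_endoRanks v), List.drop_left' (length_endoRanks v)]
  rfl

/-- Data in range come from an instance. -/
theorem exists_frontOf {E : Front} (hE : E.check = true) (hrows : E.rows = tuples E.cards) :
    ∃ (S : Signature (Fin E.numExo) (Fin E.numEndo)) (M : CausalModel S) (u : ℕ → S.ExoAsg)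
      (v : S.EndoAsg), (∀ k, E.pre ≤ k → u k = u (k + E.loop)) ∧
      E = frontOf M u v E.pre E.loop E.time := by
  obtain ⟨p, q, cards, rows, table, pre, loop, context, default, time⟩ := E
  simp only [Front.check, Bool.and_eq_true, beq_iff_eq, List.all_eq_true, Nat.ble_eq,
    inBounds_iff] at hE hrows ⊢
  obtain ⟨⟨⟨⟨⟨h1, h2⟩, h3⟩, h4⟩, h5⟩, h6⟩ := hE
  subst hrows
  obtain ⟨c, rfl⟩ : ∃ c : Fin p ⊕ Fin q → ℕ, cards = (varList p q).map c := by
    refine ⟨Sum.elim (fun i => cards.getD i 0) (fun j => cards.getD (p + j) 0), ?_⟩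
    refine List.ext_getElem (by simp [varList, h1]) fun i h7 h8 => ?_
    simp only [varList, List.map_append, List.map_map, List.getElem_append, List.length_map,
      List.length_finRange]
    split_ifs with hi
    · simp [h7]
    · simp [h7, show p + (i - p) = i by omega]
  -- Only the sizes of the ranges are encoded, so the range of a variable can be taken to be an
  -- initial segment of the natural numbers.
  obtain ⟨S, rfl⟩ : ∃ S : Signature (Fin p) (Fin q), c = fun Z => (S.range Z).card :=
    ⟨{ range := fun Z => (Finset.range (c Z)).map Nat.castEmbedding
       nonempty := fun Z => by
        have := h2 _ (List.mem_map_of_mem (mem_varList Z))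
        rw [Finset.map_nonempty, Finset.nonempty_range_iff]
        omega }, by simp⟩
  have hb : ∀ E : Front, E.numExo = p → E.cards = rangeCards S →
      E.endoBounds = ((List.finRange q).map fun X => (0, (S.range (.inr X)).card)) ∧
      E.exoBounds = ((List.finRange p).map fun X => (0, (S.range (.inl X)).card)) := by
    rintro E rfl h
    rw [Front.endoBounds, Front.endoCards, Front.exoBounds, h, rangeCards_eq,
      List.drop_left' (by simp), List.take_left' (by simp), List.map_map, List.map_map]
    exact ⟨rfl, rfl⟩
  have hnodup : S.asgs.Nodup := List.Nodup.of_map (asgRanks S) (by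
    rw [map_ranks_asgs]; exact nodup_tuples _)
  have hr : tuples ((varList p q).map fun Z => (S.range Z).card) = S.asgs.map (asgRanks S) :=
    (map_ranks_asgs S).symm
  rw [hr, List.flatMap_map] at h3
  obtain ⟨f, rfl, hf⟩ := exists_eq_flatMap hnodup h3
  have hf' : ∀ z, ∃ s : S.EndoAsg, f z = asgRanks S z ++ endoRanks s := by
    intro z
    have h := hf z (mem_asgs S z)
    rw [Front.rowBounds, (hb _ rfl rfl).1] at h
    obtain ⟨s, hs⟩ := exists_ranks (List.forall₂_drop_append _ _ _ h)
    refine ⟨s, ?_⟩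
    -- The first part of a row lies in one-point intervals, so it equals the ranks of the
    -- assignment.
    have h7 := List.forall₂_take_append _ _ _ h
    rw [← inBounds_iff] at h7
    have h8 := (eqList_iff _ _).1 h7
    conv_lhs => rw [← List.take_append_drop _ (f z), h8]
    exact congrArg _ hs.symm
  choose eqn heqn using hf'
  have hrep : List.replicate (pre + loop) () = (List.range (pre + loop)).map fun _ => () := by
    simp
  rw [hrep, List.flatMap_map, (hb _ rfl rfl).2] at h5
  obtain ⟨g, rfl, hg⟩ := exists_eq_flatMap List.nodup_range h5
  have hg' : ∀ j, ∃ s : S.ExoAsg, j < pre + loop → g j = exoRanks s := by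
    intro j
    by_cases hj : j < pre + loop
    · obtain ⟨s, hs⟩ := exists_ranks (hg j (List.mem_range.2 hj))
      exact ⟨s, fun _ => hs.symm⟩
    · exact ⟨fun X => ⟨_, (S.nonempty (.inl X)).choose_spec⟩, fun h => (hj h).elim⟩
  choose w hw using hg'
  rw [(hb _ rfl rfl).1] at h6
  obtain ⟨v, hv⟩ := exists_ranks h6
  -- The word gives the context only on prefix and loop; the loop is repeated to obtain values at
  -- all times.
  refine ⟨S, ⟨fun X z => eqn z X⟩, fun k => w (if k < pre then k else pre + (k - pre) % loop), v,
    fun k hk => ?_, ?_⟩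
  · dsimp only at hk ⊢
    rw [if_neg (by omega), if_neg (by omega), Nat.sub_add_comm hk, Nat.add_mod_right]
  · simp only [frontOf, Front.mk.injEq, true_and, and_true]
    refine ⟨rfl, hr, ?_, ?_, hv.symm⟩
    · exact List.flatMap_congr fun z _ => heqn z
    · refine List.flatMap_congr fun j hj => ?_
      rw [List.mem_range] at hj
      rw [hw j hj]
      split_ifs with h
      · rfl
      · rw [Nat.mod_eq_of_lt (by omega), show pre + (j - pre) = j by omega]

end

/-! ### Correctness of the decision procedure -/

/-- Matching the table against the rows forces it to be at least as long as the number of rows,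
while it is shorter than the cut-off. So on data that pass the check the cut-off had no effect. -/
theorem rows_readFront (ns : List ℕ) (hE : (readFront ns).check = true) :
    (readFront ns).rows = tuples (readFront ns).cards := by
  have hrows : ∃ B, (readFront ns).table.length < B ∧
      (readFront ns).rows = tuplesUpTo B (readFront ns).cards := by
    refine ⟨_, Nat.lt_succ_of_le ?_, rfl⟩
    exact List.length_take_le' _ _
  generalize readFront ns = E at hE hrows
  obtain ⟨B, hB, hrows⟩ := hrows
  simp only [Front.check, Bool.and_eq_true, beq_iff_eq, List.all_eq_true, Nat.ble_eq,
    inBounds_iff] at hE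
  obtain ⟨⟨⟨⟨⟨h1, h2⟩, h3⟩, -⟩, -⟩, -⟩ := hE
  rw [hrows]
  -- Without variables the rows have no entries and the count fails, but then the enumeration is
  -- `[[]]` and involves no cut.
  by_cases hc : E.cards = []
  · rw [hc]; rfl
  · refine tuplesUpTo_of_length_lt h2 (lt_of_le_of_lt ?_ hB)
    rw [h3.length_eq, ← hrows, List.length_flatMap]
    have hpos := List.length_pos_iff.2 hc
    have : ∀ z ∈ E.rows, 1 ≤ (E.rowBounds z).length := by
      intro z hz
      rw [hrows] at hz
      rw [Front.rowBounds, List.length_append, List.length_map, length_of_mem_tuplesUpTo hz]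
      omega
    have := List.card_nsmul_le_sum (E.rows.map fun z => (E.rowBounds z).length) 1 (by simpa using this)
    simpa using this

variable (I : MCInstance)

def frontOfInstance : Front :=
  frontOf I.model I.context I.default I.pre I.loop I.time

theorem code_eq : I.code =
    ((frontOfInstance I).nums.map numTok ++ formToks I.formula).flatMap Tok.word := by
  have h1 : ((frontOfInstance I).nums.map numTok).flatMap Tok.word =
      (frontOfInstance I).nums.flatMap unary := by
    rw [List.flatMap_map]; rfl
  rw [List.flatMap_append, flatMap_formToks, h1]
  simp only [MCInstance.code, frontOfInstance, frontOf, Front.nums, rangeCards, modelTable,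
    CausalModel.code, asgRanks, eqnRanks, exoRanks, endoRanks, List.flatMap_cons,
    List.flatMap_append, List.flatMap_assoc, List.flatMap_map, List.flatMap_nil,
    List.append_assoc, List.append_nil]

theorem pos_of_cpltl {p q : ℕ} {S : Signature (Fin p) (Fin q)} (φ : CPLTL S) : 0 < q := by
  induction φ with
  | box int ψ => exact pos_of_pltl ψ
  | _ => assumption

theorem fst_ne_tick_of_mem_formToks {p q : ℕ} {S : Signature (Fin p) (Fin q)} (φ : CPLTL S) :
    ∀ t ∈ formToks φ, t.1 ≠ .tick := by
  have key : ∀ ψ : PLTL S, ∀ t ∈ pathToks ψ, t.1 ≠ .tick := by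
    intro ψ
    induction ψ with
    | atom X x => simp [pathToks, numTok]
    | neg φ ih | nxt φ ih | prv φ ih =>
      rw [pathToks, List.forall_mem_cons]
      exact ⟨by simp, ih⟩
    | conj φ ψ ihφ ihψ | untl φ ψ ihφ ihψ | snce φ ψ ihφ ihψ =>
      rw [pathToks, List.forall_mem_cons, List.forall_mem_append]
      exact ⟨by simp, ihφ, ihψ⟩
  induction φ with
  | box int ψ =>
    rw [formToks, List.forall_mem_cons, List.forall_mem_append, List.forall_mem_cons]
    refine ⟨by simp, fun t ht => ?_, by simp, key ψ⟩
    obtain ⟨e, -, ht⟩ := List.mem_flatMap.1 ht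
    simp only [setToks, List.mem_cons, List.not_mem_nil, or_false, numTok] at ht
    rcases ht with rfl | rfl | rfl | rfl <;> simp
  | neg φ ih =>
    rw [formToks, List.forall_mem_cons]
    exact ⟨by simp, ih⟩
  | conj φ ψ ihφ ihψ =>
    rw [formToks, List.forall_mem_cons, List.forall_mem_append]
    exact ⟨by simp, ihφ, ihψ⟩

theorem accept_code (h : I.Holds) : accept I.code = true := by
  have hq := pos_of_cpltl I.formula
  have hlex : lex I.code = (frontOfInstance I).nums.map numTok ++ formToks I.formula := by
    rw [code_eq, lex_flatMap_word]
    rw [List.forall_mem_append]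
    refine ⟨fun t ht => ?_, fst_ne_tick_of_mem_formToks _⟩
    obtain ⟨n, -, rfl⟩ := List.mem_map.1 ht
    simp [numTok]
  have hsnd : ∀ l : List ℕ, (l.map numTok).map (fun t => t.2) = l := fun l => by
    simp [Function.comp_def, numTok]
  have hread : readFront ((lex I.code).map fun t => t.2) = frontOfInstance I := by
    rw [hlex, List.map_append, hsnd]
    exact readFront_nums hq _
  have hparse := parse_formToks (time := I.time) (v := I.default) (M := I.model) I.pre I.loop
    I.loop_pos I.periodic hq I.formula (ts := []) (ss := []) rfl
  rw [List.append_nil] at hparse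
  have hcheck : (frontOfInstance I).check = true := check_frontOf I.loop_pos
  simp only [accept]
  rw [hread, hlex, acceptToks, List.take_left' (by simp), List.drop_left' (by simp), hsnd,
    frontOfInstance, hparse, ← frontOfInstance, hcheck]
  have h' : I.formula.Holds I.model I.context I.default I.time := h
  simp [(eqList_iff _ _).2, numTok, acceptItems, Phrase.item, h', Item.truth]

/-- Reading the numbers fills gaps with defaults and ignores separators. The later comparison of the
tokens with `E.nums` and with `bar` excludes such words, so the instance found spells exactly `w`.
-/
theorem exists_of_accept {w : List CodeSym} (h : accept w = true) :
    ∃ I : MCInstance, I.code = w ∧ I.Holds := by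
  simp only [accept, acceptToks, Bool.and_eq_true, eqList_iff] at h
  have hrows := rows_readFront ((lex w).map fun t => t.2)
  generalize readFront ((lex w).map fun t => t.2) = E at h hrows
  obtain ⟨⟨⟨hcheck, hnums⟩, hbar⟩, hitems⟩ := h
  have hloop : 0 < E.loop := by
    simp only [Front.check, Bool.and_eq_true, Nat.ble_eq] at hcheck
    exact hcheck.1.1.2
  obtain ⟨S, M, u, v, hu, hE⟩ := exists_frontOf hcheck (hrows hcheck)
  simp only [acceptItems, Bool.and_eq_true, beq_iff_eq] at hitems
  obtain ⟨⟨⟨h1, h2⟩, h3⟩, h4⟩ := hitems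
  have hrep : Represents M u v E.time ((lex w).drop E.nums.length)
      (parse E ((lex w).drop E.nums.length)).2 := by
    refine represents_parse E.pre E.loop hloop hu ?_
    rw [← hE, ← h1]
  obtain ⟨ss, hss, htoks⟩ := hrep
  rw [← hss] at h2 h3 h4
  obtain ⟨φ, ss, rfl⟩ := eq_truth_cons h3
  rw [List.map_cons, List.tail_cons, List.isEmpty_iff, List.map_eq_nil_iff] at h2
  subst h2
  let I : MCInstance := ⟨E.numExo, E.numEndo, S, M, u, E.pre, E.loop, hloop, hu, v, E.time, φ⟩
  refine ⟨I, ?_, ?_⟩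
  · rw [code_eq, ← flatMap_word_lex w]
    congr 1
    rw [← List.take_append_drop E.nums.length (lex w)]
    refine congrArg₂ _ ?_ ?_
    · have : frontOfInstance I = E := hE.symm
      rw [this]
      rw [List.all_eq_true] at hbar
      generalize (lex w).take E.nums.length = l at hnums hbar ⊢
      rw [← hnums, List.map_map]
      refine (List.map_congr_left fun t ht => ?_).trans (List.map_id l)
      exact Prod.ext (beq_iff_eq.1 (hbar t ht)).symm rfl
    · rw [← htoks]
      simp [Phrase.toks, I]
  · by_contra hI
    have h' : ¬ φ.Holds M u v E.time := hI
    simp [Phrase.item, Item.truth, h'] at h4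

theorem inP_cpltlModelChecking : InP cpltlModelChecking :=
  inP_of_poly accept Poly.accept fun _ =>
    ⟨exists_of_accept, fun ⟨I, hI, h⟩ => hI ▸ accept_code I h⟩

end TreeProg

end

noncomputable section

namespace TreeProg

/-! ### The length of the encoding -/

theorem length_unary (n : ℕ) : (unary n).length = n + 1 := by simp [unary]

theorem length_flatMap_le {α β : Type*} {l : List α} {f : α → List β} {B : ℕ}
    (h : ∀ a ∈ l, (f a).length ≤ B) : (l.flatMap f).length ≤ l.length * B := by
  rw [List.length_flatMap]
  simpa using List.sum_le_card_nsmul (l.map fun a => (f a).length) B (by simpa using h)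

section

variable {p q : ℕ} {S : Signature (Fin p) (Fin q)}

theorem length_asgs : S.asgs.length = ∏ Z, (S.range Z).card := by
  have key : ∀ (Zs : List (Fin p ⊕ Fin q)) (z : S.Asg),
      (S.asgsFrom Zs z).length = (Zs.map fun Z => (S.range Z).card).prod := by
    intro Zs
    induction Zs with
    | nil => intro z; rfl
    | cons Z Zs ih => intro z; simp [Signature.asgsFrom, List.length_flatMap, ih]
  rw [Signature.asgs, key, ← List.prod_toFinset _ nodup_varList]
  congr 1
  exact Finset.eq_univ_iff_forall.2 fun Z => List.mem_toFinset.2 (mem_varList Z)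

theorem length_unary_rank_le {B : ℕ} (hB : ∀ Z, (S.range Z).card ≤ B) {Z : Fin p ⊕ Fin q}
    (x : S.Val Z) : (unary (S.rank x)).length ≤ B := by
  rw [length_unary]
  exact (rank_lt S x).trans_le (hB Z)

theorem PLTL.length_code_le {B C : ℕ} (hq : q ≤ B) (hC : C = B + 2)
    (hB : ∀ Z, (S.range Z).card ≤ B) (ψ : PLTL S) :
    ψ.code.length ≤ ψ.size * C := by
  induction ψ with
  | atom X x =>
    have h1 := length_unary_rank_le hB x
    have h2 := X.2
    simp only [PLTL.code, PLTL.size, List.length_cons, List.length_append, length_unary] at h1 ⊢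
    omega
  | neg φ ih | nxt φ ih | prv φ ih =>
    simp only [PLTL.code, PLTL.size, List.length_cons, Nat.add_mul, Nat.one_mul]
    omega
  | conj φ ψ ihφ ihψ | untl φ ψ ihφ ihψ | snce φ ψ ihφ ihψ =>
    simp only [PLTL.code, PLTL.size, List.length_cons, List.length_append, Nat.add_mul, Nat.one_mul]
    omega

theorem CPLTL.length_code_le {B C : ℕ} (hq : q ≤ B) (hC : C = B + 2)
    (hB : ∀ Z, (S.range Z).card ≤ B)
    (φ : CPLTL S) : φ.code.length ≤ φ.size * C := by
  induction φ with
  | box int ψ =>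
    have h1 : (int.entries.flatMap TimedSetting.code).length ≤
        (int.entries.map fun e => e.time + 5).sum * C := by
      induction int.entries with
      | nil => simp
      | cons e es ih =>
        have h1 := length_unary_rank_le hB e.val
        have h2 := e.var.2
        have h3 : e.time ≤ e.time * C := Nat.le_mul_of_pos_right _ (by omega)
        simp only [List.flatMap_cons, List.length_append, List.map_cons, List.sum_cons,
          TimedSetting.code, List.length_cons, length_unary, Nat.add_mul] at h1 ⊢
        omega
    have h2 := PLTL.length_code_le hq hC hB ψ
    simp only [CPLTL.code, CPLTL.size, List.length_append, List.length_cons, List.length_nil,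
      Nat.add_mul]
    omega
  | neg φ ih =>
    simp only [CPLTL.code, CPLTL.size, List.length_cons, Nat.add_mul, Nat.one_mul]
    omega
  | conj φ ψ ihφ ihψ =>
    simp only [CPLTL.code, CPLTL.size, List.length_cons, List.length_append, Nat.add_mul, Nat.one_mul]
    omega

theorem CausalModel.length_code_le {B : ℕ} (hpq : p + q ≤ B) (hB : ∀ Z, (S.range Z).card ≤ B)
    (hasg : ∏ Z, (S.range Z).card ≤ B) (M : CausalModel S) :
    M.code.length ≤ B * (B * B + B * B) := by
  refine (length_flatMap_le (B := B * B + B * B) fun z _ => ?_).trans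
    (Nat.mul_le_mul_right _ (length_asgs.trans_le hasg))
  rw [List.length_append]
  refine Nat.add_le_add ?_ ?_
  · refine (length_flatMap_le fun Z _ => length_unary_rank_le hB _).trans
      (Nat.mul_le_mul_right _ ?_)
    simpa [varList] using hpq
  · refine (length_flatMap_le fun Z _ => length_unary_rank_le hB _).trans
      (Nat.mul_le_mul_right _ ?_)
    rw [List.length_finRange]
    omega

end

/-- The summands bound, in this order, the five single numbers, the sizes of the ranges, the table,
the context, the default assignment and the formula. -/
theorem length_code_le (I : MCInstance) : I.code.length ≤
    (5 * (I.size + 1) + I.size * (I.size + 1) + I.size * (I.size * I.size + I.size * I.size) +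
      I.size * (I.size * I.size) + I.size * I.size + I.size * (I.size + 2)) := by
  have hsize := I.size.le_refl
  conv_lhs at hsize => rw [MCInstance.size, CausalModel.size]
  simp only [Fintype.card_fin] at hsize
  generalize I.size = B at hsize ⊢
  have hq := pos_of_cpltl I.formula
  -- The size counts the rows multiplied by the number of endogenous variables. It bounds the rows
  -- themselves because the formula forces that number to be positive.
  have hprod : ∏ Z, (I.sig.range Z).card ≤ I.numEndo * ∏ Z, (I.sig.range Z).card :=
    Nat.le_mul_of_pos_left _ hq
  have hsum : ∀ Z, (I.sig.range Z).card ≤ ∑ Z, (I.sig.range Z).card := fun Z =>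
    Finset.single_le_sum (f := fun Z => (I.sig.range Z).card) (fun _ _ => Nat.zero_le _)
      (Finset.mem_univ Z)
  have hB : ∀ Z, (I.sig.range Z).card ≤ B := fun Z => (hsum Z).trans (by omega)
  have h1 : ((varList I.numExo I.numEndo).flatMap fun Z =>
      unary (I.sig.range Z).card).length ≤ B * (B + 1) := by
    refine (length_flatMap_le (B := B + 1) fun Z _ => ?_).trans (Nat.mul_le_mul_right _ ?_)
    · rw [length_unary]
      have := hB Z
      omega
    · simp only [varList, List.length_append, List.length_map, List.length_finRange]
      omega
  have h2 := CausalModel.length_code_le (by omega) hB (by omega) I.model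
  have h3 : ((List.range (I.pre + I.loop)).flatMap fun j =>
      (List.finRange I.numExo).flatMap fun X => unary (I.sig.rank (I.context j X))).length ≤
      B * (B * B) := by
    refine (length_flatMap_le (B := B * B) fun j _ => ?_).trans (Nat.mul_le_mul_right _ ?_)
    · refine (length_flatMap_le fun X _ => length_unary_rank_le hB _).trans
        (Nat.mul_le_mul_right _ ?_)
      rw [List.length_finRange]
      omega
    · rw [List.length_range]
      omega
  have h4 : ((List.finRange I.numEndo).flatMap fun X =>
      unary (I.sig.rank (I.default X))).length ≤ B * B := by
    refine (length_flatMap_le fun X _ => length_unary_rank_le hB _).trans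
      (Nat.mul_le_mul_right _ ?_)
    rw [List.length_finRange]
    omega
  have h5 := (CPLTL.length_code_le (by omega) rfl hB I.formula).trans
    (Nat.mul_le_mul_right (B + 2) (show I.formula.size ≤ B by omega))
  simp only [MCInstance.code, List.length_append, length_unary]
  have h6 : I.pre + I.loop ≤ B := by omega
  have h7 : I.numExo + I.numEndo ≤ B := by omega
  have h8 : I.time ≤ B := by omega
  clear hsize hsum hprod hB
  omega

end TreeProg

end

theorem mainTheorem1 :
    InP cpltlModelChecking ∧
      ∃ P : Polynomial ℕ, ∀ I : MCInstance, I.code.length ≤ P.eval I.size := by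
  let X : Polynomial ℕ := Polynomial.X
  refine ⟨TreeProg.inP_cpltlModelChecking,
    5 * (X + 1) + X * (X + 1) + X * (X * X + X * X) + X * (X * X) + X * X + X * (X + 2),
    fun I => ?_⟩
  simpa [X] using TreeProg.length_code_le I
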